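/- Let $\mathbb K\in\{\mathbb R,\mathbb C\}$. **Chains.** An *sc-chain* $\mathbb E$ is a sequence of Banach spaces $E_0\supseteq E_1\supseteq E_2\supseteq\cdots$ over $\mathbb K$ whose inclusions $\iota^{j+1}_{j}:E_{j+1}\to E_j$ are injective, compact, of norm at most $1$ and have dense image. Write $\iota^n_m : E_n\to E_m$ ($m\le n$) for the compositions, $E_\infty=\bigcap_j E_j$ (with the projective limit topology) and $\iota^\infty_j:E_\infty\to E_j$. For a strictly increasing sequence $\mathbf k=(k_j)$ in $\mathbb N_0$ the *rescaling* $\mathbb E^{\mathbf k}$ is the sc-chain $(E_{k_j})_j$; it is *tame* if $k_j\le j+c$ for some $c$ and all $j$. An *operator* $\mathbb T:\mathbb E\to\mathbb E'$ is a sequence of continuous linear maps $T_j:E_j\to E'_j$ commuting with the inclusions. A continuous linear map $T:E_\infty\to E'_\infty$ is a *weak embedding* if it extends to an operator $\mathbb E^{\mathbf k}\to\mathbb E'^{\mathbf l}$ between rescalings with all components injective, and is *tame* if it extends to an operator $\mathbb E^{\mathbf k}\to\mathbb E'$ with $\mathbf k$ tame. A *tame equivalence* is a topological linear isomorphism $J:E_\infty\to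 E'_\infty$ such that $J$ and $J^{-1}$ are tame weak embeddings. The direct sum of two sc-chains is formed levelwise. **Smoothing operators.** $\mathbb E$ *admits smoothing operators* if there are a continuous map $[0,\infty)\times E_0\to E_\infty$, $(t,e)\mapsto \overline S_te$, linear in $e$, and constants $p\in\mathbb N_0$, $C^k_l\ge0$ such that $S^k_{l,t}:=\iota^\infty_l\circ\overline S_t\circ\iota^k_0:E_k\to E_l$ satisfies, for all $k,l\in\mathbb N_0$ and $t\ge 0$, $$\|S^k_{l,t}\|\le C^k_l\bigl(1+e^{(p+(l-k))t}\bigr),\qquad \|\iota^k_l-S^k_{l,t}\|\le C^k_l\,e^{(p-(k-l))t}\ \text{ if }k-l\ge p .$$ $\mathbb E$ is *weakly tame* if some tame rescaling of it admits smoothing operators. **Spaces.** An *$\overline{\mathrm{sc}}$-structure* on a topological vector space $E$ is a pair $(\mathbb E,\phi)$ of an sc-chain and an isomorphism of topological vector spaces $\phi:E_\infty\to E$; $(\mathbb E,\phi)$ and $(\tilde{\mathbb E},\tilde\phi)$ are *tamely equivalent* if $\phi=\tilde\phi\circ J$ for a tame equivalence $J$. A *pre-tame $\overline{\mathrm{sc}}$-Fréchet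 space* is a topological vector space with a tame equivalence class of $\overline{\mathrm{sc}}$-structures, called *tamely compatible*. It is *weakly tame* if it has a tamely compatible structure $(\mathbb E,\phi)$ with $\mathbb E$ weakly tame. The direct sum $E\oplus F$ carries the class of the direct sums of tamely compatible structures. For a structure $(\mathbb E,\phi)$ on $E$ and $e\in E$ write $\|e\|_j:=\|\iota^\infty_j\phi^{-1}(e)\|_{E_j}$. **Maps.** Let $E,F$ be pre-tame $\overline{\mathrm{sc}}$-Fréchet spaces, $U\subseteq E$ open and $f:U\to F$ a map. * $f$ is $\underline{\mathrm{sc}}^0$ (equivalently, by convention, p-$\underline{\mathrm{sc}}^0$) if every $x\in U$ has a neighbourhood $V\subseteq U$ and tamely compatible structures on $E$ and $F$ such that for all $j\in\mathbb N_0$ the set $V$ is open in $(E,\|\cdot\|_j)$ and $f|_V$ is continuous from $\|\cdot\|_j$ to $\|\cdot\|_j$. * An $\underline{\mathrm{sc}}^0$ map $f$ is *tame* if every $x\in U$ has a neighbourhood $V\subseteq U$ and tamely compatible structures on $E$ and $F$ such that for every $j$ there is $C_j\ge 0$ with $\|f(e)\|_j\le C_j(1+\|e\|_j)$ for all $e\in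 V$. * $f$ is *weakly Fréchet differentiable* at $x\in U$ with derivative the continuous linear map $Df(x)=L:E\to F$ if there is a convex balanced neighbourhood $V$ of $0$ with $x+V\subseteq U$ such that $r:V\times[0,1]\to F$, $r(u,t)=\frac1t(f(x+tu)-f(x))-Lu$ for $t>0$ and $r(u,0)=0$, is continuous; it is *pointwise* weakly Fréchet differentiable if one only asks that $r|_{A\times[0,1]}$ is continuous for each finite $A\subseteq V$. * For $k\ge1$, $f$ is $\underline{\mathrm{sc}}^k$ (resp. p-$\underline{\mathrm{sc}}^k$) if it is $\underline{\mathrm{sc}}^0$, weakly (resp. pointwise weakly) Fréchet differentiable at every point of $U$, and $Df:U\times E\to F$, $(x,u)\mapsto Df(x)u$, is $\underline{\mathrm{sc}}^{k-1}$ (resp. p-$\underline{\mathrm{sc}}^{k-1}$). It is (p-)$\underline{\mathrm{sc}}^\infty$ if it is (p-)$\underline{\mathrm{sc}}^k$ for all $k\in\mathbb N_0$. * If $f$ is (p-)$\underline{\mathrm{sc}}^k$, it is *tame up to order $k$* if $D^jf:U\times E^j\to F$ is tame for every $j\in\mathbb N_0$ with $j\le k$, where $D^0f=f$, $D^1f=Df$,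 and $D^{j+1}f(x)(u_1,\dots,u_{j+1})$ is the derivative of $x\mapsto D^jf(x)(u_1,\dots,u_j)$ in the direction $u_{j+1}$. **Theorem (Nash–Moser inverse function theorem).** Let $E$ and $E'$ be pre-tame $\overline{\mathrm{sc}}$-Fréchet spaces with $E$ weakly tame, let $k\in\mathbb N_0\cup\{\infty\}$ with $k\ge2$, let $U\subseteq E$ be open, and let $f:U\to E'$ be $\underline{\mathrm{sc}}^k$ (resp. p-$\underline{\mathrm{sc}}^k$) and tame up to order $k$. Suppose that $\psi:U\times E'\to E$ is $\underline{\mathrm{sc}}^0$, tame, linear in the second variable, and inverse to $Df$, that is, $\psi(x,Df(x)u)=u$ and $Df(x)\psi(x,v)=v$ for all $x\in U$, $u\in E$, $v\in E'$. Then: 1. every $x\in U$ has an open neighbourhood $V\subseteq U$ such that $f(V)\subseteq E'$ is open and there is a map $g:f(V)\to V$ with $g\circ f|_V=\mathrm{id}_V$ and $f|_V\circ g=\mathrm{id}_{f(V)}$; 2. whenever $V\subseteq U$ is open, $f(V)$ is open and $g:f(V)\to V$ is inverse to $f|_V:V\to f(V)$, then $g$ is $\underline{\mathrm{sc}}^k$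 (resp. p-$\underline{\mathrm{sc}}^k$), tame up to order $k$, and $Dg=g^*\psi$, i.e. $Dg(y)v=\psi(g(y),v)$ for all $y\in f(V)$, $v\in E'$. -/

import Mathlib

open Set Filter Topology
open scoped NNReal

universe w u v u'

/-! ### sc-chains -/

/-- An sc-chain: Banach spaces `X 0 ⊇ X 1 ⊇ …` with injective, dense, compact inclusions of norm at
most one. -/
structure ScChain (𝕜 : Type w) [RCLike 𝕜] where
  X : ℕ → Type u
  [normed : ∀ k, NormedAddCommGroup (X k)]
  [space : ∀ k, NormedSpace 𝕜 (X k)]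
  [complete : ∀ k, CompleteSpace (X k)]
  ι : ∀ k, X (k + 1) →L[𝕜] X k
  ι_injective : ∀ k, Function.Injective (ι k)
  ι_dense : ∀ k, DenseRange (ι k)
  ι_norm : ∀ k, ‖ι k‖ ≤ 1
  ι_compact : ∀ k, IsCompactOperator (ι k)

attribute [instance] ScChain.normed ScChain.space ScChain.complete

namespace ScChain

variable {𝕜 : Type w} [RCLike 𝕜]

/-- The inclusion `ι^n_m : X n → X m` for `m ≤ n`. -/
def incl (C : ScChain.{w, u} 𝕜) {m n : ℕ} (h : m ≤ n) : C.X n →L[𝕜] C.X m :=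
  Nat.leRec (motive := fun n _ => C.X n →L[𝕜] C.X m) (ContinuousLinearMap.id 𝕜 (C.X m))
    (fun n _ f => f.comp (C.ι n)) h

theorem incl_self (C : ScChain.{w, u} 𝕜) (m : ℕ) :
    C.incl (le_refl m) = ContinuousLinearMap.id 𝕜 (C.X m) := by
  unfold incl
  exact Nat.leRec_self _ _

theorem incl_succ (C : ScChain.{w, u} 𝕜) {m n : ℕ} (h : m ≤ n) (h' : m ≤ n + 1) :
    C.incl h' = (C.incl h).comp (C.ι n) := by
  unfold incl
  exact Nat.leRec_succ _ _ h

theorem incl_incl (C : ScChain.{w, u} 𝕜) {a b c : ℕ} (h : a ≤ b) (h' : b ≤ c) (x : C.X c) :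
    C.incl h (C.incl h' x) = C.incl (h.trans h') x := by
  induction c, h' using Nat.le_induction with
  | base => simp [incl_self]
  | succ n hn ih =>
    rw [C.incl_succ hn, C.incl_succ (h.trans hn)]
    exact ih _

theorem ι_eq_incl (C : ScChain.{w, u} 𝕜) (n : ℕ) : C.ι n = C.incl (Nat.le_succ n) := by
  rw [C.incl_succ (le_refl n), incl_self]
  rfl

theorem incl_injective (C : ScChain.{w, u} 𝕜) {m n : ℕ} (h : m ≤ n) :
    Function.Injective (C.incl h) := by
  induction n, h using Nat.le_induction with
  | base => rw [incl_self]; exact fun _ _ h => h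
  | succ n hn ih => rw [C.incl_succ hn]; exact ih.comp (C.ι_injective n)

theorem incl_dense (C : ScChain.{w, u} 𝕜) {m n : ℕ} (h : m ≤ n) : DenseRange (C.incl h) := by
  induction n, h using Nat.le_induction with
  | base => rw [incl_self]; exact Function.surjective_id.denseRange
  | succ n hn ih => rw [C.incl_succ hn]; exact ih.comp (C.ι_dense n) (C.incl hn).continuous

theorem incl_norm (C : ScChain.{w, u} 𝕜) {m n : ℕ} (h : m ≤ n) : ‖C.incl h‖ ≤ 1 := by
  induction n, h using Nat.le_induction with
  | base => rw [incl_self]; exact ContinuousLinearMap.norm_id_le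
  | succ n hn ih =>
    rw [C.incl_succ hn]
    exact (ContinuousLinearMap.opNorm_comp_le _ _).trans
      (mul_le_one₀ ih (norm_nonneg _) (C.ι_norm n))

theorem incl_compact (C : ScChain.{w, u} 𝕜) {m n : ℕ} (h : m < n) :
    IsCompactOperator (C.incl h.le) := by
  obtain ⟨n, rfl⟩ : ∃ n', n = n' + 1 := ⟨n - 1, by omega⟩
  rw [C.incl_succ (Nat.lt_succ_iff.mp h)]
  exact (C.ι_compact n).clm_comp (C.incl _)

/-- `E_∞ = ⋂ X k`, as the space of compatible sequences, with the weakest topology making all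
inclusions `E_∞ → X k` continuous. -/
def infty (C : ScChain.{w, u} 𝕜) : Submodule 𝕜 (∀ k, C.X k) where
  carrier := {x | ∀ k, C.ι k (x (k + 1)) = x k}
  add_mem' := by
    intro a b ha hb k
    simp only [mem_ofPred_eq] at ha hb
    simp [ha k, hb k]
  zero_mem' := by intro k; simp
  smul_mem' := by
    intro c x hx k
    simp only [mem_ofPred_eq] at hx
    simp [hx k]

/-- The inclusion `ι^∞_k : E_∞ → X k`. -/
def pr (C : ScChain.{w, u} 𝕜) (k : ℕ) : C.infty →L[𝕜] C.X k :=
  (ContinuousLinearMap.proj k).comp C.infty.subtypeL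

theorem incl_pr (C : ScChain.{w, u} 𝕜) {m n : ℕ} (h : m ≤ n) (x : C.infty) :
    C.incl h (C.pr n x) = C.pr m x := by
  induction n, h using Nat.le_induction with
  | base => simp [incl_self]
  | succ n hn ih =>
    rw [C.incl_succ hn, ← ih]
    exact congrArg _ (x.2 n)

/-- The rescaling `j ↦ X (k j)` of a chain by a strictly increasing sequence. -/
@[reducible] def rescale (C : ScChain.{w, u} 𝕜) (k : ℕ → ℕ) (hk : StrictMono k) :
    ScChain.{w, u} 𝕜 where
  X j := C.X (k j)
  ι j := C.incl (hk (Nat.lt_succ_self j)).le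
  ι_injective _ := C.incl_injective _
  ι_dense _ := C.incl_dense _
  ι_norm _ := C.incl_norm _
  ι_compact j := C.incl_compact (hk (Nat.lt_succ_self j))

theorem rescale_incl (C : ScChain.{w, u} 𝕜) (k : ℕ → ℕ) (hk : StrictMono k) {m n : ℕ}
    (h : m ≤ n) : (C.rescale k hk).incl h = C.incl (hk.monotone h) := by
  induction n, h using Nat.le_induction with
  | base => rw [incl_self, incl_self]
  | succ n hn ih =>
    rw [incl_succ _ hn, ih]
    ext x
    exact C.incl_incl _ _ x

/-- The direct sum of two chains. The maximum norm is used; it is equivalent at each level to the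
sum of the norms, so that it defines the same tame equivalence class. -/
@[reducible] def prod (C : ScChain.{w, u} 𝕜) (D : ScChain.{w, v} 𝕜) :
    ScChain.{w, max u v} 𝕜 where
  X k := C.X k × D.X k
  ι k := (C.ι k).prodMap (D.ι k)
  ι_injective k := (C.ι_injective k).prodMap (D.ι_injective k)
  ι_dense k := (C.ι_dense k).prodMap (D.ι_dense k)
  ι_norm k := by
    refine ContinuousLinearMap.opNorm_le_bound _ zero_le_one fun x => ?_
    rw [one_mul]
    have h1 : ‖C.ι k x.1‖ ≤ ‖x.1‖ := by
      simpa using (C.ι k).le_of_opNorm_le (C.ι_norm k) x.1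
    have h2 : ‖D.ι k x.2‖ ≤ ‖x.2‖ := by
      simpa using (D.ι k).le_of_opNorm_le (D.ι_norm k) x.2
    exact max_le_max h1 h2
  ι_compact k := by
    obtain ⟨K, hK, h⟩ := C.ι_compact k
    obtain ⟨L, hL, h'⟩ := D.ι_compact k
    exact ⟨K ×ˢ L, hK.prod hL, prod_mem_nhds h h'⟩

/-- The canonical identification of the limit of a direct sum. -/
def prodInfty (C : ScChain.{w, u} 𝕜) (D : ScChain.{w, v} 𝕜) :
    (C.prod D).infty ≃L[𝕜] C.infty × D.infty where
  toFun x := (⟨fun k => (x.1 k).1, fun k => congrArg Prod.fst (x.2 k)⟩,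
    ⟨fun k => (x.1 k).2, fun k => congrArg Prod.snd (x.2 k)⟩)
  invFun y := ⟨fun k => (y.1.1 k, y.2.1 k), fun k => Prod.ext (y.1.2 k) (y.2.2 k)⟩
  left_inv _ := rfl
  right_inv _ := rfl
  map_add' _ _ := rfl
  map_smul' _ _ := rfl
  continuous_toFun := by
    refine Continuous.prodMk ?_ ?_
    · exact Continuous.subtype_mk (continuous_pi fun k =>
        continuous_fst.comp ((continuous_apply k).comp continuous_subtype_val)) _
    · exact Continuous.subtype_mk (continuous_pi fun k =>
        continuous_snd.comp ((continuous_apply k).comp continuous_subtype_val)) _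
  continuous_invFun := by
    refine Continuous.subtype_mk (continuous_pi fun k => Continuous.prodMk ?_ ?_) _
    · exact (continuous_apply k).comp (continuous_subtype_val.comp continuous_fst)
    · exact (continuous_apply k).comp (continuous_subtype_val.comp continuous_snd)

/-! ### Operators, weak morphisms and tame equivalence -/

/-- A continuous linear operator between chains. -/
structure Op (C : ScChain.{w, u} 𝕜) (D : ScChain.{w, v} 𝕜) where
  T : ∀ k, C.X k →L[𝕜] D.X k
  comm : ∀ k x, T k (C.ι k x) = D.ι k (T (k + 1) x)

/-- `T : E_∞ → E'_∞` is a weak embedding: it extends to an embedding between rescalings. -/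
def IsWeakEmbedding {C : ScChain.{w, u} 𝕜} {D : ScChain.{w, v} 𝕜} (T : C.infty →L[𝕜] D.infty) :
    Prop :=
  ∃ (k l : ℕ → ℕ) (hk : StrictMono k) (hl : StrictMono l)
    (S : Op (C.rescale k hk) (D.rescale l hl)),
    (∀ j, Function.Injective (S.T j)) ∧ ∀ x j, S.T j (C.pr (k j) x) = D.pr (l j) (T x)

end ScChain

/-- Tame sequences of indices: strictly increasing and bounded above by a shift. -/
def IsTameSeq (k : ℕ → ℕ) : Prop :=
  StrictMono k ∧ ∃ c, ∀ j, k j ≤ j + c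

namespace ScChain

variable {𝕜 : Type w} [RCLike 𝕜]

/-- `T : E_∞ → E'_∞` is a tame weak morphism: it extends to an operator defined on a tame
rescaling of the domain. -/
def IsTameMorphism {C : ScChain.{w, u} 𝕜} {D : ScChain.{w, v} 𝕜} (T : C.infty →L[𝕜] D.infty) :
    Prop :=
  ∃ (k : ℕ → ℕ) (hk : IsTameSeq k) (S : Op (C.rescale k hk.1) D),
    ∀ x j, S.T j (C.pr (k j) x) = D.pr j (T x)

/-- Tame equivalences of chains. -/
def IsTameEquivalence {C : ScChain.{w, u} 𝕜} {D : ScChain.{w, v} 𝕜} (J : C.infty ≃L[𝕜] D.infty) :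
    Prop :=
  (IsWeakEmbedding J.toContinuousLinearMap ∧ IsTameMorphism J.toContinuousLinearMap) ∧
    IsWeakEmbedding J.symm.toContinuousLinearMap ∧ IsTameMorphism J.symm.toContinuousLinearMap

/-- A chain admits smoothing operators: there is a jointly continuous family of linear maps
`S t : E_0 → E_∞`, `t ≥ 0`, such that `S^k_{l,t} = ι^∞_l ∘ S t ∘ ι^k_0 : E_k → E_l` satisfies the two
smoothing estimates, with a fixed loss `p`. -/
def AdmitsSmoothing (C : ScChain.{w, u} 𝕜) : Prop :=
  ∃ S : ℝ≥0 → C.X 0 →L[𝕜] C.infty,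
    Continuous (fun q : ℝ≥0 × C.X 0 => S q.1 q.2) ∧
    ∃ (p : ℕ) (c : ℕ → ℕ → ℝ≥0),
      (∀ (k l : ℕ) (t : ℝ≥0),
        ‖(C.pr l).comp ((S t).comp (C.incl (Nat.zero_le k)))‖ ≤
          c k l * (1 + Real.exp (((p : ℝ) + ((l : ℝ) - k)) * t))) ∧
      ∀ (k l : ℕ) (h : l ≤ k) (t : ℝ≥0), l + p ≤ k →
        ‖C.incl h - (C.pr l).comp ((S t).comp (C.incl (Nat.zero_le k)))‖ ≤
          c k l * Real.exp (((p : ℝ) - ((k : ℝ) - l)) * t)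

/-- A chain is weakly tame if some tame rescaling of it admits smoothing operators. -/
def IsWeaklyTame (C : ScChain.{w, u} 𝕜) : Prop :=
  ∃ (k : ℕ → ℕ) (hk : IsTameSeq k), (C.rescale k hk.1).AdmitsSmoothing

/-! #### Tame equivalence is compatible with composition and direct sums -/

theorem Op.comm_incl {C : ScChain.{w, u} 𝕜} {D : ScChain.{w, v} 𝕜} (S : Op C D) {m n : ℕ}
    (h : m ≤ n) (x : C.X n) : S.T m (C.incl h x) = D.incl h (S.T n x) := by
  induction n, h using Nat.le_induction with
  | base => simp [incl_self]
  | succ n hn ih =>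
    rw [C.incl_succ hn, D.incl_succ hn]
    change S.T m (C.incl hn (C.ι n x)) = D.incl hn (D.ι n (S.T (n + 1) x))
    rw [ih, S.comm]

/-- The composition of `S` and `R` after rescaling `S`. -/
def Op.compRescale {C : ScChain.{w, u} 𝕜} {D : ScChain.{w, v} 𝕜} {B : ScChain.{w, u'} 𝕜}
    {k m : ℕ → ℕ} {hk : StrictMono k} {hm : StrictMono m} (R : Op (D.rescale m hm) B)
    (S : Op (C.rescale k hk) D) : Op (C.rescale (k ∘ m) (hk.comp hm)) B where
  T j := (R.T j).comp (S.T (m j))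
  comm j x := by
    have h : m j ≤ m (j + 1) := (hm (Nat.lt_succ_self j)).le
    have h1 := S.comm_incl h x
    rw [rescale_incl] at h1
    change R.T j (S.T (m j) (C.incl _ x)) = B.ι j (R.T (j + 1) (S.T (m (j + 1)) x))
    rw [h1]
    exact R.comm j (S.T (m (j + 1)) x)

/-- Forgetting a rescaling of the target. -/
def Op.unscale {C : ScChain.{w, u} 𝕜} {D : ScChain.{w, v} 𝕜} {l : ℕ → ℕ} {hl : StrictMono l}
    (S : Op C (D.rescale l hl)) : Op C D where
  T j := (D.incl (hl.le_apply : j ≤ l j)).comp (S.T j)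
  comm j x := by
    change D.incl _ (S.T j (C.ι j x)) = D.ι j (D.incl _ (S.T (j + 1) x))
    rw [S.comm, D.ι_eq_incl, D.incl_incl, D.incl_incl]

/-- Restricting an operator to a finer rescaling of its domain. -/
def Op.restrict {C : ScChain.{w, u} 𝕜} {D : ScChain.{w, v} 𝕜} {k m : ℕ → ℕ} {hk : StrictMono k}
    (S : Op (C.rescale k hk) D) (hm : StrictMono m) (h : ∀ j, k j ≤ m j) :
    Op (C.rescale m hm) D where
  T j := (S.T j).comp (C.incl (h j))
  comm j x := by
    change S.T j (C.incl (h j) (C.incl _ x)) = D.ι j (S.T (j + 1) (C.incl (h (j + 1)) x))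
    rw [← S.comm]
    change S.T j _ = S.T j (C.incl _ (C.incl _ x))
    rw [C.incl_incl, C.incl_incl]

/-- The direct sum of two operators. -/
def Op.prod {C : ScChain.{w, u} 𝕜} {D : ScChain.{w, v} 𝕜} {C' : ScChain.{w, u} 𝕜}
    {D' : ScChain.{w, v} 𝕜} {m : ℕ → ℕ} {hm : StrictMono m} (S : Op (C.rescale m hm) C')
    (R : Op (D.rescale m hm) D') : Op ((C.prod D).rescale m hm) (C'.prod D') where
  T j := (S.T j).prodMap (R.T j)
  comm j x := by
    have key : ∀ {a b : ℕ} (h : a ≤ b) (y : C.X b × D.X b),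
        (C.prod D).incl h y = (C.incl h y.1, D.incl h y.2) := by
      intro a b h
      induction b, h using Nat.le_induction with
      | base => intro y; simp [incl_self]
      | succ n hn ih =>
        intro y
        rw [incl_succ _ hn, C.incl_succ hn, D.incl_succ hn]
        exact ih _
    refine Prod.ext ?_ ?_
    · change S.T j ((C.prod D).incl _ x).1 = C'.ι j (S.T (j + 1) x.1)
      rw [key, ← S.comm]
    · change R.T j ((C.prod D).incl _ x).2 = D'.ι j (R.T (j + 1) x.2)
      rw [key, ← R.comm]

end ScChain

theorem IsTameSeq.comp {k m : ℕ → ℕ} (hk : IsTameSeq k) (hm : IsTameSeq m) :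
    IsTameSeq (k ∘ m) := by
  obtain ⟨c, hc⟩ := hk.2
  obtain ⟨d, hd⟩ := hm.2
  refine ⟨hk.1.comp hm.1, d + c, fun j => ?_⟩
  have h1 := hc (m j)
  have h2 := hd j
  simp only [Function.comp]
  omega

theorem StrictMono.max_seq {k m : ℕ → ℕ} (hk : StrictMono k) (hm : StrictMono m) :
    StrictMono (fun j => max (k j) (m j)) := fun _ _ h => max_lt_max (hk h) (hm h)

theorem IsTameSeq.max_seq {k m : ℕ → ℕ} (hk : IsTameSeq k) (hm : IsTameSeq m) :
    IsTameSeq (fun j => max (k j) (m j)) := by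
  obtain ⟨c, hc⟩ := hk.2
  obtain ⟨d, hd⟩ := hm.2
  refine ⟨hk.1.max_seq hm.1, c + d, fun j => ?_⟩
  have h1 := hc j
  have h2 := hd j
  exact max_le (by omega) (by omega)

namespace ScChain

variable {𝕜 : Type w} [RCLike 𝕜]

theorem IsWeakEmbedding.normal {C : ScChain.{w, u} 𝕜} {D : ScChain.{w, v} 𝕜}
    {T : C.infty →L[𝕜] D.infty} (h : IsWeakEmbedding T) :
    ∃ (k : ℕ → ℕ) (hk : StrictMono k) (S : Op (C.rescale k hk) D),
      (∀ j, Function.Injective (S.T j)) ∧ ∀ x j, S.T j (C.pr (k j) x) = D.pr j (T x) := by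
  obtain ⟨k, l, hk, hl, S, hS, hT⟩ := h
  refine ⟨k, hk, S.unscale, fun j => (D.incl_injective _).comp (hS j), fun x j => ?_⟩
  change D.incl _ (S.T j (C.pr (k j) x)) = _
  rw [hT, D.incl_pr]

theorem IsWeakEmbedding.of_normal {C : ScChain.{w, u} 𝕜} {D : ScChain.{w, v} 𝕜}
    {T : C.infty →L[𝕜] D.infty} {k : ℕ → ℕ} {hk : StrictMono k} (S : Op (C.rescale k hk) D)
    (hS : ∀ j, Function.Injective (S.T j)) (hT : ∀ x j, S.T j (C.pr (k j) x) = D.pr j (T x)) :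
    IsWeakEmbedding T := by
  refine ⟨k, id, hk, strictMono_id, ⟨fun j => S.T j, fun j x => ?_⟩, hS, hT⟩
  rw [S.comm, ι_eq_incl]

theorem IsWeakEmbedding.comp {C : ScChain.{w, u} 𝕜} {D : ScChain.{w, v} 𝕜} {B : ScChain.{w, u'} 𝕜}
    {R : D.infty →L[𝕜] B.infty} {T : C.infty →L[𝕜] D.infty} (hR : IsWeakEmbedding R)
    (hT : IsWeakEmbedding T) : IsWeakEmbedding (R.comp T) := by
  obtain ⟨k, hk, S, hS, hT⟩ := hT.normal
  obtain ⟨m, hm, Q, hQ, hR⟩ := hR.normal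
  refine .of_normal (Q.compRescale S) (fun j => (hQ j).comp (hS (m j))) fun x j => ?_
  change Q.T j (S.T (m j) (C.pr (k (m j)) x)) = _
  rw [hT, hR]
  rfl

theorem IsTameMorphism.comp {C : ScChain.{w, u} 𝕜} {D : ScChain.{w, v} 𝕜} {B : ScChain.{w, u'} 𝕜}
    {R : D.infty →L[𝕜] B.infty} {T : C.infty →L[𝕜] D.infty} (hR : IsTameMorphism R)
    (hT : IsTameMorphism T) : IsTameMorphism (R.comp T) := by
  obtain ⟨k, hk, S, hT⟩ := hT
  obtain ⟨m, hm, Q, hR⟩ := hR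
  refine ⟨k ∘ m, hk.comp hm, Q.compRescale S, fun x j => ?_⟩
  change Q.T j (S.T (m j) (C.pr (k (m j)) x)) = _
  rw [hT, hR]
  rfl

theorem isWeakEmbedding_id (C : ScChain.{w, u} 𝕜) :
    IsWeakEmbedding (ContinuousLinearMap.id 𝕜 C.infty) :=
  ⟨id, id, strictMono_id, strictMono_id, ⟨fun _ => ContinuousLinearMap.id 𝕜 _, fun _ _ => rfl⟩,
    fun _ _ _ h => h, fun _ _ => rfl⟩

theorem isTameMorphism_id (C : ScChain.{w, u} 𝕜) :
    IsTameMorphism (ContinuousLinearMap.id 𝕜 C.infty) :=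
  ⟨id, ⟨strictMono_id, 0, fun _ => le_rfl⟩, ⟨fun _ => ContinuousLinearMap.id 𝕜 _, fun j x => by
    rw [C.ι_eq_incl]; rfl⟩, fun _ _ => rfl⟩

/-- The direct sum of two maps, on the limit of the direct sum. -/
def prodMap {C C' : ScChain.{w, u} 𝕜} {D D' : ScChain.{w, v} 𝕜} (T : C.infty →L[𝕜] C'.infty)
    (R : D.infty →L[𝕜] D'.infty) : (C.prod D).infty →L[𝕜] (C'.prod D').infty :=
  (C'.prodInfty D').symm.toContinuousLinearMap.comp
    ((T.prodMap R).comp (C.prodInfty D).toContinuousLinearMap)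

theorem IsWeakEmbedding.prodMap {C C' : ScChain.{w, u} 𝕜} {D D' : ScChain.{w, v} 𝕜}
    {T : C.infty →L[𝕜] C'.infty} {R : D.infty →L[𝕜] D'.infty} (hT : IsWeakEmbedding T)
    (hR : IsWeakEmbedding R) : IsWeakEmbedding (prodMap T R) := by
  obtain ⟨k, hk, S, hS, hT⟩ := hT.normal
  obtain ⟨m, hm, Q, hQ, hR⟩ := hR.normal
  refine .of_normal (hk := hk.max_seq hm)
    ((S.restrict (hk.max_seq hm) fun j => le_max_left _ _).prod
      (Q.restrict (hk.max_seq hm) fun j => le_max_right _ _))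
    (fun j => ((hS j).comp (C.incl_injective _)).prodMap ((hQ j).comp (D.incl_injective _)))
    fun x j => Prod.ext ?_ ?_
  · change S.T j (C.incl _ (C.pr _ (C.prodInfty D x).1)) = C'.pr j (T (C.prodInfty D x).1)
    rw [C.incl_pr, hT]
  · change Q.T j (D.incl _ (D.pr _ (C.prodInfty D x).2)) = D'.pr j (R (C.prodInfty D x).2)
    rw [D.incl_pr, hR]

theorem IsTameMorphism.prodMap {C C' : ScChain.{w, u} 𝕜} {D D' : ScChain.{w, v} 𝕜}
    {T : C.infty →L[𝕜] C'.infty} {R : D.infty →L[𝕜] D'.infty} (hT : IsTameMorphism T)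
    (hR : IsTameMorphism R) : IsTameMorphism (prodMap T R) := by
  obtain ⟨k, hk, S, hT⟩ := hT
  obtain ⟨m, hm, Q, hR⟩ := hR
  refine ⟨_, hk.max_seq hm,
    (S.restrict (hk.1.max_seq hm.1) fun j => le_max_left _ _).prod
      (Q.restrict (hk.1.max_seq hm.1) fun j => le_max_right _ _), fun x j => Prod.ext ?_ ?_⟩
  · change S.T j (C.incl _ (C.pr _ (C.prodInfty D x).1)) = C'.pr j (T (C.prodInfty D x).1)
    rw [C.incl_pr, hT]
  · change Q.T j (D.incl _ (D.pr _ (C.prodInfty D x).2)) = D'.pr j (R (C.prodInfty D x).2)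
    rw [D.incl_pr, hR]

end ScChain

/-! ### Pre-tame sc-Fréchet spaces -/

/-- An sc-structure on a topological vector space `E`: an sc-chain and an isomorphism of
topological vector spaces `φ : E_∞ → E`. -/
structure ScStructure (𝕜 : Type w) [RCLike 𝕜] (E : Type u) [AddCommGroup E] [Module 𝕜 E]
    [TopologicalSpace E] where
  chain : ScChain.{w, u} 𝕜
  φ : chain.infty ≃L[𝕜] E

namespace ScStructure

variable {𝕜 : Type w} [RCLike 𝕜] {E : Type u} [AddCommGroup E] [Module 𝕜 E] [TopologicalSpace E]
  {F : Type v} [AddCommGroup F] [Module 𝕜 F] [TopologicalSpace F]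

/-- Tame equivalence of sc-structures. -/
def TamelyEquivalent (s s' : ScStructure 𝕜 E) : Prop :=
  ∃ J : s.chain.infty ≃L[𝕜] s'.chain.infty, ScChain.IsTameEquivalence J ∧ ∀ x, s.φ x = s'.φ (J x)

theorem TamelyEquivalent.refl (s : ScStructure 𝕜 E) : TamelyEquivalent s s :=
  ⟨ContinuousLinearEquiv.refl 𝕜 _,
    ⟨⟨s.chain.isWeakEmbedding_id, s.chain.isTameMorphism_id⟩,
      s.chain.isWeakEmbedding_id, s.chain.isTameMorphism_id⟩, fun _ => rfl⟩

theorem TamelyEquivalent.trans {s t r : ScStructure 𝕜 E} (h : TamelyEquivalent s t)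
    (h' : TamelyEquivalent t r) : TamelyEquivalent s r := by
  obtain ⟨J, hJ, e⟩ := h
  obtain ⟨K, hK, e'⟩ := h'
  exact ⟨J.trans K, ⟨⟨hK.1.1.comp hJ.1.1, hK.1.2.comp hJ.1.2⟩, hJ.2.1.comp hK.2.1,
    hJ.2.2.comp hK.2.2⟩, fun x => (e x).trans (e' _)⟩

/-- The direct sum of two sc-structures. -/
def prod (s : ScStructure 𝕜 E) (t : ScStructure 𝕜 F) : ScStructure 𝕜 (E × F) where
  chain := s.chain.prod t.chain
  φ := (s.chain.prodInfty t.chain).trans (s.φ.prodCongr t.φ)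

theorem TamelyEquivalent.prod {s s' : ScStructure 𝕜 E} {t t' : ScStructure 𝕜 F}
    (h : TamelyEquivalent s s') (h' : TamelyEquivalent t t') :
    TamelyEquivalent (s.prod t) (s'.prod t') := by
  obtain ⟨J, hJ, e⟩ := h
  obtain ⟨K, hK, e'⟩ := h'
  exact ⟨(s.chain.prodInfty t.chain).trans
    ((J.prodCongr K).trans (s'.chain.prodInfty t'.chain).symm),
    ⟨⟨hJ.1.1.prodMap hK.1.1, hJ.1.2.prodMap hK.1.2⟩, hJ.2.1.prodMap hK.2.1,
      hJ.2.2.prodMap hK.2.2⟩, fun x => Prod.ext (e _) (e' _)⟩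

/-- The map `ι^∞_j ∘ φ⁻¹ : E → E_j`. -/
def level (s : ScStructure 𝕜 E) (j : ℕ) : E →L[𝕜] s.chain.X j :=
  (s.chain.pr j).comp s.φ.symm.toContinuousLinearMap

/-- The topology on `E` that corresponds under `φ` to the one of the norm `‖·‖_j` on `E_∞`. -/
@[reducible] def levelTopology (s : ScStructure 𝕜 E) (j : ℕ) : TopologicalSpace E :=
  TopologicalSpace.induced (s.level j) inferInstance

end ScStructure

/-- A pre-tame sc-Fréchet space: a topological vector space with a tame equivalence class of
sc-structures, the tamely compatible ones. (That addition and scalar multiplication on `E` are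
continuous, and that `E` is a Fréchet space, follows from the existence of an sc-structure.) -/
class PreTame (𝕜 : Type w) [RCLike 𝕜] (E : Type u) [AddCommGroup E] [Module 𝕜 E]
    [TopologicalSpace E] where
  compatible : Set (ScStructure 𝕜 E)
  isClass : ∃ s, compatible = {s' | ScStructure.TamelyEquivalent s s'}

/-- The direct sum of pre-tame sc-Fréchet spaces: the class generated by the direct sums of
compatible structures. -/
instance PreTame.instProd (𝕜 : Type w) [RCLike 𝕜] (E : Type u) [AddCommGroup E] [Module 𝕜 E]
    [TopologicalSpace E] [PreTame 𝕜 E] (F : Type v) [AddCommGroup F] [Module 𝕜 F]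
    [TopologicalSpace F] [PreTame 𝕜 F] : PreTame 𝕜 (E × F) where
  compatible := {r | ∃ s ∈ PreTame.compatible (𝕜 := 𝕜) (E := E),
    ∃ t ∈ PreTame.compatible (𝕜 := 𝕜) (E := F), ScStructure.TamelyEquivalent (s.prod t) r}
  isClass := by
    obtain ⟨s, hs⟩ := PreTame.isClass (𝕜 := 𝕜) (E := E)
    obtain ⟨t, ht⟩ := PreTame.isClass (𝕜 := 𝕜) (E := F)
    refine ⟨s.prod t, Set.ext fun r => ⟨?_, fun h => ⟨s, ?_, t, ?_, h⟩⟩⟩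
    · rintro ⟨s', hs', t', ht', h⟩
      rw [hs] at hs'
      rw [ht] at ht'
      exact (ScStructure.TamelyEquivalent.prod hs' ht').trans h
    · rw [hs]; exact .refl s
    · rw [ht]; exact .refl t

section Maps

variable (𝕜 : Type w) [RCLike 𝕜]

/-- Weakly tame pre-tame sc-Fréchet spaces. -/
def IsWeaklyTameSpace (E : Type u) [AddCommGroup E] [Module 𝕜 E] [TopologicalSpace E]
    [PreTame 𝕜 E] : Prop :=
  ∃ s ∈ PreTame.compatible (𝕜 := 𝕜) (E := E), s.chain.IsWeaklyTame

/-! ### Continuity and tameness of nonlinear maps -/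

/-- `f` is `sc̲⁰` on `U`. Maps on `U` are represented by functions on the whole space, whose values
outside of `U` are irrelevant. -/
def ScContinuousOn {E : Type u} [AddCommGroup E] [Module 𝕜 E] [TopologicalSpace E] [PreTame 𝕜 E]
    {F : Type v} [AddCommGroup F] [Module 𝕜 F] [TopologicalSpace F] [PreTame 𝕜 F]
    (f : E → F) (U : Set E) : Prop :=
  ∀ x ∈ U, ∃ V ⊆ U, V ∈ 𝓝 x ∧
    ∃ s ∈ PreTame.compatible (𝕜 := 𝕜) (E := E), ∃ s' ∈ PreTame.compatible (𝕜 := 𝕜) (E := F),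
      ∀ j, IsOpen[s.levelTopology j] V ∧
        @ContinuousOn E F (s.levelTopology j) (s'.levelTopology j) f V

/-- The `sc̲⁰` map `f` on `U` is tame. -/
def TameOn {E : Type u} [AddCommGroup E] [Module 𝕜 E] [TopologicalSpace E] [PreTame 𝕜 E]
    {F : Type v} [AddCommGroup F] [Module 𝕜 F] [TopologicalSpace F] [PreTame 𝕜 F]
    (f : E → F) (U : Set E) : Prop :=
  ∀ x ∈ U, ∃ V ⊆ U, V ∈ 𝓝 x ∧
    ∃ s ∈ PreTame.compatible (𝕜 := 𝕜) (E := E), ∃ s' ∈ PreTame.compatible (𝕜 := 𝕜) (E := F),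
      ∀ j, ∃ c : ℝ≥0, ∀ e ∈ V, ‖s'.level j (f e)‖ ≤ c * (1 + ‖s.level j e‖)

/-! ### Differentiability -/

/-- Convex balanced neighbourhoods of `0`. -/
def IsConvexBalancedNhd {E : Type u} [AddCommGroup E] [Module 𝕜 E] [TopologicalSpace E]
    (V : Set E) : Prop :=
  V ∈ 𝓝 0 ∧ Balanced 𝕜 V ∧
    ∀ x ∈ V, ∀ y ∈ V, ∀ t ∈ Icc (0 : ℝ) 1, ((1 - t : ℝ) : 𝕜) • x + (t : 𝕜) • y ∈ V

variable {𝕜} in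
open Classical in
/-- The remainder `r^f_x(u, t) = (f (x + t u) - f x) / t - L u` for `t > 0`, and `0` for `t = 0`. -/
noncomputable def remainder {E : Type u} [AddCommGroup E] [Module 𝕜 E] [TopologicalSpace E]
    {F : Type v} [AddCommGroup F] [Module 𝕜 F] [TopologicalSpace F] (f : E → F) (x : E)
    (L : E →L[𝕜] F) (q : E × ℝ) : F :=
  if q.2 = 0 then 0 else (q.2 : 𝕜)⁻¹ • (f (x + (q.2 : 𝕜) • q.1) - f x) - L q.1

/-- The two notions of differentiability: weak Fréchet, and pointwise weak Fréchet (Gâteaux). -/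
inductive DiffKind
  | weak
  | pointwise

variable {𝕜} in
/-- `f`, defined on `U`, is (pointwise) weakly Fréchet differentiable at `x` with derivative `L`. -/
def HasScDerivAt (κ : DiffKind) {E : Type u} [AddCommGroup E] [Module 𝕜 E] [TopologicalSpace E]
    {F : Type v} [AddCommGroup F] [Module 𝕜 F] [TopologicalSpace F] (f : E → F) (U : Set E)
    (x : E) (L : E →L[𝕜] F) : Prop :=
  ∃ V : Set E, IsConvexBalancedNhd 𝕜 V ∧ (∀ u ∈ V, x + u ∈ U) ∧
    match κ with
    | .weak => ContinuousOn (remainder f x L) (V ×ˢ Icc 0 1)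
    | .pointwise => ∀ A ⊆ V, A.Finite → ContinuousOn (remainder f x L) (A ×ˢ Icc 0 1)

open Classical in
/-- The derivative `Df(x)` (`0` where `f` is not differentiable). A weak Fréchet derivative is in
particular a pointwise one, and pointwise derivatives are unique in Hausdorff spaces. -/
noncomputable def scDeriv {E : Type u} [AddCommGroup E] [Module 𝕜 E] [TopologicalSpace E]
    {F : Type v} [AddCommGroup F] [Module 𝕜 F] [TopologicalSpace F] (f : E → F) (U : Set E)
    (x : E) : E →L[𝕜] F :=
  if h : ∃ L : E →L[𝕜] F, HasScDerivAt .pointwise f U x L then h.choose else 0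

/-- The differential `Df : U × E → F`, `(x, u) ↦ Df(x)u`. -/
noncomputable def scDifferential {E : Type u} [AddCommGroup E] [Module 𝕜 E] [TopologicalSpace E]
    {F : Type v} [AddCommGroup F] [Module 𝕜 F] [TopologicalSpace F] (f : E → F) (U : Set E)
    (p : E × E) : F :=
  scDeriv 𝕜 f U p.1 p.2

/-- `f` is `sc̲ⁿ` (for `κ = weak`) or `p-sc̲ⁿ` (for `κ = pointwise`) on `U`, `n` finite. -/
def ScDiffNat (κ : DiffKind) {F : Type v} [AddCommGroup F] [Module 𝕜 F] [TopologicalSpace F]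
    [PreTame 𝕜 F] : ∀ (_ : ℕ) {E : Type u} [AddCommGroup E] [Module 𝕜 E] [TopologicalSpace E]
      [PreTame 𝕜 E] (_ : E → F) (_ : Set E), Prop
  | 0, _, _, _, _, _, f, U => ScContinuousOn 𝕜 f U
  | n + 1, E, _, _, _, _, f, U =>
    ScContinuousOn 𝕜 f U ∧ (∀ x ∈ U, ∃ L : E →L[𝕜] F, HasScDerivAt κ f U x L) ∧
      ScDiffNat κ n (scDifferential 𝕜 f U) (U ×ˢ univ)

/-- `f` is `(p-)sc̲ᵏ` on `U`, `k ≤ ∞`. -/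
def ScDiffOn (κ : DiffKind) {E : Type u} [AddCommGroup E] [Module 𝕜 E] [TopologicalSpace E]
    [PreTame 𝕜 E] {F : Type v} [AddCommGroup F] [Module 𝕜 F] [TopologicalSpace F] [PreTame 𝕜 F]
    (k : ℕ∞) (f : E → F) (U : Set E) : Prop :=
  ∀ n : ℕ, (n : ℕ∞) ≤ k → ScDiffNat 𝕜 κ n f U

/-- For `W = Eʲ` and `h = Dʲf : U × Eʲ → F`, this says that `Dʲf, …, D^{j+n}f` are tame, where
`D^{j+1}f(x)(w, u) = D(Dʲf)(x, w)(u, 0)` is the derivative of `Dʲf` in the direction `u` of the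
first variable. -/
def DifferentialsTame {E : Type u} [AddCommGroup E] [Module 𝕜 E] [TopologicalSpace E]
    [PreTame 𝕜 E] {F : Type v} [AddCommGroup F] [Module 𝕜 F] [TopologicalSpace F] [PreTame 𝕜 F]
    (U : Set E) : ∀ (_ : ℕ) {W : Type u} [AddCommGroup W] [Module 𝕜 W] [TopologicalSpace W]
      [PreTame 𝕜 W] (_ : E × W → F), Prop
  | 0, _, _, _, _, _, h => TameOn 𝕜 h (U ×ˢ univ)
  | n + 1, W, _, _, _, _, h => TameOn 𝕜 h (U ×ˢ univ) ∧
      DifferentialsTame U n (W := W × E)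
        (fun p => scDeriv 𝕜 h (U ×ˢ univ) (p.1, p.2.1) (p.2.2, 0))

/-- `Dʲf : U × Eʲ → F` is tame for all `0 ≤ j ≤ n`. -/
def TameUpToNat {E : Type u} [AddCommGroup E] [Module 𝕜 E] [TopologicalSpace E]
    [PreTame 𝕜 E] {F : Type v} [AddCommGroup F] [Module 𝕜 F] [TopologicalSpace F] [PreTame 𝕜 F]
    (f : E → F) (U : Set E) : ℕ → Prop
  | 0 => TameOn 𝕜 f U
  | n + 1 => TameOn 𝕜 f U ∧ DifferentialsTame 𝕜 U n (scDifferential 𝕜 f U)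

/-- `f` is tame up to order `k ≤ ∞` on `U`. -/
def TameUpTo {E : Type u} [AddCommGroup E] [Module 𝕜 E] [TopologicalSpace E]
    [PreTame 𝕜 E] {F : Type v} [AddCommGroup F] [Module 𝕜 F] [TopologicalSpace F] [PreTame 𝕜 F]
    (k : ℕ∞) (f : E → F) (U : Set E) : Prop :=
  ∀ n : ℕ, (n : ℕ∞) ≤ k → TameUpToNat 𝕜 f U n

/-- `ψ : U × F → E` is a family of linear maps that is inverse to `Df : U × E → F`. -/
def IsInverseFamily {E : Type u} [AddCommGroup E] [Module 𝕜 E] [TopologicalSpace E]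
    {F : Type v} [AddCommGroup F] [Module 𝕜 F] [TopologicalSpace F]
    (f : E → F) (U : Set E) (ψ : E × F → E) : Prop :=
  ∀ x ∈ U, IsLinearMap 𝕜 (fun v => ψ (x, v)) ∧
    (∀ u, ψ (x, scDifferential 𝕜 f U (x, u)) = u) ∧ ∀ v, scDifferential 𝕜 f U (x, ψ (x, v)) = v

/-- `g : f(V) → V` is inverse to `f : V → f(V)`, where `V` and `f(V)` are open. -/
def IsLocalInverse {E : Type u} [TopologicalSpace E] {F : Type v} [TopologicalSpace F]
    (f : E → F) (V : Set E) (g : F → E) : Prop :=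
  IsOpen V ∧ IsOpen (f '' V) ∧ MapsTo g (f '' V) V ∧ (∀ x ∈ V, g (f x) = x) ∧
    ∀ y ∈ f '' V, f (g y) = y

end Maps

/-! The inverse is built by Newton's method with smoothing. The full Newton step `ψ(x)(y - f x)`
loses a fixed number of derivatives, so one iterates `x_{n+1} = x_n + S_{t_n} ψ(x_n)(y - f x_n)`
with `t_n = t₀ (3/2)^n` (`iter`). Because `Df(x)` inverts `ψ(x, ·)` exactly, the new residual is
`Df(x_n)` applied to the smoothing error, minus a quadratic Taylor remainder (`residual_step`). With
total loss `a = P + 2r`, high norms grow at most like `exp((2a+1) t_n)`. The smoothing error gains a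
factor `exp(-B t_n)` at the cost of a higher norm, and the remainder is quadratic. Since `3/2 < 2`,
a fixed low norm of the residual decays like `exp(-(8a+4) t_n)` (`low_step`, `iter_bounds`). All
estimates are affine in the high norms, so the steps are summable in every norm, with a bound affine
in `y - f x₀` although only one fixed norm of it is small (`iter_steps`, `exists_solution`).

Uniqueness comes from `w = ψ(x₁)(Df(x₁) w)` for `w = x₂ - x₁`. The Taylor remainder is bounded by
`‖w‖_0^{3/2}` after interpolation with the smoothing operators, and for small `w` it is absorbed.
Hence the inverse is Lipschitz from a fixed norm to the weakest one (`stability`). Interpolating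
against the tame bounds makes it continuous in all norms (`TameSolution.contNear`), and the power
`3/2` makes it differentiable at the centre (`TameSolution.hasHadamard`). Every point of `U` can
serve as centre, and any given local inverse agrees with the constructed one near each point.

The definitions let the structures vary from point to point. Since compatible structures have
comparable seminorms up to a shift, one pair of structures can be fixed (`scContinuousOn_iff`,
`tameOn_iff`). Both kinds of differentiability, for maps with continuous differential, amount to
Hadamard differentiability, which satisfies the chain rule; the resulting classes are `TSc`.
Tameness of the `Dʲf`, which differentiate in the base point only, implies tameness of all iterated
full differentials, because `Dʲf` is multilinear in the directions (`tsc_of_differentialsTame`).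

Higher regularity is then formal. The derivative of `ψ` is expressed by `ψ` and the second
derivative of `f` (`tsc_inverseFamily`), and `Dg(y)v = ψ(g y, v)` gains one order at a time
(`tsc_inverse`). -/

/-! ### Tame rescalings of chains and structures -/

namespace ScChain

variable {𝕜 : Type w} [RCLike 𝕜]

/-- The limit of a chain is the limit of each of its rescalings. -/
def rescaleInfty (C : ScChain.{w, u} 𝕜) (k : ℕ → ℕ) (hk : StrictMono k) :
    C.infty ≃L[𝕜] (C.rescale k hk).infty where
  toFun x := ⟨fun j => C.pr (k j) x, fun _ => C.incl_pr _ x⟩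
  invFun y := ⟨fun j => C.incl (hk.le_apply : j ≤ k j) (y.1 j), fun j => by
    have h : C.incl (hk (Nat.lt_succ_self j)).le (y.1 (j + 1)) = y.1 j := y.2 j
    change C.ι j (C.incl _ (y.1 (j + 1))) = C.incl _ (y.1 j)
    rw [C.ι_eq_incl, C.incl_incl, ← h, C.incl_incl]⟩
  left_inv x := Subtype.ext (funext fun _ => C.incl_pr _ x)
  right_inv y := Subtype.ext (funext fun j => by
    have h := (C.rescale k hk).incl_pr (hk.le_apply : j ≤ k j) y
    rw [rescale_incl] at h
    exact h)
  map_add' x y := Subtype.ext (funext fun j => map_add (C.pr (k j)) x y)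
  map_smul' c x := Subtype.ext (funext fun j => map_smul (C.pr (k j)) c x)
  continuous_toFun := Continuous.subtype_mk (continuous_pi fun j => (C.pr (k j)).continuous) _
  continuous_invFun := Continuous.subtype_mk (continuous_pi fun j =>
    (C.incl (hk.le_apply : j ≤ k j)).continuous.comp
      ((C.rescale k hk).pr j).continuous) _

/-- Forward, the operator is the identity of the rescaled chain, and tameness of `k` bounds its
loss. Backward, it consists of the inclusions `X (k j) → X j` and loses nothing. -/
theorem isTameEquivalence_rescaleInfty (C : ScChain.{w, u} 𝕜) {k : ℕ → ℕ} (hk : IsTameSeq k) :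
    IsTameEquivalence (C.rescaleInfty k hk.1) := by
  have hid : IsTameSeq id := ⟨strictMono_id, 0, fun _ => le_rfl⟩
  let S : Op (C.rescale k hk.1) (C.rescale k hk.1) :=
    ⟨fun _ => ContinuousLinearMap.id 𝕜 _, fun _ _ => rfl⟩
  let R : Op ((C.rescale k hk.1).rescale id strictMono_id) C :=
    ⟨fun j => C.incl (hk.1.le_apply : j ≤ k j), fun j x => by
      change C.incl _ ((C.rescale k hk.1).incl _ x) = C.ι j (C.incl _ x)
      rw [rescale_incl, C.ι_eq_incl, C.incl_incl, C.incl_incl]⟩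
  exact ⟨⟨.of_normal S (fun _ _ _ h => h) fun _ _ => rfl, k, hk, S, fun _ _ => rfl⟩,
    .of_normal R (fun j => C.incl_injective _) fun _ _ => rfl, id, hid, R, fun _ _ => rfl⟩

end ScChain

namespace ScStructure

variable {𝕜 : Type w} [RCLike 𝕜] {E : Type u} [AddCommGroup E] [Module 𝕜 E] [TopologicalSpace E]
  {F : Type v} [AddCommGroup F] [Module 𝕜 F] [TopologicalSpace F]

theorem TamelyEquivalent.symm {s t : ScStructure 𝕜 E} (h : TamelyEquivalent s t) :
    TamelyEquivalent t s := by
  obtain ⟨J, hJ, e⟩ := h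
  exact ⟨J.symm, ⟨hJ.2, hJ.1⟩, fun x => by rw [e, J.apply_symm_apply]⟩

/-- The rescaling of an sc-structure. -/
def rescale (s : ScStructure 𝕜 E) (k : ℕ → ℕ) (hk : StrictMono k) : ScStructure 𝕜 E where
  chain := s.chain.rescale k hk
  φ := (s.chain.rescaleInfty k hk).symm.trans s.φ

theorem tamelyEquivalent_rescale (s : ScStructure 𝕜 E) {k : ℕ → ℕ} (hk : IsTameSeq k) :
    TamelyEquivalent s (s.rescale k hk.1) :=
  ⟨s.chain.rescaleInfty k hk.1, s.chain.isTameEquivalence_rescaleInfty hk, fun x => by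
    change _ = s.φ ((s.chain.rescaleInfty k hk.1).symm (s.chain.rescaleInfty k hk.1 x))
    rw [ContinuousLinearEquiv.symm_apply_apply]⟩

/-! ### The seminorms of a structure -/

/-- The seminorm `‖·‖_j` on `E`. -/
noncomputable def sn (s : ScStructure 𝕜 E) (j : ℕ) : Seminorm 𝕜 E :=
  (normSeminorm 𝕜 (s.chain.X j)).comp (s.level j).toLinearMap

theorem sn_apply (s : ScStructure 𝕜 E) (j : ℕ) (x : E) : s.sn j x = ‖s.level j x‖ := rfl

theorem incl_level (s : ScStructure 𝕜 E) {m n : ℕ} (h : m ≤ n) (x : E) :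
    s.chain.incl h (s.level n x) = s.level m x := s.chain.incl_pr h _

theorem sn_mono (s : ScStructure 𝕜 E) {m n : ℕ} (h : m ≤ n) (x : E) : s.sn m x ≤ s.sn n x := by
  rw [sn_apply, sn_apply, ← s.incl_level h]
  simpa using (s.chain.incl h).le_of_opNorm_le (s.chain.incl_norm h) (s.level n x)

theorem sn_prod (s : ScStructure 𝕜 E) (t : ScStructure 𝕜 F) (j : ℕ) (x : E × F) :
    (s.prod t).sn j x = max (s.sn j x.1) (t.sn j x.2) := rfl

theorem isInducing_level (s : ScStructure 𝕜 E) : IsInducing fun (x : E) k => s.level k x :=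
  (IsInducing.subtypeVal (t := (s.chain.infty : Set (∀ k, s.chain.X k)))).comp
    s.φ.symm.toHomeomorph.isInducing

theorem eq_of_level (s : ScStructure 𝕜 E) {x y : E} (h : ∀ k, s.level k x = s.level k y) :
    x = y :=
  s.φ.symm.injective (Subtype.ext (funext h))

/-- The inclusions are injective, so every seminorm is a norm. Uniqueness can therefore be tested in
the weakest one, and vectors can be rescaled by any of them. -/
theorem eq_zero_of_sn (s : ScStructure 𝕜 E) {j : ℕ} {x : E} (h : s.sn j x = 0) : x = 0 := by
  rw [sn_apply, norm_eq_zero] at h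
  have h0 : s.level 0 x = 0 := by
    rw [← s.incl_level (Nat.zero_le j), h, map_zero]
  refine s.eq_of_level fun k => s.chain.incl_injective (Nat.zero_le k) ?_
  rw [s.incl_level, h0, map_zero, map_zero]

theorem tendsto_iff (s : ScStructure 𝕜 E) {α : Type*} {l : Filter α} {a : α → E} {x : E} :
    Tendsto a l (𝓝 x) ↔ ∀ j, Tendsto (fun i => s.sn j (a i - x)) l (𝓝 0) := by
  rw [s.isInducing_level.tendsto_nhds_iff, tendsto_pi_nhds]
  refine forall_congr' fun j => ?_
  rw [tendsto_iff_norm_sub_tendsto_zero]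
  simp only [Function.comp, sn_apply, map_sub]

theorem mem_nhds_iff (s : ScStructure 𝕜 E) {x : E} {V : Set E} :
    V ∈ 𝓝 x ↔ ∃ j, ∃ δ > 0, ∀ e, s.sn j (e - x) < δ → e ∈ V := by
  constructor
  · intro h
    by_contra! H
    -- The seminorms increase with the index, so points within `1/(n+1)` of `x` for the `n`-th one
    -- converge to `x` in all of them.
    choose a ha ha' using fun n : ℕ => H n (1 / ((n : ℝ) + 1)) Nat.one_div_pos_of_nat
    have : Tendsto a atTop (𝓝 x) := s.tendsto_iff.2 fun j => by
      refine squeeze_zero' (Eventually.of_forall fun n => apply_nonneg _ _) ?_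
        tendsto_one_div_add_atTop_nhds_zero_nat
      filter_upwards [eventually_ge_atTop j] with n hn
      exact (s.sn_mono hn _).trans (ha n).le
    obtain ⟨n, hn⟩ := (this.eventually h).exists
    exact ha' n hn
  · rintro ⟨j, δ, hδ, h⟩
    have := s.tendsto_iff.1 (tendsto_id (α := E) (x := 𝓝 x)) j
    filter_upwards [this.eventually_lt_const hδ] with e he using h e he

theorem isTopologicalAddGroup (s : ScStructure 𝕜 E) : IsTopologicalAddGroup E :=
  IsInducing.topologicalAddGroup (s.φ.symm : E ≃L[𝕜] s.chain.infty) s.φ.symm.toHomeomorph.isInducing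

theorem continuousSMul (s : ScStructure 𝕜 E) : ContinuousSMul 𝕜 E :=
  IsInducing.continuousSMul s.φ.symm.toHomeomorph.isInducing continuous_id (map_smul s.φ.symm _ _)

theorem t2Space (s : ScStructure 𝕜 E) : T2Space E :=
  T2Space.of_injective_continuous s.φ.symm.injective s.φ.symm.continuous

/-- A sequence that is summably Cauchy for all seminorms converges. -/
theorem exists_tendsto (s : ScStructure 𝕜 E) (a : ℕ → E)
    (h : ∀ j, Summable fun n => s.sn j (a (n + 1) - a n)) : ∃ x, Tendsto a atTop (𝓝 x) := by
  have hc : ∀ j, ∃ y, Tendsto (fun n => s.level j (a n)) atTop (𝓝 y) := fun j =>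
    cauchySeq_tendsto_of_complete (cauchySeq_of_summable_dist (by
      refine (h j).congr fun n => ?_
      rw [dist_comm, dist_eq_norm, sn_apply, map_sub]))
  choose y hy using hc
  have hy' : y ∈ s.chain.infty := fun k => by
    refine tendsto_nhds_unique (((s.chain.ι k).continuous.tendsto _).comp (hy (k + 1))) ?_
    refine (hy k).congr fun n => ?_
    rw [← s.incl_level k.le_succ, ← s.chain.ι_eq_incl]
    rfl
  refine ⟨s.φ ⟨y, hy'⟩, s.tendsto_iff.2 fun j => ?_⟩
  have : s.level j (s.φ ⟨y, hy'⟩) = y j := by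
    change s.chain.pr j (s.φ.symm (s.φ _)) = _
    rw [s.φ.symm_apply_apply]; rfl
  simp only [sn_apply, map_sub]
  rw [this]
  exact tendsto_iff_norm_sub_tendsto_zero.1 (hy j)

/-- The shift `c` does not depend on `j`: it is the bound on the tame sequence on which the operator
is defined. This uniformity makes continuity and tameness with a fixed loss independent of the
chosen structures. -/
theorem TamelyEquivalent.exists_sn_le {s t : ScStructure 𝕜 E} (h : TamelyEquivalent s t) :
    ∃ c, ∀ j, ∃ C : ℝ, 0 ≤ C ∧ ∀ x, t.sn j x ≤ C * s.sn (j + c) x := by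
  obtain ⟨J, ⟨⟨-, k, ⟨hk, c, hc⟩, S, hS⟩, -⟩, e⟩ := h
  refine ⟨c, fun j => ⟨‖S.T j‖, norm_nonneg _, fun x => ?_⟩⟩
  have h1 : t.level j x = S.T j (s.level (k j) x) := by
    have : t.φ.symm x = J (s.φ.symm x) := by
      rw [ContinuousLinearEquiv.symm_apply_eq, ← e, s.φ.apply_symm_apply]
    exact (congrArg (t.chain.pr j) this).trans (hS _ j).symm
  rw [sn_apply, h1]
  exact ((S.T j).le_opNorm _).trans
    (mul_le_mul_of_nonneg_left (s.sn_mono (hc j) x) (norm_nonneg _))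

/-- The structure with the first `c` levels removed. -/
noncomputable abbrev shift (s : ScStructure 𝕜 E) (c : ℕ) : ScStructure 𝕜 E :=
  s.rescale (fun j => j + c) fun _ _ h => Nat.add_lt_add_right h c

end ScStructure

/-- The set of tamely compatible structures of a pre-tame space. -/
abbrev Compat (𝕜 : Type w) [RCLike 𝕜] (E : Type u) [AddCommGroup E] [Module 𝕜 E]
    [TopologicalSpace E] [PreTame 𝕜 E] : Set (ScStructure 𝕜 E) :=
  PreTame.compatible (𝕜 := 𝕜) (E := E)

section Compat

variable {𝕜 : Type w} [RCLike 𝕜] {E : Type u} [AddCommGroup E] [Module 𝕜 E] [TopologicalSpace E]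
  [PreTame 𝕜 E] {F : Type v} [AddCommGroup F] [Module 𝕜 F] [TopologicalSpace F] [PreTame 𝕜 F]

variable (𝕜 E) in
theorem exists_compat : ∃ s, s ∈ Compat 𝕜 E := by
  obtain ⟨s, hs⟩ := PreTame.isClass (𝕜 := 𝕜) (E := E)
  exact ⟨s, by rw [Compat, hs]; exact .refl s⟩

theorem tamelyEquivalent_of_compat {s t : ScStructure 𝕜 E} (hs : s ∈ Compat 𝕜 E)
    (ht : t ∈ Compat 𝕜 E) : ScStructure.TamelyEquivalent s t := by
  obtain ⟨r, hr⟩ := PreTame.isClass (𝕜 := 𝕜) (E := E)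
  rw [Compat, hr] at hs ht
  exact hs.symm.trans ht

theorem compat_of_equivalent {s t : ScStructure 𝕜 E} (hs : s ∈ Compat 𝕜 E)
    (h : ScStructure.TamelyEquivalent s t) : t ∈ Compat 𝕜 E := by
  obtain ⟨r, hr⟩ := PreTame.isClass (𝕜 := 𝕜) (E := E)
  rw [Compat, hr] at hs ⊢
  exact hs.trans h

theorem compat_shift {s : ScStructure 𝕜 E} (hs : s ∈ Compat 𝕜 E) (c : ℕ) :
    s.shift c ∈ Compat 𝕜 E :=
  compat_of_equivalent hs
    (s.tamelyEquivalent_rescale (k := fun j => j + c)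
      ⟨fun _ _ h => Nat.add_lt_add_right h c, c, fun _ => le_rfl⟩)

theorem compat_prod {s : ScStructure 𝕜 E} {t : ScStructure 𝕜 F} (hs : s ∈ Compat 𝕜 E)
    (ht : t ∈ Compat 𝕜 F) : s.prod t ∈ Compat 𝕜 (E × F) :=
  ⟨s, hs, t, ht, .refl _⟩

theorem exists_sn_le {s t : ScStructure 𝕜 E} (hs : s ∈ Compat 𝕜 E) (ht : t ∈ Compat 𝕜 E) :
    ∃ c, ∀ j, ∃ C : ℝ, 0 ≤ C ∧ ∀ x, t.sn j x ≤ C * s.sn (j + c) x :=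
  (tamelyEquivalent_of_compat hs ht).exists_sn_le

/-- In a weakly tame space some compatible structure has smoothing operators. -/
theorem IsWeaklyTameSpace.exists_smoothing (h : IsWeaklyTameSpace 𝕜 E) :
    ∃ s ∈ Compat 𝕜 E, ∃ (S : ℝ → E → E) (p : ℕ) (c : ℕ → ℕ → ℝ), (∀ k l, 0 ≤ c k l) ∧
      (∀ k l t x, 0 ≤ t → s.sn l (S t x) ≤
        c k l * (1 + Real.exp (((p : ℝ) + ((l : ℝ) - k)) * t)) * s.sn k x) ∧
      ∀ k l t x, 0 ≤ t → l + p ≤ k → s.sn l (x - S t x) ≤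
        c k l * Real.exp (((p : ℝ) - ((k : ℝ) - l)) * t) * s.sn k x := by
  obtain ⟨s, hs, k, hk, S, -, p, c, h1, h2⟩ := h
  refine ⟨s.rescale k hk.1, compat_of_equivalent hs (s.tamelyEquivalent_rescale hk), ?_⟩
  set s' := s.rescale k hk.1 with hs'
  let S' : ℝ≥0 → s'.chain.X 0 →L[𝕜] s'.chain.infty := S
  have hl : ∀ (l : ℕ) (y : s'.chain.infty), s'.level l (s'.φ y) = s'.chain.pr l y := by
    intro l y
    simp only [ScStructure.level, ContinuousLinearMap.comp_apply]
    change s'.chain.pr l (s'.φ.symm (s'.φ _)) = _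
    rw [s'.φ.symm_apply_apply]
  refine ⟨fun t x => s'.φ (S' t.toNNReal (s'.level 0 x)), p, fun k l => c k l,
    fun k l => (c k l).2, fun k l t x ht => ?_, fun k l t x ht hkl => ?_⟩
  · have := ContinuousLinearMap.le_of_opNorm_le _ (h1 k l t.toNNReal) (s'.level k x)
    rw [Real.coe_toNNReal t ht] at this
    rw [ScStructure.sn_apply, hl, ← s'.incl_level (Nat.zero_le k)]
    exact this
  · have := ContinuousLinearMap.le_of_opNorm_le _ (h2 k l (by omega) t.toNNReal hkl) (s'.level k x)
    rw [Real.coe_toNNReal t ht] at this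
    rw [ScStructure.sn_apply, map_sub, hl, ← s'.incl_level (Nat.zero_le k),
      ← s'.incl_level (show l ≤ k by omega)]
    exact this

end Compat

/-! ### Continuity and tameness in terms of fixed structures -/

section Local

variable {𝕜 : Type w} [RCLike 𝕜] {E : Type u} [AddCommGroup E] [Module 𝕜 E] [TopologicalSpace E]
  {F : Type v} [AddCommGroup F] [Module 𝕜 F] [TopologicalSpace F]
  {G : Type u'} [AddCommGroup G] [Module 𝕜 G] [TopologicalSpace G]

/-- On the ball of radius `δ` around `x` for `‖·‖_r`, which lies in `U`, the map `f` is continuous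
from `‖·‖_{j+r}` to `‖·‖_j` for all `j`. -/
def LocCont (s : ScStructure 𝕜 E) (s' : ScStructure 𝕜 F) (f : E → F) (U : Set E) (x : E) (r : ℕ)
    (δ : ℝ) : Prop :=
  ∀ e, s.sn r (e - x) < δ → e ∈ U ∧ ∀ j, ∀ ε > 0, ∃ η > 0, ∀ e', s.sn r (e' - x) < δ →
    s.sn (j + r) (e' - e) < η → s'.sn j (f e' - f e) < ε

/-- On the ball of radius `δ` around `x` for `‖·‖_r`, which lies in `U`, the map `f` satisfies tame
estimates. -/
def LocTame (s : ScStructure 𝕜 E) (s' : ScStructure 𝕜 F) (f : E → F) (U : Set E) (x : E) (r : ℕ)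
    (δ : ℝ) : Prop :=
  (∀ e, s.sn r (e - x) < δ → e ∈ U) ∧ ∀ j, ∃ C : ℝ, 0 ≤ C ∧ ∀ e, s.sn r (e - x) < δ →
    s'.sn j (f e) ≤ C * (1 + s.sn (j + r) e)

theorem LocCont.mono {s : ScStructure 𝕜 E} {s' : ScStructure 𝕜 F} {f : E → F} {U : Set E} {x : E}
    {r r' : ℕ} {δ δ' : ℝ} (h : LocCont s s' f U x r δ) (hr : r ≤ r') (hδ : δ' ≤ δ) :
    LocCont s s' f U x r' δ' := by
  have hb : ∀ e, s.sn r' (e - x) < δ' → s.sn r (e - x) < δ := fun e he =>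
    (s.sn_mono hr _).trans_lt (he.trans_le hδ)
  intro e he
  refine ⟨(h e (hb e he)).1, fun j ε hε => ?_⟩
  obtain ⟨η, hη, H⟩ := (h e (hb e he)).2 j ε hε
  exact ⟨η, hη, fun e' he' h' => H e' (hb e' he') ((s.sn_mono (by omega) _).trans_lt h')⟩

theorem LocTame.mono {s : ScStructure 𝕜 E} {s' : ScStructure 𝕜 F} {f : E → F} {U : Set E} {x : E}
    {r r' : ℕ} {δ δ' : ℝ} (h : LocTame s s' f U x r δ) (hr : r ≤ r') (hδ : δ' ≤ δ) :
    LocTame s s' f U x r' δ' := by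
  have hb : ∀ e, s.sn r' (e - x) < δ' → s.sn r (e - x) < δ := fun e he =>
    (s.sn_mono hr _).trans_lt (he.trans_le hδ)
  refine ⟨fun e he => h.1 e (hb e he), fun j => ?_⟩
  obtain ⟨C, hC, H⟩ := h.2 j
  refine ⟨C, hC, fun e he => (H e (hb e he)).trans ?_⟩
  gcongr
  exact s.sn_mono (by omega) _

theorem LocCont.congr {s : ScStructure 𝕜 E} {s' : ScStructure 𝕜 F} {f g : E → F} {U : Set E}
    {x : E} {r : ℕ} {δ : ℝ} (h : LocCont s s' f U x r δ) (hfg : EqOn f g U) :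
    LocCont s s' g U x r δ := by
  intro e he
  refine ⟨(h e he).1, fun j ε hε => ?_⟩
  obtain ⟨η, hη, H⟩ := (h e he).2 j ε hε
  refine ⟨η, hη, fun e' he' h' => ?_⟩
  rw [← hfg (h e he).1, ← hfg (h e' he').1]
  exact H e' he' h'

theorem LocTame.congr {s : ScStructure 𝕜 E} {s' : ScStructure 𝕜 F} {f g : E → F} {U : Set E}
    {x : E} {r : ℕ} {δ : ℝ} (h : LocTame s s' f U x r δ) (hfg : EqOn f g U) :
    LocTame s s' g U x r δ := by
  refine ⟨h.1, fun j => ?_⟩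
  obtain ⟨C, hC, H⟩ := h.2 j
  exact ⟨C, hC, fun e he => hfg (h.1 e he) ▸ H e he⟩

/-- Near `x`, the map `f` is continuous for all seminorms with a fixed loss. -/
def ContNear (s : ScStructure 𝕜 E) (s' : ScStructure 𝕜 F) (f : E → F) (U : Set E) (x : E) : Prop :=
  ∃ r, ∃ δ > 0, LocCont s s' f U x r δ

/-- Near `x`, the map `f` satisfies tame estimates with a fixed loss. -/
def TameNear (s : ScStructure 𝕜 E) (s' : ScStructure 𝕜 F) (f : E → F) (U : Set E) (x : E) : Prop :=
  ∃ r, ∃ δ > 0, LocTame s s' f U x r δ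

theorem ContNear.exists_ball {s : ScStructure 𝕜 E} {s' : ScStructure 𝕜 F} {f : E → F} {U : Set E}
    {x : E} (h : ContNear s s' f U x) (m : ℕ) {ε : ℝ} (hε : 0 < ε) :
    ∃ r, ∃ δ > 0, ∀ e, s.sn r (e - x) < δ → s'.sn m (f e - f x) < ε := by
  obtain ⟨r, δ, hδ, h⟩ := h
  obtain ⟨η, hη, H⟩ := (h x (by simpa using hδ)).2 m ε hε
  refine ⟨m + r, min δ η, lt_min hδ hη, fun e he => H e ?_ (he.trans_le (min_le_right _ _))⟩
  exact (s.sn_mono (by omega) _).trans_lt (he.trans_le (min_le_left _ _))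

theorem ContNear.comp {s : ScStructure 𝕜 E} {s' : ScStructure 𝕜 F} {s'' : ScStructure 𝕜 G}
    {g : F → G} {f : E → F} {V : Set F} {U : Set E} {x : E} (hg : ContNear s' s'' g V (f x))
    (hf : ContNear s s' f U x) : ContNear s s'' (g ∘ f) U x := by
  obtain ⟨r₂, δ₂, hδ₂, hg⟩ := hg
  obtain ⟨r, δ, hδ, hb⟩ := hf.exists_ball r₂ hδ₂
  obtain ⟨r₁, δ₁, hδ₁, hf⟩ := hf
  have hr : ∀ {e}, s.sn (r₁ + r + r₂) (e - x) < min δ δ₁ → s.sn r (e - x) < δ := fun h =>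
    (s.sn_mono (by omega) _).trans_lt (h.trans_le (min_le_left _ _))
  have hr₁ : ∀ {e}, s.sn (r₁ + r + r₂) (e - x) < min δ δ₁ → s.sn r₁ (e - x) < δ₁ := fun h =>
    (s.sn_mono (by omega) _).trans_lt (h.trans_le (min_le_right _ _))
  -- Here `r₁` and `r₂` are the losses of `f` and `g`, and `r` is a norm whose ball `f` maps into
  -- the ball where `g` is controlled.
  refine ⟨r₁ + r + r₂, min δ δ₁, lt_min hδ hδ₁, fun e he => ⟨(hf e (hr₁ he)).1, fun j ε hε => ?_⟩⟩
  obtain ⟨η₂, hη₂, H₂⟩ := (hg (f e) (hb e (hr he))).2 j ε hε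
  obtain ⟨η₁, hη₁, H₁⟩ := (hf e (hr₁ he)).2 (j + r₂) η₂ hη₂
  exact ⟨η₁, hη₁, fun e' he' h' => H₂ _ (hb e' (hr he'))
    (H₁ e' (hr₁ he') ((s.sn_mono (by omega) _).trans_lt h'))⟩

/-- Tame bounds alone do not keep `f e` near `f x`; continuity of `f` is what brings it into the
ball where the estimates for `g` hold. -/
theorem TameNear.comp {s : ScStructure 𝕜 E} {s' : ScStructure 𝕜 F} {s'' : ScStructure 𝕜 G}
    {g : F → G} {f : E → F} {V : Set F} {U : Set E} {x : E} (hg : TameNear s' s'' g V (f x))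
    (hf : TameNear s s' f U x) (hfc : ContNear s s' f U x) : TameNear s s'' (g ∘ f) U x := by
  obtain ⟨r₂, δ₂, hδ₂, -, hg⟩ := hg
  obtain ⟨r, δ, hδ, hb⟩ := hfc.exists_ball r₂ hδ₂
  obtain ⟨r₁, δ₁, hδ₁, hU, hf⟩ := hf
  have hr : ∀ {e}, s.sn (r₁ + r + r₂) (e - x) < min δ δ₁ → s.sn r (e - x) < δ := fun h =>
    (s.sn_mono (by omega) _).trans_lt (h.trans_le (min_le_left _ _))
  have hr₁ : ∀ {e}, s.sn (r₁ + r + r₂) (e - x) < min δ δ₁ → s.sn r₁ (e - x) < δ₁ := fun h =>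
    (s.sn_mono (by omega) _).trans_lt (h.trans_le (min_le_right _ _))
  refine ⟨r₁ + r + r₂, min δ δ₁, lt_min hδ hδ₁, fun e he => hU e (hr₁ he), fun j => ?_⟩
  obtain ⟨C₂, hC₂, H₂⟩ := hg j
  obtain ⟨C₁, hC₁, H₁⟩ := hf (j + r₂)
  refine ⟨C₂ * (1 + C₁), by positivity, fun e he => (H₂ _ (hb e (hr he))).trans ?_⟩
  have h1 := H₁ e (hr₁ he)
  have h2 : s.sn (j + r₂ + r₁) e ≤ s.sn (j + (r₁ + r + r₂)) e := s.sn_mono (by omega) _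
  have h3 : 0 ≤ s.sn (j + r₂ + r₁) e := apply_nonneg _ _
  rw [mul_assoc]
  refine mul_le_mul_of_nonneg_left ?_ hC₂
  nlinarith

theorem ContNear.prodMk {s : ScStructure 𝕜 E} {s' : ScStructure 𝕜 F} {s'' : ScStructure 𝕜 G}
    {f : E → F} {g : E → G} {U : Set E} {x : E} (hf : ContNear s s' f U x)
    (hg : ContNear s s'' g U x) : ContNear s (s'.prod s'') (fun e => (f e, g e)) U x := by
  obtain ⟨r₁, δ₁, hδ₁, hf⟩ := hf
  obtain ⟨r₂, δ₂, hδ₂, hg⟩ := hg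
  replace hf := hf.mono (le_max_left r₁ r₂) (min_le_left δ₁ δ₂)
  replace hg := hg.mono (le_max_right r₁ r₂) (min_le_right δ₁ δ₂)
  refine ⟨_, _, lt_min hδ₁ hδ₂, fun e he => ⟨(hf e he).1, fun j ε hε => ?_⟩⟩
  obtain ⟨η₁, hη₁, H₁⟩ := (hf e he).2 j ε hε
  obtain ⟨η₂, hη₂, H₂⟩ := (hg e he).2 j ε hε
  exact ⟨min η₁ η₂, lt_min hη₁ hη₂, fun e' he' h' => max_lt
    (H₁ e' he' (h'.trans_le (min_le_left _ _))) (H₂ e' he' (h'.trans_le (min_le_right _ _)))⟩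

theorem TameNear.prodMk {s : ScStructure 𝕜 E} {s' : ScStructure 𝕜 F} {s'' : ScStructure 𝕜 G}
    {f : E → F} {g : E → G} {U : Set E} {x : E} (hf : TameNear s s' f U x)
    (hg : TameNear s s'' g U x) : TameNear s (s'.prod s'') (fun e => (f e, g e)) U x := by
  obtain ⟨r₁, δ₁, hδ₁, hf⟩ := hf
  obtain ⟨r₂, δ₂, hδ₂, hg⟩ := hg
  replace hf := hf.mono (le_max_left r₁ r₂) (min_le_left δ₁ δ₂)
  replace hg := hg.mono (le_max_right r₁ r₂) (min_le_right δ₁ δ₂)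
  refine ⟨_, _, lt_min hδ₁ hδ₂, hf.1, fun j => ?_⟩
  obtain ⟨C₁, hC₁, H₁⟩ := hf.2 j
  obtain ⟨C₂, hC₂, H₂⟩ := hg.2 j
  refine ⟨C₁ + C₂, by positivity, fun e he => max_le ((H₁ e he).trans ?_) ((H₂ e he).trans ?_)⟩
  · have : 0 ≤ s.sn (j + max r₁ r₂) e := apply_nonneg _ _
    gcongr; linarith
  · have : 0 ≤ s.sn (j + max r₁ r₂) e := apply_nonneg _ _
    gcongr; linarith

theorem ContNear.restrict {s : ScStructure 𝕜 E} {s' : ScStructure 𝕜 F} {f : E → F} {U V : Set E}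
    {x : E} (h : ContNear s s' f U x) (hV : V ∈ 𝓝 x) : ContNear s s' f V x := by
  obtain ⟨r, δ, hδ, h⟩ := h
  obtain ⟨m, η, hη, hm⟩ := s.mem_nhds_iff.1 hV
  replace h := h.mono (le_max_left r m) (min_le_left δ η)
  exact ⟨_, _, lt_min hδ hη, fun e he => ⟨hm e ((s.sn_mono (le_max_right r m) _).trans_lt
    (he.trans_le (min_le_right _ _))), (h e he).2⟩⟩

theorem TameNear.restrict {s : ScStructure 𝕜 E} {s' : ScStructure 𝕜 F} {f : E → F} {U V : Set E}
    {x : E} (h : TameNear s s' f U x) (hV : V ∈ 𝓝 x) : TameNear s s' f V x := by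
  obtain ⟨r, δ, hδ, h⟩ := h
  obtain ⟨m, η, hη, hm⟩ := s.mem_nhds_iff.1 hV
  replace h := h.mono (le_max_left r m) (min_le_left δ η)
  exact ⟨_, _, lt_min hδ hη, fun e he => hm e ((s.sn_mono (le_max_right r m) _).trans_lt
    (he.trans_le (min_le_right _ _))), h.2⟩

theorem ContNear.continuousAt {s : ScStructure 𝕜 E} {s' : ScStructure 𝕜 F} {f : E → F} {U : Set E}
    {x : E} (h : ContNear s s' f U x) : ContinuousAt f x := by
  refine s'.tendsto_iff.2 fun j => ?_
  rw [Metric.tendsto_nhds]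
  intro ε hε
  obtain ⟨r, δ, hδ, H⟩ := h.exists_ball j hε
  have := s.mem_nhds_iff.2 ⟨r, δ, hδ, fun e he => H e he⟩
  filter_upwards [this] with e he
  rw [Real.dist_eq, sub_zero, abs_of_nonneg (apply_nonneg _ _)]
  exact he

theorem ScStructure.isOpen_levelTopology_iff (s : ScStructure 𝕜 E) {j : ℕ} {V : Set E} :
    IsOpen[s.levelTopology j] V ↔ ∀ x ∈ V, ∃ δ > 0, ∀ e, s.sn j (e - x) < δ → e ∈ V := by
  let := s.levelTopology j
  rw [isOpen_iff_mem_nhds]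
  refine forall₂_congr fun x _ => ?_
  rw [nhds_induced, ((Metric.nhds_basis_ball).comap _).mem_iff]
  refine exists_congr fun δ => and_congr_right fun _ => ?_
  simp only [subset_def, mem_preimage, Metric.mem_ball, dist_eq_norm, ← map_sub]
  rfl

theorem ScStructure.continuousOn_levelTopology_iff (s : ScStructure 𝕜 E) (s' : ScStructure 𝕜 F)
    {j k : ℕ} {V : Set E} {f : E → F} :
    @ContinuousOn E F (s.levelTopology j) (s'.levelTopology k) f V ↔
      ∀ x ∈ V, ∀ ε > 0, ∃ δ > 0, ∀ e ∈ V, s.sn j (e - x) < δ → s'.sn k (f e - f x) < ε := by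
  let := s.levelTopology j
  let := s'.levelTopology k
  refine forall₂_congr fun x _ => ?_
  rw [ContinuousWithinAt, nhdsWithin, nhds_induced, nhds_induced,
    (((Metric.nhds_basis_ball).comap _).inf_principal V).tendsto_iff
      ((Metric.nhds_basis_ball).comap _)]
  refine forall₂_congr fun ε _ => exists_congr fun δ => and_congr_right fun _ => ?_
  simp only [mem_inter_iff, mem_preimage, Metric.mem_ball, dist_eq_norm, ← map_sub]
  exact ⟨fun h e he h' => h e ⟨h', he⟩, fun h e he => h e he.2 he.1⟩

end Local

section Compat

variable {𝕜 : Type w} [RCLike 𝕜] {E : Type u} [AddCommGroup E] [Module 𝕜 E] [TopologicalSpace E]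
  [PreTame 𝕜 E] {F : Type v} [AddCommGroup F] [Module 𝕜 F] [TopologicalSpace F] [PreTame 𝕜 F]

/-- Passing to fixed structures costs only the shifts `c` and `c'`. Conversely a loss `r` is removed
by discarding the first `r` levels of the domain, after which the ball for `‖·‖_r` is open at every
level. -/
theorem scContinuousOn_iff {s : ScStructure 𝕜 E} {s' : ScStructure 𝕜 F} (hs : s ∈ Compat 𝕜 E)
    (hs' : s' ∈ Compat 𝕜 F) {f : E → F} {U : Set E} :
    ScContinuousOn 𝕜 f U ↔ ∀ x ∈ U, ContNear s s' f U x := by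
  constructor
  · intro h x hx
    obtain ⟨V, hVU, hV, t, ht, t', ht', H⟩ := h x hx
    obtain ⟨c, hc⟩ := exists_sn_le hs ht
    obtain ⟨c', hc'⟩ := exists_sn_le ht' hs'
    obtain ⟨δ, hδ, hb⟩ := t.isOpen_levelTopology_iff.1 (H 0).1 x (mem_of_mem_nhds hV)
    obtain ⟨C, hC, hC'⟩ := hc 0
    have hball : ∀ e, s.sn (c + c') (e - x) < δ / (C + 1) → e ∈ V := by
      intro e he
      refine hb e ((hC' _).trans_lt ?_)
      have h1 : s.sn (0 + c) (e - x) ≤ s.sn (c + c') (e - x) := s.sn_mono (by omega) _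
      have h2 : 0 ≤ s.sn (0 + c) (e - x) := apply_nonneg _ _
      rw [lt_div_iff₀ (by positivity)] at he
      nlinarith
    refine ⟨c + c', δ / (C + 1), by positivity, fun e he => ⟨hVU (hball e he), fun j ε hε => ?_⟩⟩
    obtain ⟨C₁, hC₁, h₁⟩ := hc' j
    obtain ⟨C₂, hC₂, h₂⟩ := hc (j + c')
    obtain ⟨η, hη, h₃⟩ := (t.continuousOn_levelTopology_iff t').1 (H (j + c')).2 e (hball e he)
      (ε / (C₁ + 1)) (by positivity)
    refine ⟨η / (C₂ + 1), by positivity, fun e' he' h' => ?_⟩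
    have h4 : t.sn (j + c') (e' - e) < η := by
      refine (h₂ _).trans_lt ?_
      have h1 : s.sn (j + c' + c) (e' - e) ≤ s.sn (j + (c + c')) (e' - e) := s.sn_mono (by omega) _
      have h2 : 0 ≤ s.sn (j + c' + c) (e' - e) := apply_nonneg _ _
      rw [lt_div_iff₀ (by positivity)] at h'
      nlinarith
    have h5 := h₃ e' (hball e' he') h4
    refine (h₁ _).trans_lt ?_
    rw [lt_div_iff₀ (by positivity)] at h5
    have h2 : 0 ≤ t'.sn (j + c') (f e' - f e) := apply_nonneg _ _
    nlinarith
  · intro h x hx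
    obtain ⟨r, δ, hδ, H⟩ := h x hx
    refine ⟨{e | s.sn r (e - x) < δ}, fun e he => (H e he).1,
      s.mem_nhds_iff.2 ⟨r, δ, hδ, fun e he => he⟩, s.shift r, compat_shift hs r, s', hs',
      fun j => ⟨?_, ?_⟩⟩
    · refine (s.shift r).isOpen_levelTopology_iff.2 fun e (he : _ < _) =>
        ⟨δ - s.sn r (e - x), sub_pos.2 he, fun e' he' => ?_⟩
      have h1 : s.sn r (e' - e) ≤ s.sn (j + r) (e' - e) := s.sn_mono (by omega) _
      have h2 := map_add_le_add (s.sn r) (e' - e) (e - x)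
      rw [sub_add_sub_cancel] at h2
      have h3 : s.sn (j + r) (e' - e) < δ - s.sn r (e - x) := he'
      change s.sn r (e' - x) < δ
      linarith
    · refine ((s.shift r).continuousOn_levelTopology_iff s').2 fun e he ε hε => ?_
      obtain ⟨η, hη, h'⟩ := (H e he).2 j ε hε
      exact ⟨η, hη, fun e' he' h'' => h' e' he' h''⟩

theorem tameOn_iff {s : ScStructure 𝕜 E} {s' : ScStructure 𝕜 F} (hs : s ∈ Compat 𝕜 E)
    (hs' : s' ∈ Compat 𝕜 F) {f : E → F} {U : Set E} :
    TameOn 𝕜 f U ↔ ∀ x ∈ U, TameNear s s' f U x := by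
  constructor
  · intro h x hx
    obtain ⟨V, hVU, hV, t, ht, t', ht', H⟩ := h x hx
    obtain ⟨c, hc⟩ := exists_sn_le hs ht
    obtain ⟨c', hc'⟩ := exists_sn_le ht' hs'
    obtain ⟨m, δ, hδ, hb⟩ := s.mem_nhds_iff.1 hV
    have hball : ∀ e, s.sn (m + c + c') (e - x) < δ → e ∈ V := fun e he =>
      hb e ((s.sn_mono (by omega) _).trans_lt he)
    refine ⟨m + c + c', δ, hδ, fun e he => hVU (hball e he), fun j => ?_⟩
    obtain ⟨C₁, hC₁, h₁⟩ := hc' j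
    obtain ⟨C₂, hC₂, h₂⟩ := hc (j + c')
    obtain ⟨C₃, h₃⟩ := H (j + c')
    refine ⟨C₁ * (C₃ * (1 + C₂)), by positivity, fun e he => (h₁ _).trans ?_⟩
    rw [mul_assoc, mul_assoc]
    refine mul_le_mul_of_nonneg_left ((h₃ e (hball e he)).trans ?_) hC₁
    refine mul_le_mul_of_nonneg_left ?_ C₃.2
    have h4 : t.sn (j + c') e ≤ C₂ * s.sn (j + c' + c) e := h₂ e
    have h5 : s.sn (j + c' + c) e ≤ s.sn (j + (m + c + c')) e := s.sn_mono (by omega) _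
    have h6 : 0 ≤ s.sn (j + c' + c) e := apply_nonneg _ _
    rw [ScStructure.sn_apply] at h4
    nlinarith
  · intro h x hx
    obtain ⟨r, δ, hδ, hU, H⟩ := h x hx
    refine ⟨{e | s.sn r (e - x) < δ}, fun e he => hU e he,
      s.mem_nhds_iff.2 ⟨r, δ, hδ, fun e he => he⟩, s.shift r, compat_shift hs r, s', hs',
      fun j => ?_⟩
    obtain ⟨C, hC, h'⟩ := H j
    exact ⟨⟨C, hC⟩, fun e he => h' e he⟩

end Compat

/-! ### Directional derivatives -/

section Deriv

variable {𝕜 : Type w} [RCLike 𝕜] {E : Type u} [AddCommGroup E] [Module 𝕜 E] [TopologicalSpace E]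
  {F : Type v} [AddCommGroup F] [Module 𝕜 F] [TopologicalSpace F]
  {G : Type u'} [AddCommGroup G] [Module 𝕜 G] [TopologicalSpace G]

variable (𝕜) in
/-- The difference quotient of `f` at `x`. -/
noncomputable def diffQuot (f : E → F) (x : E) (q : ℝ × E) : F :=
  (q.1 : 𝕜)⁻¹ • (f (x + (q.1 : 𝕜) • q.2) - f x)

/-- `L` is the Gateaux derivative of `f` at `x`. -/
def HasGateaux (f : E → F) (x : E) (L : E →L[𝕜] F) : Prop :=
  ∀ u, Tendsto (fun t : ℝ => diffQuot 𝕜 f x (t, u)) (𝓝[>] 0) (𝓝 (L u))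

/-- `L` is the Hadamard derivative of `f` at `x`. -/
def HasHadamard (f : E → F) (x : E) (L : E →L[𝕜] F) : Prop :=
  ∀ u, Tendsto (diffQuot 𝕜 f x) (𝓝[>] 0 ×ˢ 𝓝 u) (𝓝 (L u))

/-! ### Calculus of Hadamard derivatives. -/

theorem HasHadamard.hasGateaux {f : E → F} {x : E} {L : E →L[𝕜] F} (h : HasHadamard f x L) :
    HasGateaux f x L := fun u =>
  (h u).comp (tendsto_id.prodMk tendsto_const_nhds)

theorem HasGateaux.unique [T2Space F] {f : E → F} {x : E} {L M : E →L[𝕜] F}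
    (h : HasGateaux f x L) (h' : HasGateaux f x M) : L = M :=
  ContinuousLinearMap.ext fun u => tendsto_nhds_unique (h u) (h' u)

theorem eventually_pos_fst {E : Type*} [TopologicalSpace E] (u : E) :
    ∀ᶠ q : ℝ × E in 𝓝[>] 0 ×ˢ 𝓝 u, 0 < q.1 :=
  tendsto_fst.eventually self_mem_nhdsWithin

theorem hasHadamard_linear (L : E →L[𝕜] F) (x : E) : HasHadamard L x L := fun u => by
  have h : Tendsto (fun q : ℝ × E => L q.2) (𝓝[>] 0 ×ˢ 𝓝 u) (𝓝 (L u)) :=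
    (L.continuous.tendsto u).comp tendsto_snd
  refine h.congr' ?_
  filter_upwards [eventually_pos_fst u] with q hq
  have : (q.1 : 𝕜) ≠ 0 := by exact_mod_cast hq.ne'
  rw [diffQuot, map_add, add_sub_cancel_left, map_smul, inv_smul_smul₀ this]

/-- The difference quotient of `g ∘ f` is that of `g` in a direction which itself varies, namely the
difference quotient of `f`. Varying directions are what the Hadamard condition allows and the
Gateaux condition does not. -/
theorem HasHadamard.comp {g : F → G} {f : E → F} {x : E} {M : F →L[𝕜] G} {L : E →L[𝕜] F}
    (hg : HasHadamard g (f x) M) (hf : HasHadamard f x L) : HasHadamard (g ∘ f) x (M.comp L) :=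
  fun u => by
    have h : Tendsto (fun q : ℝ × E => (q.1, diffQuot 𝕜 f x q)) (𝓝[>] 0 ×ˢ 𝓝 u)
        (𝓝[>] 0 ×ˢ 𝓝 (L u)) := tendsto_fst.prodMk (hf u)
    refine ((hg (L u)).comp h).congr' ?_
    filter_upwards [eventually_pos_fst u] with q hq
    have : (q.1 : 𝕜) ≠ 0 := by exact_mod_cast hq.ne'
    simp only [Function.comp, diffQuot]
    rw [smul_inv_smul₀ this, add_sub_cancel]

theorem HasHadamard.prodMk {f : E → F} {g : E → G} {x : E} {L : E →L[𝕜] F} {M : E →L[𝕜] G}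
    (hf : HasHadamard f x L) (hg : HasHadamard g x M) :
    HasHadamard (fun e => (f e, g e)) x (L.prod M) := fun u =>
  (hf u).prodMk_nhds (hg u)

theorem tendsto_add_smul [ContinuousAdd E] [ContinuousSMul 𝕜 E] (x u : E) :
    Tendsto (fun q : ℝ × E => x + (q.1 : 𝕜) • q.2) (𝓝[>] 0 ×ˢ 𝓝 u) (𝓝 x) := by
  have h1 : Tendsto (fun q : ℝ × E => (q.1 : 𝕜)) (𝓝[>] 0 ×ˢ 𝓝 u) (𝓝 0) := by
    have := (RCLike.continuous_ofReal (K := 𝕜)).tendsto 0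
    rw [RCLike.ofReal_zero] at this
    exact this.comp (tendsto_fst.mono_right nhdsWithin_le_nhds)
  simpa using tendsto_const_nhds.add (h1.smul (tendsto_snd (f := 𝓝[>] (0 : ℝ)) (g := 𝓝 u)))

theorem HasHadamard.congr [ContinuousAdd E] [ContinuousSMul 𝕜 E] {f g : E → F} {x : E}
    {L : E →L[𝕜] F} (h : HasHadamard f x L) (hfg : f =ᶠ[𝓝 x] g) : HasHadamard g x L := fun u => by
  refine (h u).congr' ?_
  filter_upwards [(tendsto_add_smul (𝕜 := 𝕜) x u).eventually hfg] with q hq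
  rw [diffQuot, diffQuot, hq, hfg.self_of_nhds]

/-- The mean value inequality on a segment. -/
theorem HasGateaux.sn_sub_le (s' : ScStructure 𝕜 F) [ContinuousAdd E] [ContinuousSMul 𝕜 E]
    {f : E → F} {D : E → E →L[𝕜] F} {U : Set E} (hf : ContinuousOn f U)
    (hD : ∀ x ∈ U, HasGateaux f x (D x)) {x u : E} {j : ℕ}
    (hseg : ∀ t ∈ Icc (0 : ℝ) 1, x + (t : 𝕜) • u ∈ U) {c : F} {M : ℝ}
    (hM : ∀ t ∈ Icc (0 : ℝ) 1, s'.sn j (D (x + (t : 𝕜) • u) u - c) ≤ M) :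
    s'.sn j (f (x + u) - f x - c) ≤ M := by
  let : NormedSpace ℝ (s'.chain.X j) := NormedSpace.restrictScalars ℝ 𝕜 _
  have hsm : ∀ (t : ℝ) (z : s'.chain.X j), t • z = (t : 𝕜) • z := fun _ _ => rfl
  -- Subtracting `t • c` makes the derivative of `φ` the deviation of the directional derivative
  -- from `c`, so that a bound on this deviation is all that is needed.
  let φ : ℝ → s'.chain.X j := fun t => s'.level j (f (x + (t : 𝕜) • u)) - t • s'.level j c
  have hline : Continuous fun t : ℝ => x + (t : 𝕜) • u :=
    continuous_const.add (RCLike.continuous_ofReal.smul continuous_const)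
  have hφc : ContinuousOn φ (Icc 0 1) := by
    refine ContinuousOn.sub ?_ (continuousOn_id.smul continuousOn_const)
    exact (s'.level j).continuous.comp_continuousOn (hf.comp hline.continuousOn hseg)
  have hφd : ∀ t ∈ Ico (0 : ℝ) 1,
      HasDerivWithinAt φ (s'.level j (D (x + (t : 𝕜) • u) u - c)) (Ici t) t := by
    intro t ht
    -- Only positive increments are available, hence a right derivative; it suffices for the mean
    -- value inequality.
    rw [← hasDerivWithinAt_Ioi_iff_Ici, hasDerivWithinAt_iff_tendsto_slope' (by simp)]
    have h0 := hD _ (hseg t ⟨ht.1, ht.2.le⟩) u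
    have h1 : Tendsto (fun τ : ℝ => τ - t) (𝓝[>] t) (𝓝[>] 0) := by
      refine tendsto_nhdsWithin_iff.2 ⟨?_, ?_⟩
      · have : Tendsto (fun τ : ℝ => τ - t) (𝓝 t) (𝓝 (t - t)) := (continuous_sub_right t).tendsto t
        rw [sub_self] at this
        exact this.mono_left nhdsWithin_le_nhds
      · filter_upwards [self_mem_nhdsWithin] with τ hτ using sub_pos.2 (mem_Ioi.1 hτ)
    have h2 := (((s'.level j).continuous.tendsto _).comp (h0.comp h1)).sub_const (s'.level j c)
    rw [← map_sub] at h2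
    refine h2.congr' ?_
    filter_upwards [self_mem_nhdsWithin] with τ hτ
    have hτ' : τ - t ≠ 0 := (sub_pos.2 (mem_Ioi.1 hτ)).ne'
    have e1 : x + (t : 𝕜) • u + ((τ - t : ℝ) : 𝕜) • u = x + (τ : 𝕜) • u := by
      rw [add_assoc, ← add_smul, RCLike.ofReal_sub, add_sub_cancel]
    have e2 : φ τ - φ t = s'.level j (f (x + (τ : 𝕜) • u) - f (x + (t : 𝕜) • u)) -
        (τ - t) • s'.level j c := by
      simp only [φ, map_sub, sub_smul]
      abel
    simp only [Function.comp, diffQuot, slope, vsub_eq_sub]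
    rw [e1, e2, smul_sub (τ - t)⁻¹, inv_smul_smul₀ hτ', map_smul, hsm, RCLike.ofReal_inv]
  have h := norm_image_sub_le_of_norm_deriv_right_le_segment hφc hφd
    (fun t ht => hM t ⟨ht.1, ht.2.le⟩) 1 (by simp)
  have e : φ 1 - φ 0 = s'.level j (f (x + u) - f x - c) := by
    simp only [φ, RCLike.ofReal_one, RCLike.ofReal_zero, one_smul, zero_smul, add_zero, sub_zero,
      map_sub]
    abel
  rw [e, sub_zero, mul_one] at h
  exact h

/-- A Gateaux derivative that is continuous in both variables is a Hadamard derivative. -/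
theorem HasGateaux.hasHadamard (s : ScStructure 𝕜 E) (s' : ScStructure 𝕜 F) {f : E → F}
    {D : E → E →L[𝕜] F} {U : Set E} (hf : ContinuousOn f U) (hU : IsOpen U)
    (hD : ∀ x ∈ U, HasGateaux f x (D x))
    (hDc : ContinuousOn (fun p : E × E => D p.1 p.2) (U ×ˢ univ)) {x : E} (hx : x ∈ U) :
    HasHadamard f x (D x) := by
  have := s.isTopologicalAddGroup
  have := s.continuousSMul
  intro v
  refine s'.tendsto_iff.2 fun j => ?_
  rw [Metric.tendsto_nhds]
  intro ε hε
  have h1 : ContinuousAt (fun p : E × E => D p.1 p.2) (x, v) :=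
    hDc.continuousAt ((hU.prod isOpen_univ).mem_nhds ⟨hx, mem_univ _⟩)
  have h2 : ∀ᶠ p : E × E in 𝓝 (x, v), p.1 ∈ U ∧ s'.sn j (D p.1 p.2 - D x v) < ε / 2 := by
    have h0 : ∀ᶠ p : E × E in 𝓝 (x, v), p.1 ∈ U :=
      (continuous_fst.tendsto (x, v)).eventually (hU.mem_nhds hx)
    exact h0.and ((s'.tendsto_iff.1 h1 j).eventually_lt_const (half_pos hε))
  rw [nhds_prod_eq] at h2
  obtain ⟨P, hP, Q, hQ, H⟩ := Filter.eventually_prod_iff.1 h2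
  obtain ⟨m, δ, hδ, hm⟩ := s.mem_nhds_iff.1 hP
  have h3 : ∀ᶠ q : ℝ × E in 𝓝[>] 0 ×ˢ 𝓝 v, s.sn m (x + (q.1 : 𝕜) • q.2 - x) < δ :=
    (s.tendsto_iff.1 (tendsto_add_smul (𝕜 := 𝕜) x v) m).eventually_lt_const hδ
  filter_upwards [eventually_pos_fst v, h3, tendsto_snd.eventually hQ] with q hq hq3 hq2
  have hq0 : (q.1 : 𝕜) ≠ 0 := by exact_mod_cast hq.ne'
  rw [add_sub_cancel_left] at hq3
  have hseg : ∀ t ∈ Icc (0 : ℝ) 1, P (x + (t : 𝕜) • ((q.1 : 𝕜) • q.2)) := by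
    intro t ht
    refine hm _ ?_
    rw [add_sub_cancel_left, map_smul_eq_mul, RCLike.norm_ofReal, abs_of_nonneg ht.1]
    exact (mul_le_of_le_one_left (apply_nonneg _ _) ht.2).trans_lt hq3
  -- The comparison vector is the expected increment `q.1 • D x v`, although the segment runs in the
  -- perturbed direction `q.2`; joint continuity of `D` bounds the difference along the whole
  -- segment.
  have h4 := HasGateaux.sn_sub_le s' hf hD (x := x) (u := (q.1 : 𝕜) • q.2) (j := j)
    (fun t ht => (H (hseg t ht) hq2).1) (c := (q.1 : 𝕜) • D x v) (M := q.1 * (ε / 2))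
    (fun t ht => by
      rw [map_smul, ← smul_sub, map_smul_eq_mul, RCLike.norm_ofReal, abs_of_pos hq]
      exact mul_le_mul_of_nonneg_left (H (hseg t ht) hq2).2.le hq.le)
  rw [Real.dist_eq, sub_zero, abs_of_nonneg (apply_nonneg _ _)]
  have e : diffQuot 𝕜 f x q - D x v =
      (q.1 : 𝕜)⁻¹ • (f (x + (q.1 : 𝕜) • q.2) - f x - (q.1 : 𝕜) • D x v) := by
    rw [diffQuot, smul_sub _ _ ((q.1 : 𝕜) • D x v), inv_smul_smul₀ hq0]
  rw [e, map_smul_eq_mul, norm_inv, RCLike.norm_ofReal, abs_of_pos hq]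
  calc _ ≤ q.1⁻¹ * (q.1 * (ε / 2)) := mul_le_mul_of_nonneg_left h4 (by positivity)
    _ = ε / 2 := by field_simp
    _ < ε := half_lt_self hε

/-! ### Comparison with weak Fréchet and pointwise derivatives. -/

theorem HasScDerivAt.pointwise {κ : DiffKind} {f : E → F} {U : Set E} {x : E} {L : E →L[𝕜] F}
    (h : HasScDerivAt κ f U x L) : HasScDerivAt .pointwise f U x L := by
  obtain ⟨V, hV, hVU, h⟩ := h
  cases κ with
  | weak => exact ⟨V, hV, hVU, fun A hA _ => h.mono (prod_mono hA le_rfl)⟩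
  | pointwise => exact ⟨V, hV, hVU, h⟩

theorem HasScDerivAt.hasGateaux [IsTopologicalAddGroup F] [ContinuousSMul 𝕜 F] [ContinuousSMul 𝕜 E]
    {κ : DiffKind} {f : E → F} {U : Set E} {x : E} {L : E →L[𝕜] F}
    (h : HasScDerivAt κ f U x L) : HasGateaux f x L := by
  obtain ⟨V, hV, -, h⟩ := h.pointwise
  intro u
  have h0 : Tendsto (fun t : ℝ => (t : 𝕜) • u) (𝓝[>] 0) (𝓝 0) := by
    have h1 : Continuous fun t : ℝ => (t : 𝕜) • u := RCLike.continuous_ofReal.smul continuous_const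
    have := h1.tendsto 0
    rw [RCLike.ofReal_zero, zero_smul] at this
    exact this.mono_left nhdsWithin_le_nhds
  -- The hypothesis concerns directions in `V` only. An arbitrary `u` is scaled into `V`, and the
  -- singleton `{l • u}` serves as the finite set.
  obtain ⟨l, hl, hl0⟩ := ((h0.eventually hV.1).and self_mem_nhdsWithin).exists
  replace hl0 : 0 < l := hl0
  have hl0' : (l : 𝕜) ≠ 0 := by exact_mod_cast hl0.ne'
  have hc := h {(l : 𝕜) • u} (singleton_subset_iff.2 hl) (finite_singleton _) ((l : 𝕜) • u, 0)
    ⟨rfl, by simp⟩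
  have hr0 : remainder f x L ((l : 𝕜) • u, 0) = 0 := by simp [remainder]
  rw [ContinuousWithinAt, hr0] at hc
  have h2 : Tendsto (fun t : ℝ => ((l : 𝕜) • u, t / l)) (𝓝[>] 0)
      (𝓝[{(l : 𝕜) • u} ×ˢ Icc (0 : ℝ) 1] ((l : 𝕜) • u, 0)) := by
    refine tendsto_nhdsWithin_iff.2 ⟨?_, ?_⟩
    · have : Tendsto (fun t : ℝ => t / l) (𝓝 0) (𝓝 (0 / l)) := (continuous_id.div_const l).tendsto 0
      rw [zero_div] at this
      exact tendsto_const_nhds.prodMk_nhds (this.mono_left nhdsWithin_le_nhds)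
    · filter_upwards [Ioo_mem_nhdsGT hl0] with t ht
      exact ⟨rfl, div_nonneg ht.1.le hl0.le, (div_le_one hl0).2 ht.2.le⟩
  have h3 := ((hc.comp h2).const_smul (l : 𝕜)⁻¹).add_const (L u)
  rw [smul_zero, zero_add] at h3
  refine h3.congr' ?_
  filter_upwards [self_mem_nhdsWithin] with t ht
  have ht0 : t ≠ 0 := (mem_Ioi.1 ht).ne'
  have ht0' : (t : 𝕜) ≠ 0 := by exact_mod_cast ht0
  have e1 : ((t / l : ℝ) : 𝕜) • ((l : 𝕜) • u) = (t : 𝕜) • u := by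
    rw [smul_smul, RCLike.ofReal_div, div_mul_cancel₀ _ hl0']
  have e2 : (l : 𝕜)⁻¹ * ((t / l : ℝ) : 𝕜)⁻¹ = (t : 𝕜)⁻¹ := by
    rw [RCLike.ofReal_div]; field_simp
  simp only [Function.comp, remainder, if_neg (div_ne_zero ht0 hl0.ne'), diffQuot]
  rw [e1, smul_sub, smul_smul, e2, map_smul, inv_smul_smul₀ hl0', sub_add_cancel]

/-- At `t = 0` continuity of the remainder is the Hadamard condition, since the direction varies
along with `t`; at `t > 0` it follows from continuity of `f`. Thus one condition yields both kinds
of differentiability. -/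
theorem HasHadamard.hasScDerivAt (s : ScStructure 𝕜 E) (s' : ScStructure 𝕜 F) (κ : DiffKind)
    {f : E → F} {U : Set E} {x : E} {L : E →L[𝕜] F} (h : HasHadamard f x L) (hU : IsOpen U)
    (hf : ContinuousOn f U) (hx : x ∈ U) : HasScDerivAt κ f U x L := by
  have := s.isTopologicalAddGroup
  have := s.continuousSMul
  have := s'.isTopologicalAddGroup
  have := s'.continuousSMul
  suffices H : HasScDerivAt .weak f U x L by
    cases κ with
    | weak => exact H
    | pointwise => exact H.pointwise
  obtain ⟨m, δ, hδ, hm⟩ := s.mem_nhds_iff.1 (hU.mem_nhds hx)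
  have hVU : ∀ u, s.sn m u < δ → x + u ∈ U := fun u hu => hm _ (by rwa [add_sub_cancel_left])
  refine ⟨{u | s.sn m u < δ}, ⟨s.mem_nhds_iff.2 ⟨m, δ, hδ, fun e he => by simpa using he⟩, ?_, ?_⟩,
    hVU, ?_⟩
  · intro a ha u hu
    obtain ⟨u, hu, rfl⟩ := hu
    change s.sn m (a • u) < δ
    rw [map_smul_eq_mul]
    exact (mul_le_of_le_one_left (apply_nonneg _ _) ha).trans_lt hu
  · intro y hy z hz t ht
    change s.sn m _ < δ
    refine (map_add_le_add _ _ _).trans_lt ?_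
    rw [map_smul_eq_mul, map_smul_eq_mul, RCLike.norm_ofReal, RCLike.norm_ofReal,
      abs_of_nonneg ht.1, abs_of_nonneg (sub_nonneg.2 ht.2)]
    have hy' : s.sn m y < δ := hy
    have hz' : s.sn m z < δ := hz
    rcases eq_or_lt_of_le ht.1 with h0 | h0
    · rw [← h0]; simpa using hy'
    · have := mul_lt_mul_of_pos_left hz' h0
      have := mul_le_mul_of_nonneg_left hy'.le (sub_nonneg.2 ht.2)
      linarith
  · rintro ⟨u, t⟩ ⟨hu, ht⟩
    rcases eq_or_lt_of_le ht.1 with h0 | h0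
    · change (0 : ℝ) = t at h0
      subst h0
      rw [ContinuousWithinAt]
      have hr0 : remainder f x L (u, 0) = 0 := by simp [remainder]
      rw [hr0]
      have h1 : Tendsto (fun q : ℝ × E => diffQuot 𝕜 f x q - L q.2) (𝓝[>] 0 ×ˢ 𝓝 u) (𝓝 0) := by
        have := (h u).sub ((L.continuous.tendsto u).comp (tendsto_snd (f := 𝓝[>] (0 : ℝ))))
        rwa [sub_self] at this
      have e : 𝓝[>] (0 : ℝ) ×ˢ 𝓝 u = 𝓝[Ioi (0 : ℝ) ×ˢ univ] (0, u) := by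
        rw [nhdsWithin_prod_eq, nhdsWithin_univ]
      rw [e] at h1
      intro N hN
      have h2 := eventually_nhdsWithin_iff.1 (h1.eventually hN)
      have h3 : Tendsto (fun q : E × ℝ => (q.2, q.1)) (𝓝[{u | s.sn m u < δ} ×ˢ Icc 0 1] (u, 0))
          (𝓝 (0, u)) := (continuous_swap.tendsto (u, (0 : ℝ))).mono_left nhdsWithin_le_nhds
      rw [mem_map]
      filter_upwards [h3.eventually h2, self_mem_nhdsWithin] with q hq hq'
      change remainder f x L q ∈ N
      rcases eq_or_lt_of_le hq'.2.1 with h4 | h4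
      · rw [remainder, if_pos h4.symm]
        exact mem_of_mem_nhds hN
      · rw [remainder, if_neg h4.ne']
        exact hq ⟨h4, mem_univ _⟩
    · change (0 : ℝ) < t at h0
      refine ContinuousAt.continuousWithinAt ?_
      have hxu : x + (t : 𝕜) • u ∈ U := hVU _ (by
        rw [map_smul_eq_mul, RCLike.norm_ofReal, abs_of_pos h0]
        exact (mul_le_of_le_one_left (apply_nonneg _ _) ht.2).trans_lt hu)
      have ht0 : (t : 𝕜) ≠ 0 := by exact_mod_cast h0.ne'
      have h1 : ContinuousAt (fun q : E × ℝ =>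
          (q.2 : 𝕜)⁻¹ • (f (x + (q.2 : 𝕜) • q.1) - f x) - L q.1) (u, t) := by
        have hc : Continuous fun q : E × ℝ => (q.2 : 𝕜) :=
          RCLike.continuous_ofReal.comp continuous_snd
        refine ContinuousAt.sub (ContinuousAt.smul (hc.continuousAt.inv₀ ht0)
          (ContinuousAt.sub ?_ continuousAt_const)) (L.continuous.comp continuous_fst).continuousAt
        have hc2 : ContinuousAt (fun q : E × ℝ => x + (q.2 : 𝕜) • q.1) (u, t) :=
          (continuous_const.add (hc.smul continuous_fst)).continuousAt
        exact ContinuousAt.comp (f := fun q : E × ℝ => x + (q.2 : 𝕜) • q.1) (g := f)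
          (hf.continuousAt (hU.mem_nhds hxu)) hc2
      refine h1.congr ?_
      have : ∀ᶠ q : E × ℝ in 𝓝 (u, t), 0 < q.2 :=
        (continuous_snd.tendsto (u, t)).eventually (lt_mem_nhds h0)
      filter_upwards [this] with q hq
      rw [remainder, if_neg hq.ne']

theorem HasGateaux.scDeriv_eq [IsTopologicalAddGroup F] [ContinuousSMul 𝕜 F] [ContinuousSMul 𝕜 E]
    [T2Space F] {κ : DiffKind} {f : E → F} {U : Set E} {x : E} {L : E →L[𝕜] F}
    (h : HasGateaux f x L) (hL : ∃ L : E →L[𝕜] F, HasScDerivAt κ f U x L) :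
    scDeriv 𝕜 f U x = L := by
  have hp : ∃ L : E →L[𝕜] F, HasScDerivAt .pointwise f U x L := hL.imp fun _ h => h.pointwise
  rw [scDeriv, dif_pos hp]
  exact hp.choose_spec.hasGateaux.unique h

theorem eventually_add_smul_mem [ContinuousAdd E] [ContinuousSMul 𝕜 E] {U : Set E}
    (hU : IsOpen U) {x : E} (hx : x ∈ U) (u : E) : ∀ᶠ t : ℝ in 𝓝[>] 0, x + (t : 𝕜) • u ∈ U :=
  ((tendsto_add_smul (𝕜 := 𝕜) x u).comp
    (tendsto_id.prodMk (tendsto_const_nhds (x := u)))).eventually (hU.mem_nhds hx)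

/-- This extracts the linear coefficient of a polynomial in `t`. For `d = 0` the quotient vanishes
by the convention `0 ^ 0 = 1`. -/
theorem tendsto_pow_quotient (d : ℕ) :
    Tendsto (fun t : ℝ => (t : 𝕜)⁻¹ * ((t : 𝕜) ^ d - 0 ^ d)) (𝓝[>] 0)
      (𝓝 (if d = 1 then 1 else 0)) := by
  have hne : ∀ᶠ t : ℝ in 𝓝[>] 0, (t : 𝕜) ≠ 0 := by
    filter_upwards [self_mem_nhdsWithin] with t ht
    exact_mod_cast (mem_Ioi.1 ht).ne'
  rcases d with _ | _ | d
  · simp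
  · refine tendsto_const_nhds.congr' ?_
    filter_upwards [hne] with t ht
    simp [ht]
  · have h0 : Tendsto (fun t : ℝ => (t : 𝕜) ^ (d + 1)) (𝓝[>] 0) (𝓝 0) := by
      have : Continuous fun t : ℝ => (t : 𝕜) ^ (d + 1) := RCLike.continuous_ofReal.pow _
      have := this.tendsto 0
      rw [RCLike.ofReal_zero, zero_pow (by omega)] at this
      exact this.mono_left nhdsWithin_le_nhds
    rw [if_neg (by omega)]
    refine h0.congr' ?_
    filter_upwards [hne] with t ht
    rw [zero_pow (by omega), sub_zero, pow_succ' _ (d + 1), inv_mul_cancel_left₀ ht]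

/-- Along `w + t w'` the map is a polynomial in `t`, so its derivative is the coefficient of degree
one. This is a sum of values of `h`, and no information beyond `h` is needed to control derivatives
in the second variable. -/
theorem deriv_snd_of_split (s' : ScStructure 𝕜 F) {W : Type*} [AddCommGroup W] [Module 𝕜 W]
    [TopologicalSpace W] {h : E × W → F} {ι : Type} [Fintype ι] {d : ι → ℕ}
    {B : ι → W × W →L[𝕜] W} {x : E} (H : ∀ (w w' : W) (t : ℝ),
      h (x, w + (t : 𝕜) • w') = ∑ i, (t : 𝕜) ^ d i • h (x, B i (w, w')))
    {w : W} {L : E × W →L[𝕜] F} (hL : HasHadamard h (x, w) L) (w' : W) :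
    L (0, w') = ∑ i ∈ Finset.univ.filter (fun i => d i = 1), h (x, B i (w, w')) := by
  have := s'.isTopologicalAddGroup
  have := s'.continuousSMul
  have := s'.t2Space
  refine tendsto_nhds_unique (hL.hasGateaux (0, w')) ?_
  have h0 := tendsto_finsetSum Finset.univ fun i (_ : i ∈ Finset.univ) =>
    (tendsto_pow_quotient (𝕜 := 𝕜) (d i)).smul_const (h (x, B i (w, w')))
  have e : ∑ i, (if d i = 1 then (1 : 𝕜) else 0) • h (x, B i (w, w')) =
      ∑ i ∈ Finset.univ.filter (fun i => d i = 1), h (x, B i (w, w')) := by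
    simp [Finset.sum_filter, ite_smul]
  rw [e] at h0
  refine h0.congr fun t => ?_
  have h1 := H w w' 0
  rw [RCLike.ofReal_zero, zero_smul, add_zero] at h1
  simp only [diffQuot, Prod.smul_mk, Prod.mk_add_mk, smul_zero, add_zero]
  rw [H w w' t, h1, ← Finset.sum_sub_distrib, Finset.smul_sum]
  refine Finset.sum_congr rfl fun i _ => ?_
  rw [← sub_smul, smul_smul]

end Deriv

/-! ### Differentiability classes -/

section Classes

variable {𝕜 : Type w} [RCLike 𝕜] {E : Type u} [AddCommGroup E] [Module 𝕜 E] [TopologicalSpace E]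
  [PreTame 𝕜 E] {F : Type v} [AddCommGroup F] [Module 𝕜 F] [TopologicalSpace F] [PreTame 𝕜 F]
  {G : Type u'} [AddCommGroup G] [Module 𝕜 G] [TopologicalSpace G] [PreTame 𝕜 G]

/-- A continuous linear map that satisfies tame estimates. -/
def IsTameLin (L : E →L[𝕜] F) : Prop :=
  ∃ s ∈ Compat 𝕜 E, ∃ s' ∈ Compat 𝕜 F, ∃ c, ∀ j, ∃ C : ℝ, 0 ≤ C ∧
    ∀ x, s'.sn j (L x) ≤ C * s.sn (j + c) x

theorem IsTameLin.exists_le {L : E →L[𝕜] F} (hL : IsTameLin L) {s : ScStructure 𝕜 E}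
    (hs : s ∈ Compat 𝕜 E) {s' : ScStructure 𝕜 F} (hs' : s' ∈ Compat 𝕜 F) :
    ∃ c, ∀ j, ∃ C : ℝ, 0 ≤ C ∧ ∀ x, s'.sn j (L x) ≤ C * s.sn (j + c) x := by
  obtain ⟨t, ht, t', ht', c, hc⟩ := hL
  obtain ⟨c₁, h₁⟩ := exists_sn_le hs ht
  obtain ⟨c₂, h₂⟩ := exists_sn_le ht' hs'
  refine ⟨c₂ + c + c₁, fun j => ?_⟩
  obtain ⟨C₂, hC₂, H₂⟩ := h₂ j
  obtain ⟨C, hC, H⟩ := hc (j + c₂)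
  obtain ⟨C₁, hC₁, H₁⟩ := h₁ (j + c₂ + c)
  refine ⟨C₂ * (C * C₁), by positivity, fun x => (H₂ _).trans ?_⟩
  rw [mul_assoc, mul_assoc]
  refine mul_le_mul_of_nonneg_left ((H _).trans
    (mul_le_mul_of_nonneg_left ((H₁ x).trans ?_) hC)) hC₂
  rw [show j + c₂ + c + c₁ = j + (c₂ + c + c₁) by omega]

theorem IsTameLin.comp {M : F →L[𝕜] G} {L : E →L[𝕜] F} (hM : IsTameLin M) (hL : IsTameLin L) :
    IsTameLin (M.comp L) := by
  obtain ⟨s, hs, s', hs', c, hc⟩ := hL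
  obtain ⟨t, ht⟩ := exists_compat 𝕜 G
  obtain ⟨d, hd⟩ := hM.exists_le hs' ht
  refine ⟨s, hs, t, ht, d + c, fun j => ?_⟩
  obtain ⟨C₁, hC₁, H₁⟩ := hd j
  obtain ⟨C₂, hC₂, H₂⟩ := hc (j + d)
  refine ⟨C₁ * C₂, by positivity, fun x => (H₁ _).trans ?_⟩
  rw [mul_assoc, ← add_assoc]
  exact mul_le_mul_of_nonneg_left (H₂ x) hC₁

theorem IsTameLin.prod {M : E →L[𝕜] G} {L : E →L[𝕜] F} (hM : IsTameLin M) (hL : IsTameLin L) :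
    IsTameLin (M.prod L) := by
  obtain ⟨s, hs, s', hs', c, hc⟩ := hL
  obtain ⟨t, ht⟩ := exists_compat 𝕜 G
  obtain ⟨d, hd⟩ := hM.exists_le hs ht
  refine ⟨s, hs, _, compat_prod ht hs', d + c, fun j => ?_⟩
  obtain ⟨C₁, hC₁, H₁⟩ := hd j
  obtain ⟨C₂, hC₂, H₂⟩ := hc j
  have h1 : ∀ x, s.sn (j + d) x ≤ s.sn (j + (d + c)) x := s.sn_mono (by omega)
  have h2 : ∀ x, s.sn (j + c) x ≤ s.sn (j + (d + c)) x := s.sn_mono (by omega)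
  have h3 : ∀ m x, 0 ≤ s.sn m x := fun _ _ => apply_nonneg _ _
  refine ⟨C₁ + C₂, by positivity, fun x => max_le ((H₁ x).trans ?_) ((H₂ x).trans ?_)⟩
  · have := mul_le_mul_of_nonneg_left (h1 x) hC₁
    have := mul_nonneg hC₂ (h3 (j + (d + c)) x)
    linarith
  · have := mul_le_mul_of_nonneg_left (h2 x) hC₂
    have := mul_nonneg hC₁ (h3 (j + (d + c)) x)
    linarith

variable (𝕜 E F) in
theorem isTameLin_fst : IsTameLin (ContinuousLinearMap.fst 𝕜 E F) := by
  obtain ⟨s, hs⟩ := exists_compat 𝕜 E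
  obtain ⟨t, ht⟩ := exists_compat 𝕜 F
  refine ⟨_, compat_prod hs ht, s, hs, 0, fun j => ⟨1, zero_le_one, fun x => ?_⟩⟩
  rw [one_mul]; exact le_max_left _ _

variable (𝕜 E F) in
theorem isTameLin_snd : IsTameLin (ContinuousLinearMap.snd 𝕜 E F) := by
  obtain ⟨s, hs⟩ := exists_compat 𝕜 E
  obtain ⟨t, ht⟩ := exists_compat 𝕜 F
  refine ⟨_, compat_prod hs ht, t, ht, 0, fun j => ⟨1, zero_le_one, fun x => ?_⟩⟩
  rw [one_mul]; exact le_max_right _ _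

variable (𝕜 E F) in
theorem isTameLin_zero : IsTameLin (0 : E →L[𝕜] F) := by
  obtain ⟨s, hs⟩ := exists_compat 𝕜 E
  obtain ⟨t, ht⟩ := exists_compat 𝕜 F
  exact ⟨s, hs, t, ht, 0, fun j => ⟨0, le_rfl, fun x => by simp⟩⟩

theorem IsTameLin.prodMap {E₁ : Type*} [AddCommGroup E₁] [Module 𝕜 E₁] [TopologicalSpace E₁]
    [PreTame 𝕜 E₁] {M : E →L[𝕜] G} {L : E₁ →L[𝕜] F} (hM : IsTameLin M) (hL : IsTameLin L) :
    IsTameLin (M.prodMap L) :=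
  (hM.comp (isTameLin_fst 𝕜 E E₁)).prod (hL.comp (isTameLin_snd 𝕜 E E₁))

/-- A linear combination of the two components of a pair. -/
theorem isTameLin_linComb (a b : 𝕜) [IsTopologicalAddGroup F] [ContinuousSMul 𝕜 F] :
    IsTameLin (a • ContinuousLinearMap.fst 𝕜 F F + b • ContinuousLinearMap.snd 𝕜 F F) := by
  obtain ⟨s, hs⟩ := exists_compat 𝕜 F
  refine ⟨_, compat_prod hs hs, s, hs, 0, fun j => ⟨‖a‖ + ‖b‖, by positivity, fun x => ?_⟩⟩
  refine (map_add_le_add (s.sn j) _ _).trans ?_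
  change s.sn j (a • x.1) + s.sn j (b • x.2) ≤ _
  rw [map_smul_eq_mul, map_smul_eq_mul, ScStructure.sn_prod, add_mul]
  gcongr
  · exact le_max_left _ _
  · exact le_max_right _ _

variable (𝕜) in
/-- Continuity and, if `τ` holds, tameness. -/
def Sc0 (τ : Prop) (f : E → F) (U : Set E) : Prop :=
  ScContinuousOn 𝕜 f U ∧ (τ → TameOn 𝕜 f U)

variable {τ : Prop}

theorem ScContinuousOn.continuousAt {f : E → F} {U : Set E} (h : ScContinuousOn 𝕜 f U) {x : E}
    (hx : x ∈ U) : ContinuousAt f x := by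
  obtain ⟨s, hs⟩ := exists_compat 𝕜 E
  obtain ⟨s', hs'⟩ := exists_compat 𝕜 F
  exact ((scContinuousOn_iff hs hs').1 h x hx).continuousAt

theorem ScContinuousOn.continuousOn {f : E → F} {U : Set E} (h : ScContinuousOn 𝕜 f U) :
    ContinuousOn f U := fun _ hx => (h.continuousAt hx).continuousWithinAt

theorem Sc0.comp {g : F → G} {f : E → F} {V : Set F} {U : Set E} (hg : Sc0 𝕜 τ g V)
    (hf : Sc0 𝕜 τ f U) (h : MapsTo f U V) : Sc0 𝕜 τ (g ∘ f) U := by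
  obtain ⟨s, hs⟩ := exists_compat 𝕜 E
  obtain ⟨s', hs'⟩ := exists_compat 𝕜 F
  obtain ⟨s'', hs''⟩ := exists_compat 𝕜 G
  rw [Sc0, scContinuousOn_iff hs' hs'', tameOn_iff hs' hs''] at hg
  rw [Sc0, scContinuousOn_iff hs hs', tameOn_iff hs hs'] at hf
  rw [Sc0, scContinuousOn_iff hs hs'', tameOn_iff hs hs'']
  exact ⟨fun x hx => (hg.1 _ (h hx)).comp (hf.1 x hx),
    fun ht x hx => (hg.2 ht _ (h hx)).comp (hf.2 ht x hx) (hf.1 x hx)⟩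

theorem Sc0.prodMk {f : E → F} {g : E → G} {U : Set E} (hf : Sc0 𝕜 τ f U) (hg : Sc0 𝕜 τ g U) :
    Sc0 𝕜 τ (fun e => (f e, g e)) U := by
  obtain ⟨s, hs⟩ := exists_compat 𝕜 E
  obtain ⟨s', hs'⟩ := exists_compat 𝕜 F
  obtain ⟨s'', hs''⟩ := exists_compat 𝕜 G
  rw [Sc0, scContinuousOn_iff hs hs'', tameOn_iff hs hs''] at hg
  rw [Sc0, scContinuousOn_iff hs hs', tameOn_iff hs hs'] at hf
  rw [Sc0, scContinuousOn_iff hs (compat_prod hs' hs''), tameOn_iff hs (compat_prod hs' hs'')]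
  exact ⟨fun x hx => (hf.1 x hx).prodMk (hg.1 x hx),
    fun ht x hx => (hf.2 ht x hx).prodMk (hg.2 ht x hx)⟩

theorem Sc0.restrict {f : E → F} {U V : Set E} (hf : Sc0 𝕜 τ f U) (hV : IsOpen V) (h : V ⊆ U) :
    Sc0 𝕜 τ f V := by
  obtain ⟨s, hs⟩ := exists_compat 𝕜 E
  obtain ⟨s', hs'⟩ := exists_compat 𝕜 F
  rw [Sc0, scContinuousOn_iff hs hs', tameOn_iff hs hs'] at hf ⊢
  exact ⟨fun x hx => (hf.1 x (h hx)).restrict (hV.mem_nhds hx),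
    fun ht x hx => (hf.2 ht x (h hx)).restrict (hV.mem_nhds hx)⟩

theorem Sc0.congr {f g : E → F} {U : Set E} (hf : Sc0 𝕜 τ f U) (h : EqOn f g U) :
    Sc0 𝕜 τ g U := by
  obtain ⟨s, hs⟩ := exists_compat 𝕜 E
  obtain ⟨s', hs'⟩ := exists_compat 𝕜 F
  rw [Sc0, scContinuousOn_iff hs hs', tameOn_iff hs hs'] at hf ⊢
  exact ⟨fun x hx => (hf.1 x hx).imp fun r => .imp fun δ => .imp_right fun H => H.congr h,
    fun ht x hx => (hf.2 ht x hx).imp fun r => .imp fun δ => .imp_right fun H => H.congr h⟩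

theorem Sc0.linear {L : E →L[𝕜] F} (hL : IsTameLin L) : Sc0 𝕜 τ L univ := by
  obtain ⟨s, hs, s', hs', c, hc⟩ := hL
  rw [Sc0, scContinuousOn_iff hs hs', tameOn_iff hs hs']
  refine ⟨fun x _ => ⟨c, 1, one_pos, fun e _ => ⟨mem_univ _, fun j ε hε => ?_⟩⟩,
    fun _ x _ => ⟨c, 1, one_pos, fun e _ => mem_univ _, fun j => ?_⟩⟩
  · obtain ⟨C, hC, H⟩ := hc j
    refine ⟨ε / (C + 1), by positivity, fun e' _ h' => ?_⟩
    rw [← map_sub]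
    rw [lt_div_iff₀ (by positivity)] at h'
    have := apply_nonneg (s.sn (j + c)) (e' - e)
    exact (H _).trans_lt (by nlinarith)
  · obtain ⟨C, hC, H⟩ := hc j
    refine ⟨C, hC, fun e _ => (H e).trans ?_⟩
    gcongr
    linarith

variable (𝕜 τ) in
/-- Iterated Hadamard differentiability, where all iterated differentials `Dⁱf` of the differential
`Df : U × E → F` are continuous and, if `τ` holds, tame. -/
def TSc {F : Type v} [AddCommGroup F] [Module 𝕜 F] [TopologicalSpace F] [PreTame 𝕜 F] :
    ∀ (_ : ℕ) {E : Type u} [AddCommGroup E] [Module 𝕜 E] [TopologicalSpace E]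
      [PreTame 𝕜 E] (_ : E → F) (_ : Set E), Prop
  | 0, _, _, _, _, _, f, U => Sc0 𝕜 τ f U
  | n + 1, E, _, _, _, _, f, U => Sc0 𝕜 τ f U ∧ ∃ D : E → E →L[𝕜] F,
      (∀ x ∈ U, HasHadamard f x (D x)) ∧ TSc n (fun p : E × E => D p.1 p.2) (U ×ˢ univ)

theorem TSc.sc0 {n : ℕ} {f : E → F} {U : Set E} (h : TSc 𝕜 τ n f U) : Sc0 𝕜 τ f U := by
  cases n with
  | zero => exact h
  | succ n => exact h.1

theorem TSc.of_succ {n : ℕ} {f : E → F} {U : Set E} (h : TSc 𝕜 τ (n + 1) f U) :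
    TSc 𝕜 τ n f U := by
  induction n generalizing E with
  | zero => exact h.1
  | succ n ih =>
    obtain ⟨h0, D, hD, h⟩ := h
    exact ⟨h0, D, hD, ih h⟩

theorem TSc.restrict {n : ℕ} {f : E → F} {U V : Set E} (h : TSc 𝕜 τ n f U) (hV : IsOpen V)
    (hVU : V ⊆ U) : TSc 𝕜 τ n f V := by
  induction n generalizing E with
  | zero => exact Sc0.restrict h hV hVU
  | succ n ih =>
    obtain ⟨h0, D, hD, h⟩ := h
    exact ⟨h0.restrict hV hVU, D, fun x hx => hD x (hVU hx),
      ih h (hV.prod isOpen_univ) (prod_mono hVU le_rfl)⟩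

theorem TSc.congr {n : ℕ} {f g : E → F} {U : Set E} (h : TSc 𝕜 τ n f U) (hU : IsOpen U)
    (hfg : EqOn f g U) : TSc 𝕜 τ n g U := by
  obtain ⟨s, hs⟩ := exists_compat 𝕜 E
  have := s.isTopologicalAddGroup
  have := s.continuousSMul
  cases n with
  | zero => exact Sc0.congr h hfg
  | succ n =>
    obtain ⟨h0, D, hD, h⟩ := h
    exact ⟨h0.congr hfg, D, fun x hx => (hD x hx).congr (hfg.eventuallyEq_of_mem (hU.mem_nhds hx)),
      h⟩

theorem TSc.linear (n : ℕ) {L : E →L[𝕜] F} (hL : IsTameLin L) : TSc 𝕜 τ n L univ := by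
  induction n generalizing E with
  | zero => exact Sc0.linear hL
  | succ n ih =>
    refine ⟨Sc0.linear hL, fun _ => L, fun x _ => hasHadamard_linear L x, ?_⟩
    rw [univ_prod_univ]
    exact ih (hL.comp (isTameLin_snd 𝕜 E E))

theorem TSc.comp_linear {n : ℕ} {f : F → G} {U : Set F} (h : TSc 𝕜 τ n f U) (hU : IsOpen U)
    {L : E →L[𝕜] F} (hL : IsTameLin L) : TSc 𝕜 τ n (fun e => f (L e)) (L ⁻¹' U) := by
  have h0 {f : F → G} {U : Set F} (hU : IsOpen U) (h : Sc0 𝕜 τ f U) :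
      Sc0 𝕜 τ (fun e => f (L e)) (L ⁻¹' U) :=
    h.comp ((Sc0.linear hL).restrict (hU.preimage L.continuous) (subset_univ _))
      (mapsTo_preimage L U)
  induction n generalizing E F with
  | zero => exact h0 hU h
  | succ n ih =>
    obtain ⟨h1, D, hD, h⟩ := h
    refine ⟨h0 hU h1, fun x => (D (L x)).comp L,
      fun x hx => (hD (L x) hx).comp (hasHadamard_linear L x), ?_⟩
    have h2 : (L ⁻¹' U) ×ˢ univ = L.prodMap L ⁻¹' (U ×ˢ univ) := by
      ext p; simp
    rw [h2]
    refine ih h (hU.prod isOpen_univ) (hL.prodMap hL) fun hV hg => ?_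
    exact hg.comp ((Sc0.linear (hL.prodMap hL)).restrict
      (hV.preimage (L.prodMap L).continuous) (subset_univ _)) (mapsTo_preimage _ _)

theorem TSc.prodMk {n : ℕ} {f : E → F} {g : E → G} {U : Set E} (hf : TSc 𝕜 τ n f U)
    (hg : TSc 𝕜 τ n g U) : TSc 𝕜 τ n (fun e => (f e, g e)) U := by
  induction n generalizing E with
  | zero => exact Sc0.prodMk hf hg
  | succ n ih =>
    obtain ⟨h0, D, hD, hf⟩ := hf
    obtain ⟨h0', D', hD', hg⟩ := hg
    exact ⟨h0.prodMk h0', fun x => (D x).prod (D' x), fun x hx => (hD x hx).prodMk (hD' x hx),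
      ih hf hg⟩

/-- The differential is `Dg` composed with `(x, u) ↦ (f x, Df(x)u)`, again a composition of maps
with one order less. The first component needs `f` at order `n` only, whence `of_succ`. -/
theorem TSc.comp {n : ℕ} {g : F → G} {f : E → F} {V : Set F} {U : Set E} (hg : TSc 𝕜 τ n g V)
    (hf : TSc 𝕜 τ n f U) (hU : IsOpen U) (h : MapsTo f U V) :
    TSc 𝕜 τ n (fun e => g (f e)) U := by
  induction n generalizing E F with
  | zero => exact Sc0.comp hg hf h
  | succ n ih =>
    have hf' := hf.of_succ
    obtain ⟨h0, D, hD, hg⟩ := hg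
    obtain ⟨h0', D', hD', hf⟩ := hf
    refine ⟨h0.comp h0' h, fun x => (D (f x)).comp (D' x),
      fun x hx => (hD _ (h hx)).comp (hD' x hx), ?_⟩
    have h1 : TSc 𝕜 τ n (fun p : E × E => f p.1) (U ×ˢ univ) := by
      rw [Set.prod_univ]
      exact hf'.comp_linear hU (isTameLin_fst 𝕜 E E)
    exact ih hg (h1.prodMk hf) (hU.prod isOpen_univ) fun p hp => ⟨h hp.1, mem_univ _⟩

end Classes

/-! ### Comparison with the classes `sc̲ⁿ` and with tameness up to order `n` -/

section Comparison

variable {𝕜 : Type w} [RCLike 𝕜] {E : Type u} [AddCommGroup E] [Module 𝕜 E] [TopologicalSpace E]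
  [PreTame 𝕜 E] {F : Type v} [AddCommGroup F] [Module 𝕜 F] [TopologicalSpace F] [PreTame 𝕜 F]
  {W : Type u} [AddCommGroup W] [Module 𝕜 W] [TopologicalSpace W] [PreTame 𝕜 W]
  {τ : Prop} {κ : DiffKind}

theorem HasHadamard.scDeriv_eq {f : E → F} {U : Set E} {x : E} {L : E →L[𝕜] F}
    (h : HasHadamard f x L) (hU : IsOpen U) (hf : ContinuousOn f U) (hx : x ∈ U) :
    scDeriv 𝕜 f U x = L := by
  obtain ⟨s, hs⟩ := exists_compat 𝕜 E
  obtain ⟨s', hs'⟩ := exists_compat 𝕜 F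
  have := s.continuousSMul
  have := s'.isTopologicalAddGroup
  have := s'.continuousSMul
  have := s'.t2Space
  exact h.hasGateaux.scDeriv_eq (κ := .weak) ⟨L, h.hasScDerivAt s s' .weak hU hf hx⟩

/-- Continuity of the differential upgrades either kind of derivative to a Hadamard derivative;
after this the kind `κ` plays no role. -/
theorem hasHadamard_scDeriv {f : E → F} {U : Set E} (hU : IsOpen U) (hf : ScContinuousOn 𝕜 f U)
    (hd : ∀ x ∈ U, ∃ L : E →L[𝕜] F, HasScDerivAt κ f U x L)
    (hc : ScContinuousOn 𝕜 (scDifferential 𝕜 f U) (U ×ˢ univ)) {x : E} (hx : x ∈ U) :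
    HasHadamard f x (scDeriv 𝕜 f U x) := by
  obtain ⟨s, hs⟩ := exists_compat 𝕜 E
  obtain ⟨s', hs'⟩ := exists_compat 𝕜 F
  have := s.continuousSMul
  have := s'.isTopologicalAddGroup
  have := s'.continuousSMul
  have := s'.t2Space
  refine HasGateaux.hasHadamard s s' hf.continuousOn hU (fun x hx => ?_) hc.continuousOn hx
  obtain ⟨L, hL⟩ := hd x hx
  rw [hL.hasGateaux.scDeriv_eq ⟨L, hL⟩]
  exact hL.hasGateaux

theorem ScDiffNat.scContinuousOn {n : ℕ} {f : E → F} {U : Set E} (h : ScDiffNat 𝕜 κ n f U) :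
    ScContinuousOn 𝕜 f U := by
  cases n with
  | zero => exact h
  | succ n => exact h.1

theorem ScDiffNat.tsc {n : ℕ} {f : E → F} {U : Set E} (h : ScDiffNat 𝕜 κ n f U) (hU : IsOpen U) :
    TSc 𝕜 False n f U := by
  induction n generalizing E with
  | zero => exact ⟨h, False.elim⟩
  | succ n ih =>
    obtain ⟨h0, hd, h⟩ := h
    exact ⟨⟨h0, False.elim⟩, scDeriv 𝕜 f U,
      fun x hx => hasHadamard_scDeriv hU h0 hd h.scContinuousOn hx, ih h (hU.prod isOpen_univ)⟩

theorem TSc.scDiffNat {n : ℕ} {f : E → F} {U : Set E} (h : TSc 𝕜 τ n f U) (hU : IsOpen U) :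
    ScDiffNat 𝕜 κ n f U := by
  obtain ⟨s, hs⟩ := exists_compat 𝕜 E
  obtain ⟨s', hs'⟩ := exists_compat 𝕜 F
  induction n generalizing E with
  | zero => exact h.1
  | succ n ih =>
    obtain ⟨h0, D, hD, h⟩ := h
    refine ⟨h0.1, fun x hx => ⟨D x, (hD x hx).hasScDerivAt s s' κ hU h0.1.continuousOn hx⟩,
      ih (h.congr (hU.prod isOpen_univ) fun p hp => ?_) (hU.prod isOpen_univ)
        _ (compat_prod hs hs)⟩
    rw [scDifferential, (hD p.1 hp.1).scDeriv_eq hU h0.1.continuousOn hp.1]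

/-- The linear map `(x, (w, u)) ↦ ((x, w), (u, 0))`. -/
def partialDir (𝕜 : Type w) [RCLike 𝕜] (E W : Type u) [AddCommGroup E] [Module 𝕜 E]
    [TopologicalSpace E] [AddCommGroup W] [Module 𝕜 W] [TopologicalSpace W] :
    E × (W × E) →L[𝕜] (E × W) × (E × W) :=
  ((ContinuousLinearMap.fst 𝕜 E (W × E)).prod
    ((ContinuousLinearMap.fst 𝕜 W E).comp (ContinuousLinearMap.snd 𝕜 E (W × E)))).prod
  (((ContinuousLinearMap.snd 𝕜 W E).comp (ContinuousLinearMap.snd 𝕜 E (W × E))).prod 0)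

theorem isTameLin_partialDir : IsTameLin (partialDir 𝕜 E W) :=
  ((isTameLin_fst _ _ _).prod ((isTameLin_fst _ _ _).comp (isTameLin_snd _ _ _))).prod
    (((isTameLin_snd _ _ _).comp (isTameLin_snd _ _ _)).prod (isTameLin_zero _ _ _))

/-- The partial derivative `(x, (w, u)) ↦ Dh(x, w)(u, 0)`. -/
noncomputable def partialDeriv (𝕜 : Type w) [RCLike 𝕜] {E W : Type u} [AddCommGroup E] [Module 𝕜 E]
    [TopologicalSpace E] [AddCommGroup W] [Module 𝕜 W] [TopologicalSpace W] {F : Type v}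
    [AddCommGroup F] [Module 𝕜 F] [TopologicalSpace F] (U : Set E) (h : E × W → F)
    (p : E × (W × E)) : F :=
  scDeriv 𝕜 h (U ×ˢ univ) (p.1, p.2.1) (p.2.2, 0)

theorem TSc.partialDeriv {n : ℕ} {h : E × W → F} {U : Set E} (hU : IsOpen U)
    (hh : TSc 𝕜 τ (n + 1) h (U ×ˢ univ)) : TSc 𝕜 τ n (partialDeriv 𝕜 U h) (U ×ˢ univ) := by
  obtain ⟨h0, D, hD, hh⟩ := hh
  have hU' : IsOpen (U ×ˢ (univ : Set W)) := hU.prod isOpen_univ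
  have h1 := hh.comp_linear (hU'.prod isOpen_univ) (isTameLin_partialDir (E := E) (W := W))
  have h2 : partialDir 𝕜 E W ⁻¹' ((U ×ˢ univ) ×ˢ univ) = U ×ˢ univ := by
    ext p; simp [partialDir]
  rw [h2] at h1
  refine h1.congr (hU.prod isOpen_univ) fun p hp => ?_
  rw [_root_.partialDeriv, (hD (p.1, p.2.1) ⟨hp.1, mem_univ _⟩).scDeriv_eq hU' h0.1.continuousOn
    ⟨hp.1, mem_univ _⟩]
  rfl

theorem TSc.differentialsTame {n : ℕ} {h : E × W → F} {U : Set E} (hU : IsOpen U)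
    (hh : TSc 𝕜 True n h (U ×ˢ univ)) : DifferentialsTame 𝕜 U n h := by
  induction n generalizing W with
  | zero => exact hh.2 trivial
  | succ n ih => exact ⟨hh.1.2 trivial, ih (hh.partialDeriv hU)⟩

theorem TSc.tameUpToNat {n : ℕ} {f : E → F} {U : Set E} (hU : IsOpen U)
    (h : TSc 𝕜 True n f U) : TameUpToNat 𝕜 f U n := by
  cases n with
  | zero => exact h.2 trivial
  | succ n =>
    obtain ⟨h0, D, hD, h⟩ := h
    refine ⟨h0.2 trivial, TSc.differentialsTame hU (h.congr (hU.prod isOpen_univ) fun p hp => ?_)⟩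
    rw [scDifferential, (hD p.1 hp.1).scDeriv_eq hU h0.1.continuousOn hp.1]

theorem DifferentialsTame.of_succ {n : ℕ} {h : E × W → F} {U : Set E}
    (hh : DifferentialsTame 𝕜 U (n + 1) h) : DifferentialsTame 𝕜 U n h := by
  induction n generalizing W with
  | zero => exact hh.1
  | succ n ih => exact ⟨hh.1, ih hh.2⟩

/-! #### Multilinear dependence on the directions -/

variable (𝕜) in
/-- `h(x, w + t w')` is a polynomial in `t` whose coefficients are values of `h(x, ·)` at points
that depend linearly on `w` and `w'`. -/
def PolySplit (U : Set E) (h : E × W → F) : Prop :=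
  ∃ (ι : Type) (_ : Fintype ι) (d : ι → ℕ) (B : ι → W × W →L[𝕜] W), (∀ i, IsTameLin (B i)) ∧
    ∀ x ∈ U, ∀ (w w' : W) (t : ℝ),
      h (x, w + (t : 𝕜) • w') = ∑ i, (t : 𝕜) ^ d i • h (x, B i (w, w'))

/-- Differentiating the splitting identity in `x` keeps its form. The new direction enters linearly,
so replacing `u` by `u + t u'` produces a second copy of the sum with all exponents raised by one,
whence the index set `ι ⊕ ι`. -/
theorem PolySplit.partialDeriv {h : E × W → F} {U : Set E} (hU : IsOpen U) (hP : PolySplit 𝕜 U h)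
    {D : E × W → E × W →L[𝕜] F} (hD : ∀ p ∈ U ×ˢ (univ : Set W), HasHadamard h p (D p))
    (hc : ContinuousOn h (U ×ˢ univ)) : PolySplit 𝕜 U (partialDeriv 𝕜 U h) := by
  obtain ⟨s, hs⟩ := exists_compat 𝕜 E
  obtain ⟨s', hs'⟩ := exists_compat 𝕜 F
  have := s.isTopologicalAddGroup
  have := s.continuousSMul
  have := s'.isTopologicalAddGroup
  have := s'.continuousSMul
  have := s'.t2Space
  obtain ⟨ι, _, d, B, hB, H⟩ := hP
  have hpd : ∀ x ∈ U, ∀ (w : W) (u : E), _root_.partialDeriv 𝕜 U h (x, (w, u)) = D (x, w) (u, 0) :=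
    fun x hx w u => by
      rw [_root_.partialDeriv, (hD (x, w) ⟨hx, mem_univ _⟩).scDeriv_eq (hU.prod isOpen_univ) hc
        ⟨hx, mem_univ _⟩]
  have key : ∀ x ∈ U, ∀ (w w' : W) (t : ℝ) (u : E), D (x, w + (t : 𝕜) • w') (u, 0) =
      ∑ i, (t : 𝕜) ^ d i • D (x, B i (w, w')) (u, 0) := by
    intro x hx w w' t u
    refine tendsto_nhds_unique ((hD _ ⟨hx, mem_univ _⟩).hasGateaux (u, 0)) ?_
    have h1 := tendsto_finsetSum Finset.univ fun i (_ : i ∈ Finset.univ) =>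
      (((hD (x, B i (w, w')) ⟨hx, mem_univ _⟩).hasGateaux (u, 0)).const_smul ((t : 𝕜) ^ d i))
    refine h1.congr' ?_
    filter_upwards [eventually_add_smul_mem (𝕜 := 𝕜) hU hx u] with a ha
    simp only [diffQuot, Prod.smul_mk, Prod.mk_add_mk, smul_zero, add_zero]
    rw [H x hx, H _ ha, ← Finset.sum_sub_distrib, Finset.smul_sum]
    refine Finset.sum_congr rfl fun i _ => ?_
    rw [← smul_sub, smul_comm]
  let π₁ : (W × E) × (W × E) →L[𝕜] W × W :=
    (ContinuousLinearMap.fst 𝕜 W E).prodMap (ContinuousLinearMap.fst 𝕜 W E)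
  have hπ : IsTameLin π₁ := (isTameLin_fst _ _ _).prodMap (isTameLin_fst _ _ _)
  let p₁ : (W × E) × (W × E) →L[𝕜] E :=
    (ContinuousLinearMap.snd 𝕜 W E).comp (ContinuousLinearMap.fst 𝕜 _ _)
  let p₂ : (W × E) × (W × E) →L[𝕜] E :=
    (ContinuousLinearMap.snd 𝕜 W E).comp (ContinuousLinearMap.snd 𝕜 _ _)
  refine ⟨ι ⊕ ι, inferInstance, Sum.elim d fun i => d i + 1,
    Sum.elim (fun i => ((B i).comp π₁).prod p₁) (fun i => ((B i).comp π₁).prod p₂), ?_, ?_⟩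
  · rintro (i | i)
    · exact ((hB i).comp hπ).prod ((isTameLin_snd _ _ _).comp (isTameLin_fst _ _ _))
    · exact ((hB i).comp hπ).prod ((isTameLin_snd _ _ _).comp (isTameLin_snd _ _ _))
  · rintro x hx ⟨w, u⟩ ⟨w', u'⟩ t
    simp only [Fintype.sum_sum_type, Sum.elim_inl, Sum.elim_inr]
    change _root_.partialDeriv 𝕜 U h (x, (w + (t : 𝕜) • w', u + (t : 𝕜) • u')) =
      ∑ i, (t : 𝕜) ^ d i • _root_.partialDeriv 𝕜 U h (x, (B i (w, w'), u)) +
      ∑ i, (t : 𝕜) ^ (d i + 1) • _root_.partialDeriv 𝕜 U h (x, (B i (w, w'), u'))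
    simp only [hpd x hx]
    have e : ((u + (t : 𝕜) • u', 0) : E × W) = (u, 0) + (t : 𝕜) • (u', 0) := by simp
    rw [e, map_add, map_smul, key x hx, key x hx, Finset.smul_sum]
    congr 1
    refine Finset.sum_congr rfl fun i _ => ?_
    rw [smul_smul, pow_succ']

theorem TSc.add {n : ℕ} {f g : E → F} {U : Set E} (hU : IsOpen U) (hf : TSc 𝕜 τ n f U)
    (hg : TSc 𝕜 τ n g U) : TSc 𝕜 τ n (fun e => f e + g e) U := by
  obtain ⟨s', hs'⟩ := exists_compat 𝕜 F
  have := s'.isTopologicalAddGroup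
  have := s'.continuousSMul
  refine ((TSc.linear n (isTameLin_linComb (F := F) (1 : 𝕜) 1)).comp (hf.prodMk hg) hU
    (mapsTo_univ _ _)).congr hU fun x _ => ?_
  simp

theorem TSc.sub {n : ℕ} {f g : E → F} {U : Set E} (hU : IsOpen U) (hf : TSc 𝕜 τ n f U)
    (hg : TSc 𝕜 τ n g U) : TSc 𝕜 τ n (fun e => f e - g e) U := by
  obtain ⟨s', hs'⟩ := exists_compat 𝕜 F
  have := s'.isTopologicalAddGroup
  have := s'.continuousSMul
  refine ((TSc.linear n (isTameLin_linComb (F := F) (1 : 𝕜) (-1))).comp (hf.prodMk hg) hU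
    (mapsTo_univ _ _)).congr hU fun x _ => ?_
  simp [sub_eq_add_neg]

theorem TSc.sum {n : ℕ} {ι : Type*} (S : Finset ι) {f : ι → E → F} {U : Set E} (hU : IsOpen U)
    (hf : ∀ i, TSc 𝕜 τ n (f i) U) : TSc 𝕜 τ n (fun e => ∑ i ∈ S, f i e) U := by
  classical
  induction S using Finset.induction_on with
  | empty =>
    exact ((TSc.linear n (isTameLin_zero 𝕜 E F)).restrict hU (subset_univ _)).congr hU
      fun x _ => by simp
  | insert i S hi ih =>
    simp only [Finset.sum_insert hi]
    exact (hf i).add hU ih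

/-- The full differential splits as `Dh(x, w)(u, w') = Dh(x, w)(u, 0) + Dh(x, w)(0, w')`. The first
term is the next iterated differential, tame by assumption and again polynomial in the directions.
The second is a sum of values of `h` itself, by `deriv_snd_of_split`. Both are covered by the
induction, for different `W`. -/
theorem tsc_of_differentialsTame {n : ℕ} {h : E × W → F} {U : Set E} (hU : IsOpen U)
    (hh : TSc 𝕜 False n h (U ×ˢ univ)) (ht : DifferentialsTame 𝕜 U n h) (hP : PolySplit 𝕜 U h) :
    TSc 𝕜 True n h (U ×ˢ univ) := by
  induction n generalizing W with
  | zero => exact ⟨hh.1, fun _ => ht⟩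
  | succ n ih =>
    have hU' : IsOpen (U ×ˢ (univ : Set W)) := hU.prod isOpen_univ
    have hp := hh.partialDeriv hU
    have h1 := ih hh.of_succ ht.of_succ hP
    obtain ⟨h0, D, hD, hh⟩ := hh
    have h2 := ih hp ht.2 (hP.partialDeriv hU hD h0.1.continuousOn)
    refine ⟨⟨h0.1, fun _ => ht.1⟩, D, hD, ?_⟩
    obtain ⟨ι, _, d, B, hB, H⟩ := hP
    have hU'' : IsOpen ((U ×ˢ univ) ×ˢ univ : Set ((E × W) × (E × W))) := hU'.prod isOpen_univ
    let P : (E × W) × (E × W) →L[𝕜] E × (W × E) :=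
      ((ContinuousLinearMap.fst 𝕜 E W).comp (ContinuousLinearMap.fst 𝕜 _ _)).prod
        ((ContinuousLinearMap.snd 𝕜 E W).prodMap (ContinuousLinearMap.fst 𝕜 E W))
    have hPt : IsTameLin P := ((isTameLin_fst _ _ _).comp (isTameLin_fst _ _ _)).prod
      ((isTameLin_snd _ _ _).prodMap (isTameLin_fst _ _ _))
    let Q : ι → (E × W) × (E × W) →L[𝕜] E × W := fun i =>
      ((ContinuousLinearMap.fst 𝕜 E W).comp (ContinuousLinearMap.fst 𝕜 _ _)).prod
        ((B i).comp ((ContinuousLinearMap.snd 𝕜 E W).prodMap (ContinuousLinearMap.snd 𝕜 E W)))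
    have hQt : ∀ i, IsTameLin (Q i) := fun i =>
      ((isTameLin_fst _ _ _).comp (isTameLin_fst _ _ _)).prod
        ((hB i).comp ((isTameLin_snd _ _ _).prodMap (isTameLin_snd _ _ _)))
    have h3 := (h2.comp_linear (hU.prod isOpen_univ) hPt).restrict hU'' fun p hp =>
      ⟨hp.1.1, mem_univ _⟩
    have h4 := TSc.sum (Finset.univ.filter fun i => d i = 1) hU'' fun i =>
      (h1.comp_linear hU' (hQt i)).restrict hU'' fun p hp => ⟨hp.1.1, mem_univ _⟩
    refine (h3.add hU'' h4).congr hU'' ?_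
    rintro ⟨⟨x, w⟩, u, w'⟩ ⟨hx, -⟩
    obtain ⟨s', -⟩ := exists_compat 𝕜 F
    have e1 := deriv_snd_of_split s' (H x hx.1) (hD (x, w) hx) w'
    have e2 : partialDeriv 𝕜 U h (x, (w, u)) = D (x, w) (u, 0) := by
      rw [partialDeriv, (hD (x, w) hx).scDeriv_eq hU' h0.1.continuousOn hx]
    have e3 : ((u, w') : E × W) = (u, 0) + (0, w') := by simp
    change partialDeriv 𝕜 U h (x, (w, u)) + ∑ i ∈ _, h (x, B i (w, w')) = D (x, w) (u, w')
    rw [e3, map_add, e1, e2]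

theorem tsc_of_tameUpToNat {n : ℕ} {f : E → F} {U : Set E} (hU : IsOpen U)
    (h : ScDiffNat 𝕜 κ n f U) (ht : TameUpToNat 𝕜 f U n) : TSc 𝕜 True n f U := by
  cases n with
  | zero => exact ⟨h, fun _ => ht⟩
  | succ n =>
    obtain ⟨h0, hd, h⟩ := h
    refine ⟨⟨h0, fun _ => ht.1⟩, scDeriv 𝕜 f U,
      fun x hx => hasHadamard_scDeriv hU h0 hd h.scContinuousOn hx,
      tsc_of_differentialsTame hU (h.tsc (hU.prod isOpen_univ)) ht.2 ?_⟩
    -- `Df(x)` is linear, so `h(x, w + t w') = h(x, w) + t h(x, w')`: one term of degree `0` and one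
    -- of degree `1`.
    refine ⟨Bool, inferInstance, fun b => if b then 1 else 0, fun b =>
      if b then ContinuousLinearMap.snd 𝕜 E E else ContinuousLinearMap.fst 𝕜 E E, ?_, ?_⟩
    · rintro (_ | _)
      · exact isTameLin_fst 𝕜 E E
      · exact isTameLin_snd 𝕜 E E
    · intro x _ w w' t
      simp [add_comm]

end Comparison

/-! ### Regularity of the inverse family and of the inverse map -/

section Regularity

variable {𝕜 : Type w} [RCLike 𝕜] {E : Type u} [AddCommGroup E] [Module 𝕜 E] [TopologicalSpace E]
  [PreTame 𝕜 E] {F : Type v} [AddCommGroup F] [Module 𝕜 F] [TopologicalSpace F] [PreTame 𝕜 F]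
  {τ : Prop}

theorem exists_clm_of_isLinearMap {U : Set E} {ψ : E × F → E}
    (hlin : ∀ x ∈ U, IsLinearMap 𝕜 fun v => ψ (x, v)) (hc : ScContinuousOn 𝕜 ψ (U ×ˢ univ)) :
    ∃ Ψ : E → F →L[𝕜] E, ∀ x ∈ U, ∀ v, Ψ x v = ψ (x, v) := by
  have h : ∀ x ∈ U, ∃ L : F →L[𝕜] E, ∀ v, L v = ψ (x, v) := fun x hx =>
    ⟨⟨(hlin x hx).mk' _, continuous_iff_continuousAt.2 fun v =>
      ContinuousAt.comp (f := fun v => (x, v)) (g := ψ) (hc.continuousAt ⟨hx, mem_univ _⟩)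
        (by fun_prop)⟩, fun _ => rfl⟩
  choose! Ψ hΨ using h
  exact ⟨Ψ, hΨ⟩

/-- With `z = ψ(x, v)`, the increment `ψ(x', v') - z` equals `ψ(x', v' - v - (D x' z - D x z))`.
Dividing by `t` and using only continuity of `ψ` gives the limit `ψ(x, w - D²f(x)(z, u))`. No prior
differentiability of `ψ` is needed. -/
theorem hasHadamard_inverseFamily [IsTopologicalAddGroup F] {U : Set E} (hU : IsOpen U)
    {D : E → E →L[𝕜] F} {DD : E × E → E × E →L[𝕜] F} {ψ : E × F → E} {Ψ : E → F →L[𝕜] E}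
    (hΨ : ∀ x ∈ U, ∀ v, Ψ x v = ψ (x, v)) (hc : ScContinuousOn 𝕜 ψ (U ×ˢ univ))
    (hl : ∀ x ∈ U, ∀ u, Ψ x (D x u) = u) (hr : ∀ x ∈ U, ∀ v, D x (Ψ x v) = v) {x : E} (hx : x ∈ U)
    {v : F} (hDD : HasHadamard (fun p : E × E => D p.1 p.2) (x, ψ (x, v)) (DD (x, ψ (x, v)))) :
    HasHadamard ψ (x, v) ((Ψ x).comp (ContinuousLinearMap.snd 𝕜 E F -
      (DD (x, ψ (x, v))).comp ((ContinuousLinearMap.inl 𝕜 E E).comp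
        (ContinuousLinearMap.fst 𝕜 E F)))) := by
  obtain ⟨s, hs⟩ := exists_compat 𝕜 E
  have := s.isTopologicalAddGroup
  have := s.continuousSMul
  rintro ⟨u, w⟩
  set z := ψ (x, v) with hz
  have h1 : Tendsto (fun q : ℝ × (E × F) => (q.1, ((q.2.1, 0) : E × E))) (𝓝[>] 0 ×ˢ 𝓝 (u, w))
      (𝓝[>] 0 ×ˢ 𝓝 (u, 0)) := tendsto_fst.prodMk
    (((continuous_fst.tendsto (u, w)).comp tendsto_snd).prodMk_nhds tendsto_const_nhds)
  have h2 := (hDD (u, 0)).comp h1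
  have h2' : Tendsto (fun q : ℝ × (E × F) => (q.1, q.2.1)) (𝓝[>] 0 ×ˢ 𝓝 (u, w))
      (𝓝[>] 0 ×ˢ 𝓝 u) := tendsto_fst.prodMk ((continuous_fst.tendsto (u, w)).comp tendsto_snd)
  have h3 : Tendsto (fun q : ℝ × (E × F) => x + (q.1 : 𝕜) • q.2.1) (𝓝[>] 0 ×ˢ 𝓝 (u, w)) (𝓝 x) :=
    (tendsto_add_smul (𝕜 := 𝕜) x u).comp h2'
  have h4 : Tendsto (fun q : ℝ × (E × F) => q.2.2) (𝓝[>] 0 ×ˢ 𝓝 (u, w)) (𝓝 w) :=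
    (continuous_snd.tendsto (u, w)).comp tendsto_snd
  have h5 := ((hc.continuousAt (x := (x, w - DD (x, z) (u, 0))) ⟨hx, mem_univ _⟩).tendsto).comp
    (h3.prodMk_nhds (h4.sub h2))
  have e0 : ((Ψ x).comp (ContinuousLinearMap.snd 𝕜 E F -
      (DD (x, z)).comp ((ContinuousLinearMap.inl 𝕜 E E).comp
        (ContinuousLinearMap.fst 𝕜 E F)))) (u, w) = ψ (x, w - DD (x, z) (u, 0)) := by
    rw [← hΨ x hx]; rfl
  rw [e0]
  refine h5.congr' ?_
  filter_upwards [h3.eventually (hU.mem_nhds hx), eventually_pos_fst (u, w)] with q hq hq0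
  have ht : (q.1 : 𝕜) ≠ 0 := by exact_mod_cast hq0.ne'
  simp only [Function.comp, diffQuot, Prod.smul_mk, Prod.mk_add_mk, smul_zero, add_zero]
  rw [← hΨ _ hq, ← hz]
  have e1 : D x z = v := by rw [hz, ← hΨ x hx, hr x hx]
  have e2 : ψ (x + (q.1 : 𝕜) • q.2.1, v + (q.1 : 𝕜) • q.2.2) - z =
      Ψ (x + (q.1 : 𝕜) • q.2.1) ((q.1 : 𝕜) • q.2.2 - (D (x + (q.1 : 𝕜) • q.2.1) z - D x z)) := by
    rw [← hΨ _ hq, e1, map_sub, map_sub, hl _ hq, map_add]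
    abel
  have e3 : ((x, v) : E × F) + (q.1 : 𝕜) • q.2 =
    (x + (q.1 : 𝕜) • q.2.1, v + (q.1 : 𝕜) • q.2.2) := rfl
  rw [e3, e2, ← map_smul, smul_sub (q.1 : 𝕜)⁻¹ ((q.1 : 𝕜) • q.2.2), inv_smul_smul₀ ht]

/-- The formula for the derivative involves `ψ` and a partial derivative of `Df`. If these have
order `n`, so has the derivative of `ψ`, and the induction proceeds. -/
theorem tsc_inverseFamily {n : ℕ} {U : Set E} (hU : IsOpen U) {D : E → E →L[𝕜] F}
    (hD : TSc 𝕜 τ n (fun p : E × E => D p.1 p.2) (U ×ˢ univ))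
    {ψ : E × F → E} {Ψ : E → F →L[𝕜] E} (hΨ : ∀ x ∈ U, ∀ v, Ψ x v = ψ (x, v))
    (hψ : Sc0 𝕜 τ ψ (U ×ˢ univ)) (hl : ∀ x ∈ U, ∀ u, Ψ x (D x u) = u)
    (hr : ∀ x ∈ U, ∀ v, D x (Ψ x v) = v) : TSc 𝕜 τ n ψ (U ×ˢ univ) := by
  obtain ⟨s', hs'⟩ := exists_compat 𝕜 F
  have := s'.isTopologicalAddGroup
  induction n with
  | zero => exact hψ
  | succ n ih =>
    have h1 := ih hD.of_succ
    have h2 := hD.partialDeriv hU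
    obtain ⟨h0, DD, hDD, hD⟩ := hD
    have hU' : IsOpen (U ×ˢ (univ : Set E)) := hU.prod isOpen_univ
    have hU'' : IsOpen ((U ×ˢ univ) ×ˢ univ : Set ((E × F) × (E × F))) :=
      (hU.prod isOpen_univ).prod isOpen_univ
    refine ⟨hψ, fun p => (Ψ p.1).comp (ContinuousLinearMap.snd 𝕜 E F -
      (DD (p.1, ψ p)).comp ((ContinuousLinearMap.inl 𝕜 E E).comp
        (ContinuousLinearMap.fst 𝕜 E F))), fun p hp => ?_, ?_⟩
    · exact hasHadamard_inverseFamily hU hΨ hψ.1 hl hr hp.1 (hDD (p.1, ψ p) ⟨hp.1, mem_univ _⟩)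
    · have hfst : IsTameLin (ContinuousLinearMap.fst 𝕜 (E × F) (E × F)) := isTameLin_fst _ _ _
      have hsnd : IsTameLin (ContinuousLinearMap.snd 𝕜 (E × F) (E × F)) := isTameLin_snd _ _ _
      have hx := (isTameLin_fst 𝕜 E F).comp hfst
      have hu := (isTameLin_fst 𝕜 E F).comp hsnd
      have hw := (isTameLin_snd 𝕜 E F).comp hsnd
      have hx' := (TSc.linear (τ := τ) n hx).restrict hU'' (subset_univ _)
      have hu' := (TSc.linear (τ := τ) n hu).restrict hU'' (subset_univ _)
      have hw' := (TSc.linear (τ := τ) n hw).restrict hU'' (subset_univ _)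
      have h3 : TSc 𝕜 τ n (fun q : (E × F) × (E × F) => ψ q.1) ((U ×ˢ univ) ×ˢ univ) :=
        h1.comp ((TSc.linear (τ := τ) n hfst).restrict hU'' (subset_univ _)) hU'' fun q hq => hq.1
      have h4 : TSc 𝕜 τ n (fun q : (E × F) × (E × F) =>
          partialDeriv 𝕜 U (fun p : E × E => D p.1 p.2) (q.1.1, (ψ q.1, q.2.1)))
          ((U ×ˢ univ) ×ˢ univ) :=
        h2.comp (hx'.prodMk (h3.prodMk hu')) hU'' fun q hq => ⟨hq.1.1, mem_univ _⟩
      have h5 := h1.comp (hx'.prodMk (hw'.sub hU'' h4)) hU'' fun q hq => ⟨hq.1.1, mem_univ _⟩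
      refine h5.congr hU'' ?_
      rintro ⟨⟨x, v⟩, u, w⟩ ⟨hxv, -⟩
      have e : partialDeriv 𝕜 U (fun p : E × E => D p.1 p.2) (x, (ψ (x, v), u)) =
          DD (x, ψ (x, v)) (u, 0) := by
        rw [partialDeriv, (hDD (x, ψ (x, v)) ⟨hxv.1, mem_univ _⟩).scDeriv_eq hU'
          h0.1.continuousOn ⟨hxv.1, mem_univ _⟩]
      change ψ (x, w - partialDeriv 𝕜 U (fun p : E × E => D p.1 p.2) (x, (ψ (x, v), u))) =
        Ψ x (w - DD (x, ψ (x, v)) (u, 0))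
      rw [e, hΨ x hxv.1]

/-- Since `Dg(y)v = ψ(g y, v)`, order `m` for `g` and `ψ` gives order `m` for `Dg`, that is order `m
+ 1` for `g`. -/
theorem tsc_inverse {n : ℕ} {U : Set E} {V : Set F} (hV : IsOpen V) {g : F → E}
    (hg : Sc0 𝕜 τ g V) (hgV : MapsTo g V U) {ψ : E × F → E} {Ψ : E → F →L[𝕜] E}
    (hΨ : ∀ x ∈ U, ∀ v, Ψ x v = ψ (x, v)) (hd : ∀ y ∈ V, HasHadamard g y (Ψ (g y)))
    (hψ : TSc 𝕜 τ n ψ (U ×ˢ univ)) : TSc 𝕜 τ (n + 1) g V := by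
  have key : ∀ m, TSc 𝕜 τ m g V → TSc 𝕜 τ m ψ (U ×ˢ univ) → TSc 𝕜 τ (m + 1) g V := by
    intro m h1 h2
    refine ⟨hg, fun y => Ψ (g y), hd, ?_⟩
    have hV' : IsOpen (V ×ˢ (univ : Set F)) := hV.prod isOpen_univ
    have h3 : TSc 𝕜 τ m (fun p : F × F => g p.1) (V ×ˢ univ) :=
      h1.comp ((TSc.linear m (isTameLin_fst 𝕜 F F)).restrict hV' (subset_univ _)) hV'
        fun p hp => hp.1
    have h4 := (TSc.linear (τ := τ) m (isTameLin_snd 𝕜 F F)).restrict hV' (subset_univ _)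
    refine (h2.comp (h3.prodMk h4) hV' fun p hp => ⟨hgV hp.1, mem_univ _⟩).congr hV' fun p hp => ?_
    exact (hΨ _ (hgV hp.1) _).symm
  induction n with
  | zero => exact key 0 hg hψ
  | succ n ih => exact key _ (ih hψ.of_succ) hψ

end Regularity

/-! ### Newton iteration with smoothing in graded spaces -/

/-- The data of the Nash–Moser scheme near `x₀`: two spaces with increasing sequences of seminorms,
smoothing operators with loss `P` on the first one, a map `f`, its derivative `D` and a family `ψ` of
inverses of the derivatives, together with tame estimates with loss `r` on a ball for `p r`. -/
structure NashMoser {𝕜 : Type*} [RCLike 𝕜] {E : Type*} [AddCommGroup E] [Module 𝕜 E] {F : Type*}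
    [AddCommGroup F] [Module 𝕜 F] (p : ℕ → Seminorm 𝕜 E) (q : ℕ → Seminorm 𝕜 F) (S : ℝ → E → E)
    (P : ℕ) (f : E → F) (D : E → E → F) (ψ : E → F → E) (x₀ : E) (r : ℕ) (δ : ℝ) : Prop where
  p_mono : ∀ {m n : ℕ}, m ≤ n → ∀ x, p m x ≤ p n x
  q_mono : ∀ {m n : ℕ}, m ≤ n → ∀ x, q m x ≤ q n x
  p_sep : ∀ x, p 0 x = 0 → x = 0
  q_sep : ∀ x, q 0 x = 0 → x = 0
  smooth : ∀ k l : ℕ, ∃ C : ℝ, 0 ≤ C ∧ ∀ t x, 0 ≤ t →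
    p l (S t x) ≤ C * (1 + Real.exp (((P : ℝ) + ((l : ℝ) - k)) * t)) * p k x
  approx : ∀ k l : ℕ, l + P ≤ k → ∃ C : ℝ, 0 ≤ C ∧ ∀ t x, 0 ≤ t →
    p l (x - S t x) ≤ C * Real.exp (((P : ℝ) - ((k : ℝ) - l)) * t) * p k x
  δ_pos : 0 < δ
  δ_le : δ ≤ 1
  ψ_le : ∀ j, ∃ C : ℝ, 0 ≤ C ∧ ∀ x, p r (x - x₀) < δ → ∀ v,
    p j (ψ x v) ≤ C * (q (j + r) v + (1 + p (j + r) (x - x₀)) * q r v)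
  D_le : ∀ j, ∃ C : ℝ, 0 ≤ C ∧ ∀ x, p r (x - x₀) < δ → ∀ u,
    q j (D x u) ≤ C * (p (j + r) u + (1 + p (j + r) (x - x₀)) * p r u)
  Q_le : ∀ j, ∃ C : ℝ, 0 ≤ C ∧ ∀ x u, p r (x - x₀) < δ → p r (x + u - x₀) < δ →
    q j (f (x + u) - f x - D x u) ≤
      C * ((1 + p (j + r) (x - x₀)) * p r u ^ 2 + p (j + r) u * p r u)
  D_sub : ∀ x, p r (x - x₀) < δ → ∀ u u', D x (u - u') = D x u - D x u'
  D_ψ : ∀ x, p r (x - x₀) < δ → ∀ v, D x (ψ x v) = v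
  ψ_D : ∀ x, p r (x - x₀) < δ → ∀ u, ψ x (D x u) = u

namespace NashMoser

variable {𝕜 : Type*} [RCLike 𝕜] {E : Type*} [AddCommGroup E] [Module 𝕜 E] {F : Type*}
  [AddCommGroup F] [Module 𝕜 F] {p : ℕ → Seminorm 𝕜 E} {q : ℕ → Seminorm 𝕜 F} {S : ℝ → E → E}
  {P : ℕ} {f : E → F} {D : E → E → F} {ψ : E → F → E} {x₀ : E} {r : ℕ} {δ : ℝ}

theorem mem_ball_self (h : NashMoser p q S P f D ψ x₀ r δ) : p r (x₀ - x₀) < δ := by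
  simpa using h.δ_pos

theorem f_le (h : NashMoser p q S P f D ψ x₀ r δ) (j : ℕ) : ∃ C : ℝ, 0 ≤ C ∧
    ∀ x, p r (x - x₀) < δ → q j (f x - f x₀) ≤ C * p (j + r) (x - x₀) := by
  obtain ⟨C₁, hC₁, h₁⟩ := h.Q_le j
  obtain ⟨C₂, hC₂, h₂⟩ := h.D_le j
  refine ⟨2 * C₁ + 2 * C₂, by positivity, fun x hx => ?_⟩
  set u := x - x₀ with hu
  have e : x₀ + u = x := by rw [hu]; abel
  have h3 := h₁ x₀ u h.mem_ball_self (by rwa [e])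
  have h4 := h₂ x₀ h.mem_ball_self u
  rw [e] at h3
  rw [sub_self, map_zero, add_zero, one_mul] at h3 h4
  have h5 := map_add_le_add (q j) (f x - f x₀ - D x₀ u) (D x₀ u)
  rw [sub_add_cancel] at h5
  have h6 : p r u ≤ p (j + r) u := h.p_mono (by omega) u
  have h7 : 0 ≤ p r u := apply_nonneg _ _
  have h8 : p r u ≤ 1 := hx.le.trans h.δ_le
  have h9 : p r u ^ 2 + p (j + r) u * p r u ≤ 2 * p (j + r) u := by nlinarith
  have h10 := mul_le_mul_of_nonneg_left h9 hC₁
  have h11 := mul_le_mul_of_nonneg_left h6 hC₂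
  linarith

/-- The residual is controlled by the data and the current point. -/
theorem residual_le (h : NashMoser p q S P f D ψ x₀ r δ) (j : ℕ) : ∃ C : ℝ, 0 ≤ C ∧
    ∀ x y, p r (x - x₀) < δ → q (j + r) (y - f x) ≤
      C * (1 + q (j + 2 * r) (y - f x₀) + p (j + 2 * r) (x - x₀)) := by
  obtain ⟨C, hC, h₁⟩ := h.f_le (j + r)
  refine ⟨1 + C, by positivity, fun x y hx => ?_⟩
  have h2 := map_sub_le_add (q (j + r)) (y - f x₀) (f x - f x₀)
  rw [sub_sub_sub_cancel_right] at h2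
  have h3 := h₁ x hx
  rw [show j + r + r = j + 2 * r by omega] at h3
  have h4 : q (j + r) (y - f x₀) ≤ q (j + 2 * r) (y - f x₀) := h.q_mono (by omega) _
  have h5 : 0 ≤ q (j + 2 * r) (y - f x₀) := apply_nonneg _ _
  have h6 : 0 ≤ p (j + 2 * r) (x - x₀) := apply_nonneg _ _
  nlinarith

/-- One loss `r` comes from `ψ` and another from `f` inside the residual, together `2r`. The low
norm of the residual is at most one, so the product in the estimate for `ψ` stays affine in the high
norms. -/
theorem newton_le (h : NashMoser p q S P f D ψ x₀ r δ) (j : ℕ) : ∃ C : ℝ, 0 ≤ C ∧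
    ∀ x y, p r (x - x₀) < δ → q r (y - f x) ≤ 1 → p j (ψ x (y - f x)) ≤
      C * (1 + q (j + 2 * r) (y - f x₀) + p (j + 2 * r) (x - x₀)) := by
  obtain ⟨C₁, hC₁, h₁⟩ := h.ψ_le j
  obtain ⟨C₂, hC₂, h₂⟩ := h.residual_le j
  refine ⟨C₁ * (C₂ + 1), by positivity, fun x y hx hy => (h₁ x hx _).trans ?_⟩
  rw [mul_assoc]
  refine mul_le_mul_of_nonneg_left ?_ hC₁
  have h3 := h₂ x y hx
  have h4 : p (j + r) (x - x₀) ≤ p (j + 2 * r) (x - x₀) := h.p_mono (by omega) _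
  have h5 : 0 ≤ q (j + 2 * r) (y - f x₀) := apply_nonneg _ _
  have h6 : 0 ≤ p (j + r) (x - x₀) := apply_nonneg _ _
  have h7 : 0 ≤ q r (y - f x) := apply_nonneg _ _
  nlinarith

/-! ### Estimates for a single smoothed Newton step. -/

theorem one_add_exp_le {a b t : ℝ} (hb : 0 ≤ b) (hab : a ≤ b) (ht : 0 ≤ t) :
    1 + Real.exp (a * t) ≤ 2 * Real.exp (b * t) := by
  have h1 : Real.exp (a * t) ≤ Real.exp (b * t) := Real.exp_le_exp.2 (by gcongr)
  have h2 : 1 ≤ Real.exp (b * t) := Real.one_le_exp (by positivity)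
  linarith

/-- Growth of the smoothed Newton step in high norms. -/
theorem step_growth (h : NashMoser p q S P f D ψ x₀ r δ) (j : ℕ) : ∃ C : ℝ, 0 ≤ C ∧
    ∀ x y t, p r (x - x₀) < δ → q r (y - f x) ≤ 1 → 0 ≤ t →
      p (j + 2 * r) (S t (ψ x (y - f x))) ≤ C * Real.exp (((P + 2 * r : ℕ) : ℝ) * t) *
        (1 + q (j + 2 * r) (y - f x₀) + p (j + 2 * r) (x - x₀)) := by
  obtain ⟨C₁, hC₁, h₁⟩ := h.newton_le j
  obtain ⟨C₂, hC₂, h₂⟩ := h.smooth j (j + 2 * r)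
  refine ⟨C₂ * 2 * C₁, by positivity, fun x y t hx hy ht => (h₂ t _ ht).trans ?_⟩
  -- Smoothing from norm `j` back to norm `j + 2r` repairs the loss of the Newton step, so the same
  -- norm appears on both sides and the rate `P + 2r` is the same for all `j`.
  have h3 := one_add_exp_le (a := (P : ℝ) + ((j + 2 * r : ℕ) - j)) (b := ((P + 2 * r : ℕ) : ℝ))
    (by positivity) (by push_cast; linarith) ht
  calc _ ≤ C₂ * (2 * Real.exp (((P + 2 * r : ℕ) : ℝ) * t)) *
        (C₁ * (1 + q (j + 2 * r) (y - f x₀) + p (j + 2 * r) (x - x₀))) := by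
        have := h₁ x y hx hy
        gcongr
    _ = _ := by ring

/-- The smoothed Newton step is small in a fixed norm if the residual is small. -/
theorem step_low (h : NashMoser p q S P f D ψ x₀ r δ) (m : ℕ) : ∃ C : ℝ, 0 ≤ C ∧
    ∀ x y t, p r (x - x₀) < δ → 0 ≤ t →
      p m (S t (ψ x (y - f x))) ≤ C * Real.exp (((P + m : ℕ) : ℝ) * t) * q r (y - f x) := by
  obtain ⟨C₁, hC₁, h₁⟩ := h.ψ_le 0
  obtain ⟨C₂, hC₂, h₂⟩ := h.smooth 0 m
  refine ⟨C₂ * 2 * (C₁ * 3), by positivity, fun x y t hx ht => (h₂ t _ ht).trans ?_⟩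
  have h3 := one_add_exp_le (a := (P : ℝ) + (m - (0 : ℕ))) (b := ((P + m : ℕ) : ℝ))
    (by positivity) (by push_cast; linarith) ht
  have h4 : p 0 (ψ x (y - f x)) ≤ C₁ * (3 * q r (y - f x)) := by
    refine (h₁ x hx _).trans (mul_le_mul_of_nonneg_left ?_ hC₁)
    rw [zero_add]
    have h5 : p r (x - x₀) ≤ 1 := hx.le.trans h.δ_le
    have h7 : 0 ≤ q r (y - f x) := apply_nonneg _ _
    nlinarith
  calc _ ≤ C₂ * (2 * Real.exp (((P + m : ℕ) : ℝ) * t)) * (C₁ * (3 * q r (y - f x))) := by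
        gcongr
    _ = _ := by ring

/-- The smoothed Newton step in terms of the residual, without loss beyond `P`. -/
theorem step_high (h : NashMoser p q S P f D ψ x₀ r δ) (j : ℕ) : ∃ C : ℝ, 0 ≤ C ∧
    ∀ x y t, p r (x - x₀) < δ → 0 ≤ t → p j (S t (ψ x (y - f x))) ≤ C * Real.exp ((P : ℝ) * t) *
      (q (j + r) (y - f x) + (1 + p (j + r) (x - x₀)) * q r (y - f x)) := by
  obtain ⟨C₁, hC₁, h₁⟩ := h.ψ_le j
  obtain ⟨C₂, hC₂, h₂⟩ := h.smooth j j
  refine ⟨C₂ * 2 * C₁, by positivity, fun x y t hx ht => (h₂ t _ ht).trans ?_⟩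
  have h3 := one_add_exp_le (a := (P : ℝ) + ((j : ℝ) - j)) (b := (P : ℝ))
    (by positivity) (by linarith) ht
  calc _ ≤ C₂ * (2 * Real.exp ((P : ℝ) * t)) * (C₁ * (q (j + r) (y - f x) +
        (1 + p (j + r) (x - x₀)) * q r (y - f x))) := by
        have := h₁ x hx (y - f x)
        gcongr
    _ = _ := by ring

/-- The smoothing error in the Newton step. -/
theorem step_error (h : NashMoser p q S P f D ψ x₀ r δ) (l B : ℕ) : ∃ C : ℝ, 0 ≤ C ∧
    ∀ x y t, p r (x - x₀) < δ → q r (y - f x) ≤ 1 → 0 ≤ t →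
      p l (ψ x (y - f x) - S t (ψ x (y - f x))) ≤ C * Real.exp (-(B : ℝ) * t) *
        (1 + q (l + P + B + 2 * r) (y - f x₀) + p (l + P + B + 2 * r) (x - x₀)) := by
  obtain ⟨C₁, hC₁, h₁⟩ := h.newton_le (l + P + B)
  obtain ⟨C₂, hC₂, h₂⟩ := h.approx (l + P + B) l (by omega)
  refine ⟨C₂ * C₁, by positivity, fun x y t hx hy ht => (h₂ t _ ht).trans ?_⟩
  -- Measuring the Newton step in norm `l + P + B` makes the smoothing error decay at rate exactly
  -- `B`.
  have e : (P : ℝ) - (((l + P + B : ℕ) : ℝ) - l) = -B := by push_cast; ring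
  rw [e]
  calc _ ≤ C₂ * Real.exp (-(B : ℝ) * t) *
        (C₁ * (1 + q (l + P + B + 2 * r) (y - f x₀) + p (l + P + B + 2 * r) (x - x₀))) := by
        have := h₁ x y hx hy
        gcongr
    _ = _ := by ring

/-- The residual after one step. -/
theorem residual_step (h : NashMoser p q S P f D ψ x₀ r δ) (j : ℕ) : ∃ C : ℝ, 0 ≤ C ∧
    ∀ x y u, p r (x - x₀) < δ → p r (x + u - x₀) < δ → q j (y - f (x + u)) ≤
      C * (p (j + r) (ψ x (y - f x) - u) + (1 + p (j + r) (x - x₀)) * p r (ψ x (y - f x) - u) +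
        (1 + p (j + r) (x - x₀)) * p r u ^ 2 + p (j + r) u * p r u) := by
  obtain ⟨C₁, hC₁, h₁⟩ := h.D_le j
  obtain ⟨C₂, hC₂, h₂⟩ := h.Q_le j
  refine ⟨C₁ + C₂, by positivity, fun x y u hx hxu => ?_⟩
  -- The full Newton step cancels the linear part of the residual. What remains is `D x` of the
  -- smoothing error and the Taylor remainder.
  have e : y - f (x + u) = D x (ψ x (y - f x) - u) - (f (x + u) - f x - D x u) := by
    rw [h.D_sub x hx, h.D_ψ x hx]; abel
  rw [e]
  refine (map_sub_le_add _ _ _).trans ((add_le_add (h₁ x hx _) (h₂ x u hx hxu)).trans ?_)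
  have n1 : 0 ≤ p (j + r) (ψ x (y - f x) - u) := apply_nonneg _ _
  have n2 : 0 ≤ p (j + r) (x - x₀) := apply_nonneg _ _
  have n3 : 0 ≤ p r (ψ x (y - f x) - u) := apply_nonneg _ _
  have n4 : 0 ≤ p r u := apply_nonneg _ _
  have n5 : 0 ≤ p (j + r) u := apply_nonneg _ _
  have a1 : 0 ≤ C₂ * (p (j + r) (ψ x (y - f x) - u) +
    (1 + p (j + r) (x - x₀)) * p r (ψ x (y - f x) - u)) := by positivity
  have a2 : 0 ≤ C₁ * ((1 + p (j + r) (x - x₀)) * p r u ^ 2 + p (j + r) u * p r u) := by positivity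
  linarith

/-! #### Interpolation and local injectivity -/

/-- Split `w = S t w + (w - S t w)`: the first part is controlled by the weakest norm, the second by
a norm high enough to gain `exp(-t)`. -/
theorem interpolation (h : NashMoser p q S P f D ψ x₀ r δ) (j : ℕ) : ∃ C : ℝ, 0 ≤ C ∧
    ∀ t w, 0 ≤ t → p j w ≤
      C * (Real.exp (((P + j : ℕ) : ℝ) * t) * p 0 w + Real.exp (-t) * p (j + P + 1) w) := by
  obtain ⟨C₁, hC₁, h₁⟩ := h.smooth 0 j
  obtain ⟨C₂, hC₂, h₂⟩ := h.approx (j + P + 1) j (by omega)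
  refine ⟨2 * C₁ + C₂, by positivity, fun t w ht => ?_⟩
  have h3 := one_add_exp_le (a := (P : ℝ) + (j - (0 : ℕ))) (b := ((P + j : ℕ) : ℝ))
    (by positivity) (by push_cast; linarith) ht
  have h4 := map_add_le_add (p j) (S t w) (w - S t w)
  rw [add_sub_cancel] at h4
  have h5 := h₂ t w ht
  rw [show ((P : ℝ) - (((j + P + 1 : ℕ) : ℝ) - j)) * t = -t by push_cast; ring] at h5
  have h6 : p j (S t w) ≤ C₁ * (2 * Real.exp (((P + j : ℕ) : ℝ) * t)) * p 0 w :=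
    (h₁ t w ht).trans (by gcongr)
  have n1 : 0 ≤ C₂ * (Real.exp (((P + j : ℕ) : ℝ) * t) * p 0 w) := by
    have := apply_nonneg (p 0) w
    positivity
  have n2 : 0 ≤ 2 * C₁ * (Real.exp (-t) * p (j + P + 1) w) := by
    have := apply_nonneg (p (j + P + 1)) w
    positivity
  linarith

/-- In the same splitting take `t` with `p 0 w = exp(-4a t)`. Both parts are then of order `exp(-3a
t)`, the power `3/4` of `p 0 w`, and squaring gives `3/2`. An exponent above one is what absorption
and differentiability require. -/
theorem interpolation_sq (h : NashMoser p q S P f D ψ x₀ r δ) (m : ℕ) : ∃ (M : ℕ) (C : ℝ), 0 ≤ C ∧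
    ∀ w, p 0 w ≤ 1 → p m w ^ 2 ≤ C * (1 + p M w) ^ 2 * (p 0 w * √(p 0 w)) := by
  set a : ℕ := P + m + 1 with ha
  obtain ⟨C₁, hC₁, h₁⟩ := h.smooth 0 m
  obtain ⟨C₂, hC₂, h₂⟩ := h.approx (m + P + 3 * a) m (by omega)
  refine ⟨m + P + 3 * a, (2 * C₁ + C₂) ^ 2, by positivity, fun w hw => ?_⟩
  rcases (apply_nonneg (p 0) w).eq_or_lt with h0 | h0
  · rw [h.p_sep w h0.symm]; simp
  have ha0 : (0 : ℝ) < a := by positivity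
  obtain ⟨t, ht, hpt⟩ : ∃ t : ℝ, 0 ≤ t ∧ p 0 w = Real.exp (-(4 * a) * t) := by
    refine ⟨-Real.log (p 0 w) / (4 * a), div_nonneg (neg_nonneg.2 (Real.log_nonpos h0.le hw))
      (by positivity), ?_⟩
    rw [show -(4 * (a : ℝ)) * (-Real.log (p 0 w) / (4 * a)) = Real.log (p 0 w) by field_simp,
      Real.exp_log h0]
  have h3 := one_add_exp_le (a := (P : ℝ) + (m - (0 : ℕ))) (b := (a : ℝ)) (by positivity)
    (by rw [ha]; push_cast; linarith) ht
  have h4 := map_add_le_add (p m) (S t w) (w - S t w)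
  rw [add_sub_cancel] at h4
  have h5 := h₂ t w ht
  rw [show (P : ℝ) - (((m + P + 3 * a : ℕ) : ℝ) - m) = -(3 * a) by push_cast; ring] at h5
  have n1 : 0 ≤ p (m + P + 3 * a) w := apply_nonneg _ _
  have h6 : p m (S t w) ≤ 2 * C₁ * Real.exp (-(3 * a) * t) := by
    calc _ ≤ C₁ * (2 * Real.exp (a * t)) * p 0 w := (h₁ t w ht).trans (by gcongr)
      _ = 2 * C₁ * (Real.exp (a * t) * Real.exp (-(4 * a) * t)) := by rw [hpt]; ring
      _ = _ := by rw [← Real.exp_add]; ring_nf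
  have h7 : p m w ≤ (2 * C₁ + C₂) * (1 + p (m + P + 3 * a) w) * Real.exp (-(3 * a) * t) := by
    have a1 : 0 ≤ 2 * C₁ * p (m + P + 3 * a) w * Real.exp (-(3 * a) * t) := by positivity
    have a2 : 0 ≤ C₂ * Real.exp (-(3 * a) * t) := by positivity
    linarith
  have h8 : p 0 w * √(p 0 w) = Real.exp (-(3 * a) * t) ^ 2 := by
    have : √(p 0 w) = Real.exp (-(2 * a) * t) := by
      rw [hpt, Real.sqrt_eq_iff_mul_self_eq (Real.exp_pos _).le (Real.exp_pos _).le, ← Real.exp_add]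
      ring_nf
    rw [this, hpt, ← Real.exp_add, sq, ← Real.exp_add]
    ring_nf
  rw [h8, ← mul_pow, ← mul_pow]
  exact pow_le_pow_left₀ (apply_nonneg _ _) h7 2

/-- The inverse is Lipschitz in the weakest norm. -/
theorem stability (h : NashMoser p q S P f D ψ x₀ r δ) : ∃ (M : ℕ) (δ' C : ℝ), r ≤ M ∧ 0 < δ' ∧
    δ' ≤ δ ∧ 0 ≤ C ∧ ∀ x₁ x₂, p M (x₁ - x₀) < δ' → p M (x₂ - x₀) < δ' →
      p 0 (x₂ - x₁) ≤ C * q r (f x₂ - f x₁) := by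
  obtain ⟨C₁, hC₁, h₁⟩ := h.ψ_le 0
  obtain ⟨C₂, hC₂, h₂⟩ := h.Q_le r
  obtain ⟨M, C₃, hC₃, h₃⟩ := h.interpolation_sq (r + r)
  set K : ℝ := C₁ * 3 * (C₂ * 3 * (C₃ * 9)) with hK
  have hK0 : 0 ≤ K := by positivity
  -- The radius is such that `K √(2d) ≤ 1/2`, which lets the term `K √(p 0 w) · p 0 w` be absorbed
  -- into the left-hand side.
  set d : ℝ := min (1 / 2) (1 / (2 * (2 * K + 1)) ^ 2) with hd
  have hd0 : 0 < d := by positivity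
  have hKd : K * √(2 * d) ≤ 1 / 2 := by
    have h4 : √(2 * d) ≤ √(2 ^ 2 * (1 / (2 * (2 * K + 1)) ^ 2)) := Real.sqrt_le_sqrt (by
      have : d ≤ 1 / (2 * (2 * K + 1)) ^ 2 := min_le_right _ _
      nlinarith)
    have h5 : √(2 ^ 2 * (1 / (2 * (2 * K + 1)) ^ 2)) = 1 / (2 * K + 1) := by
      rw [show (2 : ℝ) ^ 2 * (1 / (2 * (2 * K + 1)) ^ 2) = (1 / (2 * K + 1)) ^ 2 by field_simp,
        Real.sqrt_sq (by positivity)]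
    rw [h5] at h4
    calc K * √(2 * d) ≤ K * (1 / (2 * K + 1)) := by gcongr
      _ ≤ 1 / 2 := by
        rw [mul_one_div, div_le_div_iff₀ (by positivity) (by positivity)]
        linarith
  refine ⟨M + 2 * r, min δ d, 2 * (C₁ * 3), by omega, lt_min h.δ_pos hd0, min_le_left _ _,
    by positivity, fun x₁ x₂ hx₁ hx₂ => ?_⟩
  have hr₁ : p r (x₁ - x₀) < δ := (h.p_mono (by omega) _).trans_lt (hx₁.trans_le (min_le_left _ _))
  have hr₂ : p r (x₂ - x₀) < δ := (h.p_mono (by omega) _).trans_lt (hx₂.trans_le (min_le_left _ _))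
  set w := x₂ - x₁ with hw
  have ew : x₁ + w = x₂ := by rw [hw]; abel
  have hwM : p (M + 2 * r) w ≤ 2 * d := by
    have h4 := map_sub_le_add (p (M + 2 * r)) (x₂ - x₀) (x₁ - x₀)
    rw [sub_sub_sub_cancel_right] at h4
    have := min_le_right δ d
    linarith
  have hd2 : d ≤ 1 / 2 := min_le_left _ _
  have hw0 : p 0 w ≤ 2 * d := (h.p_mono (by omega) w).trans hwM
  have hw1 : p M w ≤ 1 := (h.p_mono (by omega) w).trans (hwM.trans (by linarith))
  -- Here `w = ψ x₁ (D x₁ w)`, and `D x₁ w` is `f x₂ - f x₁` minus the Taylor remainder.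
  have h4 := h₁ x₁ hr₁ (D x₁ w)
  rw [h.ψ_D x₁ hr₁, zero_add] at h4
  have h5 : q r (D x₁ w) ≤ q r (f x₂ - f x₁) + q r (f x₂ - f x₁ - D x₁ w) := by
    have := map_sub_le_add (q r) (f x₂ - f x₁) (f x₂ - f x₁ - D x₁ w)
    rwa [sub_sub_cancel] at this
  have h6 := h₂ x₁ w hr₁ (by rwa [ew])
  rw [ew] at h6
  have h7 : p (r + r) (x₁ - x₀) ≤ 1 := (h.p_mono (by omega) _).trans
    (hx₁.le.trans ((min_le_left _ _).trans h.δ_le))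
  have h8 : p r w ≤ p (r + r) w := h.p_mono (by omega) w
  have n1 : 0 ≤ p r w := apply_nonneg _ _
  have n2 : 0 ≤ p 0 w := apply_nonneg _ _
  have n3 : 0 ≤ p M w := apply_nonneg _ _
  have n4 : 0 ≤ q r (D x₁ w) := apply_nonneg _ _
  have h9 : (1 + p (r + r) (x₁ - x₀)) * p r w ^ 2 + p (r + r) w * p r w ≤ 3 * p (r + r) w ^ 2 := by
    have a1 : p r w ^ 2 ≤ p (r + r) w ^ 2 := pow_le_pow_left₀ n1 h8 2
    have a2 : (1 + p (r + r) (x₁ - x₀)) * p r w ^ 2 ≤ 2 * p (r + r) w ^ 2 :=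
      mul_le_mul (by linarith) a1 (by positivity) (by norm_num)
    nlinarith
  have h10 : p (r + r) w ^ 2 ≤ C₃ * 9 * (p 0 w * √(p 0 w)) := by
    refine (h₃ w (hw0.trans (by linarith))).trans ?_
    gcongr
    nlinarith
  have h11 : p 0 w ≤ C₁ * 3 * q r (D x₁ w) := by
    refine h4.trans ?_
    rw [mul_assoc]
    refine mul_le_mul_of_nonneg_left ?_ hC₁
    have := hr₁.le.trans h.δ_le
    nlinarith
  have h12 : q r (f x₂ - f x₁ - D x₁ w) ≤ C₂ * 3 * (C₃ * 9 * (p 0 w * √(p 0 w))) :=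
    h6.trans (by rw [mul_assoc]; exact mul_le_mul_of_nonneg_left (h9.trans (by gcongr)) hC₂)
  have h13 : p 0 w ≤ C₁ * 3 * q r (f x₂ - f x₁) + K * √(p 0 w) * p 0 w := by
    calc _ ≤ C₁ * 3 * (q r (f x₂ - f x₁) + C₂ * 3 * (C₃ * 9 * (p 0 w * √(p 0 w)))) :=
          h11.trans (mul_le_mul_of_nonneg_left (h5.trans (by gcongr)) (by positivity))
      _ = _ := by rw [hK]; ring
  have h14 : K * √(p 0 w) ≤ 1 / 2 := le_trans (by gcongr) hKd
  have h15 := mul_le_mul_of_nonneg_right h14 n2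
  linarith

/-- The quadratic error at the centre, in terms of the weakest norm. -/
theorem quadratic_le (h : NashMoser p q S P f D ψ x₀ r δ) (j : ℕ) : ∃ (M : ℕ) (C : ℝ), 0 ≤ C ∧
    ∀ w, p r w < δ → q j (f (x₀ + w) - f x₀ - D x₀ w) ≤
      C * (1 + p M w) ^ 2 * (p 0 w * √(p 0 w)) := by
  obtain ⟨C₂, hC₂, h₂⟩ := h.Q_le j
  obtain ⟨M, C₃, hC₃, h₃⟩ := h.interpolation_sq (j + r)
  refine ⟨M, C₂ * (2 * C₃), by positivity, fun w hw => ?_⟩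
  have h4 := h₂ x₀ w h.mem_ball_self (by rwa [add_sub_cancel_left])
  rw [sub_self, map_zero, add_zero, one_mul] at h4
  have h5 := h₃ w ((h.p_mono (by omega) w).trans (hw.le.trans h.δ_le))
  have h8 : p r w ≤ p (j + r) w := h.p_mono (by omega) w
  have n1 : 0 ≤ p r w := apply_nonneg _ _
  have h9 : p r w ^ 2 + p (j + r) w * p r w ≤ 2 * p (j + r) w ^ 2 := by nlinarith
  calc _ ≤ C₂ * (2 * (C₃ * (1 + p M w) ^ 2 * (p 0 w * √(p 0 w)))) :=
        h4.trans (mul_le_mul_of_nonneg_left (h9.trans (by linarith)) hC₂)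
    _ = _ := by ring

end NashMoser

namespace NashMoser

/-! #### The iteration -/

/-- The smoothing parameters of the iteration. -/
noncomputable def time (t₀ : ℝ) (n : ℕ) : ℝ := t₀ * (3 / 2) ^ n

theorem time_succ (t₀ : ℝ) (n : ℕ) : time t₀ (n + 1) = 3 / 2 * time t₀ n := by
  rw [time, time, pow_succ]; ring

theorem add_le_time {t₀ : ℝ} (h : 2 ≤ t₀) (n : ℕ) : t₀ + n ≤ time t₀ n := by
  have h1 := one_add_mul_le_pow (a := (1 / 2 : ℝ)) (by norm_num) n
  have h2 : (1 + 1 / 2 : ℝ) = 3 / 2 := by norm_num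
  rw [h2] at h1
  have h3 : (0 : ℝ) ≤ n := n.cast_nonneg
  rw [time]
  nlinarith

theorem time_nonneg {t₀ : ℝ} (h : 2 ≤ t₀) (n : ℕ) : 0 ≤ time t₀ n := by
  rw [time]; positivity

theorem exp_neg_time_le {t₀ : ℝ} (h : 2 ≤ t₀) (n : ℕ) :
    Real.exp (-time t₀ n) ≤ Real.exp (-t₀) * (1 / 2) ^ n := by
  have h1 : Real.exp (-1) ≤ 1 / 2 := by
    have := Real.add_one_le_exp (1 : ℝ)
    rw [Real.exp_neg, ← one_div]
    exact one_div_le_one_div_of_le (by norm_num) (by linarith)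
  calc Real.exp (-time t₀ n) ≤ Real.exp (-t₀ + n * (-1)) :=
        Real.exp_le_exp.2 (by have := add_le_time h n; linarith)
    _ = Real.exp (-t₀) * Real.exp (-1) ^ n := by rw [Real.exp_add, Real.exp_nat_mul]
    _ ≤ _ := by gcongr

/-- The smoothing parameters grow geometrically while the constants of `n` steps accumulate only to
`C ^ n`, so one factor `exp(time t₀ n)` absorbs them. Concretely `(6/5)² ≤ 3/2` gives quadratic
growth of `(3/2)^n`, which dominates `n C` up to `7 C²`. -/
theorem exists_pow_le_exp_time {C : ℝ} (hC : 0 ≤ C) : ∃ K : ℝ, 1 ≤ K ∧ ∀ t₀, 2 ≤ t₀ → ∀ n,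
    C ^ n ≤ K * Real.exp (time t₀ n) := by
  refine ⟨Real.exp (7 * C ^ 2), Real.one_le_exp (by positivity), fun t₀ ht n => ?_⟩
  have h0 : C ≤ Real.exp C := by have := Real.add_one_le_exp C; linarith
  have h1 := one_add_mul_le_pow (a := (1 / 5 : ℝ)) (by norm_num) n
  have h2 : ((1 + 1 / 5 : ℝ) ^ n) ^ 2 ≤ (3 / 2) ^ n := by
    rw [← pow_mul, mul_comm, pow_mul]
    exact pow_le_pow_left₀ (by norm_num) (by norm_num) n
  have h3 : (0 : ℝ) ≤ n := n.cast_nonneg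
  have h4 : (1 + n * (1 / 5 : ℝ)) ^ 2 ≤ (3 / 2) ^ n :=
    (pow_le_pow_left₀ (by positivity) h1 2).trans h2
  have h5 : (2 : ℝ) * (3 / 2) ^ n ≤ time t₀ n := by rw [time]; gcongr
  calc C ^ n ≤ Real.exp C ^ n := by gcongr
    _ = Real.exp (n * C) := (Real.exp_nat_mul _ _).symm
    _ ≤ Real.exp (7 * C ^ 2 + time t₀ n) := Real.exp_le_exp.2 (by
        nlinarith [sq_nonneg ((n : ℝ) / 5 - 5 / 2 * C)])
    _ = _ := Real.exp_add _ _

theorem exp_mul_exp (a b t : ℝ) :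
    Real.exp (a * t) * Real.exp (b * t) = Real.exp ((a + b) * t) := by
  rw [← Real.exp_add, add_mul]

theorem exp_mul_le {a b t : ℝ} (ht : 0 ≤ t) (hab : a ≤ b) :
    Real.exp (a * t) ≤ Real.exp (b * t) := Real.exp_le_exp.2 (by gcongr)

variable {𝕜 : Type*} [RCLike 𝕜] {E : Type*} [AddCommGroup E] [Module 𝕜 E] {F : Type*}
  [AddCommGroup F] [Module 𝕜 F] {p : ℕ → Seminorm 𝕜 E} {q : ℕ → Seminorm 𝕜 F} {S : ℝ → E → E}
  {P : ℕ} {f : E → F} {D : E → E → F} {ψ : E → F → E} {x₀ : E} {r : ℕ} {δ : ℝ}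

/-- The low norm of the residual after one step, if the high norms do not grow too fast. -/
theorem low_step (h : NashMoser p q S P f D ψ x₀ r δ) {a : ℝ} (ha : a = (P + 2 * r : ℕ)) {B : ℕ}
    (hB : (B : ℝ) = 16 * a + 9) {κ : ℝ} (hκ : 1 ≤ κ) : ∃ C : ℝ, 0 ≤ C ∧ ∀ x y t,
    p r (x - x₀) < δ → p r (x + S t (ψ x (y - f x)) - x₀) < δ → 0 ≤ t →
    q r (y - f x) ≤ Real.exp (-(8 * a + 4) * t) →
    1 + q (r + r + P + B + 2 * r) (y - f x₀) + p (r + r + P + B + 2 * r) (x - x₀) ≤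
      κ * Real.exp ((2 * a + 1) * t) →
    q r (y - f (x + S t (ψ x (y - f x)))) ≤ C * Real.exp (-(12 * a + 7) * t) := by
  obtain ⟨C₁, hC₁, h₁⟩ := h.residual_step r
  obtain ⟨C₂, hC₂, h₂⟩ := h.step_error (r + r) B
  obtain ⟨C₃, hC₃, h₃⟩ := h.step_low (r + r)
  refine ⟨C₁ * (2 * κ * (C₂ * κ) + 2 * κ * C₃ ^ 2), by positivity,
    fun x y t hx hxu ht hz hN => ?_⟩
  have ha0 : 0 ≤ a := by rw [ha]; positivity
  have hz1 : q r (y - f x) ≤ 1 := hz.trans (Real.exp_le_one_iff.2 (by nlinarith))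
  set u := S t (ψ x (y - f x)) with hu
  set w := ψ x (y - f x) with hw
  set θ := Real.exp ((2 * a + 1) * t) with hθ
  have hθ1 : 1 ≤ θ := Real.one_le_exp (by positivity)
  have hX : p (r + r) (w - u) ≤ C₂ * κ * (Real.exp (-(B : ℝ) * t) * θ) := by
    refine (h₂ x y t hx hz1 ht).trans ?_
    calc _ ≤ C₂ * Real.exp (-(B : ℝ) * t) * (κ * θ) := by gcongr
      _ = _ := by ring
  have hY : p (r + r) u ≤ C₃ * (Real.exp (a * t) * Real.exp (-(8 * a + 4) * t)) := by
    refine (h₃ x y t hx ht).trans ?_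
    rw [show P + (r + r) = P + 2 * r by omega, ← ha, mul_assoc]
    gcongr
  have hX' : p r (w - u) ≤ p (r + r) (w - u) := h.p_mono (by omega) _
  have hY' : p r u ≤ p (r + r) u := h.p_mono (by omega) _
  have he : 1 + p (r + r) (x - x₀) ≤ κ * θ := by
    have e1 : p (r + r) (x - x₀) ≤ p (r + r + P + B + 2 * r) (x - x₀) := h.p_mono (by omega) _
    have e2 : 0 ≤ q (r + r + P + B + 2 * r) (y - f x₀) := apply_nonneg _ _
    linarith
  have hκθ : 1 ≤ κ * θ := one_le_mul_of_one_le_of_one_le hκ hθ1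
  have n1 : 0 ≤ p r (w - u) := apply_nonneg _ _
  have n2 : 0 ≤ p r u := apply_nonneg _ _
  have n3 : 0 ≤ p (r + r) u := apply_nonneg _ _
  have n4 : 0 ≤ p (r + r) (w - u) := apply_nonneg _ _
  have key : p (r + r) (w - u) + (1 + p (r + r) (x - x₀)) * p r (w - u) +
      (1 + p (r + r) (x - x₀)) * p r u ^ 2 + p (r + r) u * p r u ≤
      2 * (κ * θ) * p (r + r) (w - u) + 2 * (κ * θ) * p (r + r) u ^ 2 := by
    have b1 : (1 + p (r + r) (x - x₀)) * p r (w - u) ≤ κ * θ * p (r + r) (w - u) := by gcongr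
    have b2 : (1 + p (r + r) (x - x₀)) * p r u ^ 2 ≤ κ * θ * p (r + r) u ^ 2 := by gcongr
    have b3 : p (r + r) u * p r u ≤ p (r + r) u ^ 2 := by nlinarith
    have b4 : p (r + r) u ^ 2 ≤ κ * θ * p (r + r) u ^ 2 := le_mul_of_one_le_left (by positivity) hκθ
    have b5 : p (r + r) (w - u) ≤ κ * θ * p (r + r) (w - u) := le_mul_of_one_le_left n4 hκθ
    linarith
  -- `B = 16a + 9` makes the smoothing error, with exponent `-B + 2(2a+1)`, match the quadratic
  -- error, with exponent `(2a+1) + 2(a - (8a+4))`; both equal `-(12a+7)`.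
  have c1 : θ * (Real.exp (-(B : ℝ) * t) * θ) = Real.exp (-(12 * a + 7) * t) := by
    rw [hθ, exp_mul_exp, exp_mul_exp, hB]; ring_nf
  have c2 : θ * (Real.exp (a * t) * Real.exp (-(8 * a + 4) * t)) ^ 2 =
      Real.exp (-(12 * a + 7) * t) := by
    rw [hθ, exp_mul_exp, sq, exp_mul_exp, exp_mul_exp]; ring_nf
  refine (h₁ x y u hx hxu).trans ?_
  rw [mul_assoc]
  refine mul_le_mul_of_nonneg_left (key.trans ?_) hC₁
  calc _ ≤ 2 * (κ * θ) * (C₂ * κ * (Real.exp (-(B : ℝ) * t) * θ)) +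
        2 * (κ * θ) * (C₃ * (Real.exp (a * t) * Real.exp (-(8 * a + 4) * t))) ^ 2 := by gcongr
    _ = 2 * κ * (C₂ * κ) * (θ * (Real.exp (-(B : ℝ) * t) * θ)) + 2 * κ * C₃ ^ 2 *
        (θ * (Real.exp (a * t) * Real.exp (-(8 * a + 4) * t)) ^ 2) := by ring
    _ = _ := by rw [c1, c2]; ring

/-- The high norms of the residual after one step. -/
theorem high_step (h : NashMoser p q S P f D ψ x₀ r δ) {a : ℝ} (ha : a = (P + 2 * r : ℕ)) {B : ℕ}
    (hB : (B : ℝ) = 16 * a + 9) {κ κ' : ℝ} (hκ : 0 ≤ κ) (hκ' : 0 ≤ κ') (j : ℕ) :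
    ∃ C : ℝ, 0 ≤ C ∧ ∀ x y t H,
    p r (x - x₀) < δ → p r (x + S t (ψ x (y - f x)) - x₀) < δ → 0 ≤ t → 0 ≤ H →
    q r (y - f x) ≤ Real.exp (-(8 * a + 4) * t) →
    1 + q (r + P + B + 2 * r) (y - f x₀) + p (r + P + B + 2 * r) (x - x₀) ≤
      κ * Real.exp ((2 * a + 1) * t) →
    1 + q (j + r + P + B + 2 * r) (y - f x₀) + p (j + r + P + B + 2 * r) (x - x₀) ≤
      κ' * Real.exp ((2 * a + 1) * t) * H →
    q j (y - f (x + S t (ψ x (y - f x)))) ≤ C * Real.exp (-(4 * a + 3) * t) * H := by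
  obtain ⟨C₁, hC₁, h₁⟩ := h.residual_step j
  obtain ⟨C₂, hC₂, h₂⟩ := h.step_error r B
  obtain ⟨C₃, hC₃, h₃⟩ := h.step_error (j + r) B
  obtain ⟨C₄, hC₄, h₄⟩ := h.step_low r
  obtain ⟨C₅, hC₅, h₅⟩ := h.step_growth j
  refine ⟨C₁ * (C₃ * κ' + κ' * (C₂ * κ) + κ' * C₄ ^ 2 + C₅ * κ' * C₄), by positivity,
    fun x y t H hx hxu ht hH hz hN hN' => ?_⟩
  have ha0 : 0 ≤ a := by rw [ha]; positivity
  have hz1 : q r (y - f x) ≤ 1 := hz.trans (Real.exp_le_one_iff.2 (by nlinarith))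
  set u := S t (ψ x (y - f x)) with hu
  set w := ψ x (y - f x) with hw
  set θ := Real.exp ((2 * a + 1) * t) with hθ
  have hX : p (j + r) (w - u) ≤ C₃ * Real.exp (-(B : ℝ) * t) * (κ' * θ * H) :=
    (h₃ x y t hx hz1 ht).trans (by gcongr)
  have hX' : p r (w - u) ≤ C₂ * Real.exp (-(B : ℝ) * t) * (κ * θ) :=
    (h₂ x y t hx hz1 ht).trans (by gcongr)
  have hY : p r u ≤ C₄ * Real.exp (a * t) * Real.exp (-(8 * a + 4) * t) := by
    refine (h₄ x y t hx ht).trans ?_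
    have : ((P + r : ℕ) : ℝ) ≤ a := by rw [ha]; exact_mod_cast (by omega)
    gcongr
  have hu' : 0 ≤ q (j + r + P + B + 2 * r) (y - f x₀) := apply_nonneg _ _
  have he : 1 + p (j + r) (x - x₀) ≤ κ' * θ * H := by
    have e1 : p (j + r) (x - x₀) ≤ p (j + r + P + B + 2 * r) (x - x₀) := h.p_mono (by omega) _
    linarith
  have hY' : p (j + r) u ≤ C₅ * Real.exp (a * t) * (κ' * θ * H) := by
    refine (h.p_mono (show j + r ≤ j + 2 * r by omega) _).trans ((h₅ x y t hx hz1 ht).trans ?_)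
    rw [← ha]
    have e1 : p (j + 2 * r) (x - x₀) ≤ p (j + r + P + B + 2 * r) (x - x₀) := h.p_mono (by omega) _
    have e2 : q (j + 2 * r) (y - f x₀) ≤ q (j + r + P + B + 2 * r) (y - f x₀) :=
      h.q_mono (by omega) _
    gcongr
    linarith
  have n1 : 0 ≤ p r (w - u) := apply_nonneg _ _
  have n2 : 0 ≤ p r u := apply_nonneg _ _
  have n3 : 0 ≤ p (j + r) u := apply_nonneg _ _
  have n5 : 0 ≤ 1 + p (j + r) (x - x₀) := by
    have := apply_nonneg (p (j + r)) (x - x₀)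
    linarith
  set ρ := Real.exp (-(4 * a + 3) * t) with hρ
  have c1 : Real.exp (-(B : ℝ) * t) * θ ≤ ρ := by
    rw [hθ, exp_mul_exp, hB]; exact exp_mul_le ht (by linarith)
  have c2 : θ * Real.exp (-(B : ℝ) * t) * θ ≤ ρ := by
    rw [hθ, exp_mul_exp, exp_mul_exp, hB]; exact exp_mul_le ht (by linarith)
  have c3 : θ * (Real.exp (a * t) * Real.exp (-(8 * a + 4) * t)) ^ 2 ≤ ρ := by
    rw [hθ, exp_mul_exp, sq, exp_mul_exp, exp_mul_exp]; exact exp_mul_le ht (by linarith)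
  -- This is the slowest term, the product of a high and a low norm of the step: `a + (2a+1) + a -
  -- (8a+4) = -(4a+3)`.
  have c4 : Real.exp (a * t) * θ * (Real.exp (a * t) * Real.exp (-(8 * a + 4) * t)) ≤ ρ := by
    rw [hθ, exp_mul_exp, exp_mul_exp, exp_mul_exp]; exact exp_mul_le ht (by linarith)
  refine (h₁ x y u hx hxu).trans ?_
  rw [mul_assoc, mul_assoc]
  refine mul_le_mul_of_nonneg_left ?_ hC₁
  have hθ0 : 0 ≤ θ := (Real.exp_pos _).le
  calc _ ≤ C₃ * Real.exp (-(B : ℝ) * t) * (κ' * θ * H) +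
        κ' * θ * H * (C₂ * Real.exp (-(B : ℝ) * t) * (κ * θ)) +
        κ' * θ * H * (C₄ * Real.exp (a * t) * Real.exp (-(8 * a + 4) * t)) ^ 2 +
        C₅ * Real.exp (a * t) * (κ' * θ * H) *
          (C₄ * Real.exp (a * t) * Real.exp (-(8 * a + 4) * t)) := by gcongr
    _ = C₃ * κ' * (Real.exp (-(B : ℝ) * t) * θ) * H +
        κ' * (C₂ * κ) * (θ * Real.exp (-(B : ℝ) * t) * θ) * H +
        κ' * C₄ ^ 2 * (θ * (Real.exp (a * t) * Real.exp (-(8 * a + 4) * t)) ^ 2) * H +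
        C₅ * κ' * C₄ *
          (Real.exp (a * t) * θ * (Real.exp (a * t) * Real.exp (-(8 * a + 4) * t))) * H := by ring
    _ ≤ C₃ * κ' * ρ * H + κ' * (C₂ * κ) * ρ * H + κ' * C₄ ^ 2 * ρ * H +
        C₅ * κ' * C₄ * ρ * H := by gcongr
    _ = _ := by ring

/-- The Newton iteration with smoothing. -/
noncomputable def iter (S : ℝ → E → E) (f : E → F) (ψ : E → F → E) (x₀ : E) (t₀ : ℝ) (y : F) :
    ℕ → E
  | 0 => x₀
  | n + 1 => iter S f ψ x₀ t₀ y n +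
      S (time t₀ n) (ψ (iter S f ψ x₀ t₀ y n) (y - f (iter S f ψ x₀ t₀ y n)))

/-- The invariants of the iteration. -/
theorem iter_bounds (h : NashMoser p q S P f D ψ x₀ r δ) {a : ℝ} (ha : a = (P + 2 * r : ℕ)) {B : ℕ}
    (hB : (B : ℝ) = 16 * a + 9) : ∃ (t₀ ε : ℝ) (K : ℕ → ℝ), 2 ≤ t₀ ∧ 0 < ε ∧ ε ≤ 1 ∧
    (∀ j, 1 ≤ K j) ∧ ∀ y, q (r + r + P + B + 2 * r) (y - f x₀) < ε → ∀ n,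
      p r (iter S f ψ x₀ t₀ y n - x₀) ≤ δ / 2 * (1 - (1 / 2) ^ n) ∧
      q r (y - f (iter S f ψ x₀ t₀ y n)) ≤ Real.exp (-(8 * a + 4) * time t₀ n) ∧
      ∀ j, 1 + q (j + 2 * r) (y - f x₀) + p (j + 2 * r) (iter S f ψ x₀ t₀ y n - x₀) ≤
        K j * Real.exp ((2 * a + 1) * time t₀ n) * (1 + q (j + 2 * r) (y - f x₀)) := by
  have ha0 : 0 ≤ a := by rw [ha]; positivity
  choose G hG hstep using h.step_growth
  choose K hK hpow using fun j => exists_pow_le_exp_time (C := 1 + G j) (by linarith [hG j])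
  obtain ⟨C₁, hC₁, h₁⟩ := h.low_step ha hB (κ := 2 * K (r + r + P + B))
    (by linarith [hK (r + r + P + B)])
  obtain ⟨C₂, hC₂, h₂⟩ := h.step_low r
  -- `t₀` is taken large for two reasons: to absorb the constant of the low estimate, and to make
  -- the steps at most `δ/4 · 2^{-n}`, so that the iterates stay within `δ/2` of the centre.
  obtain ⟨t₀, ht2, ht1, htδ⟩ : ∃ t₀ : ℝ, 2 ≤ t₀ ∧ C₁ ≤ Real.exp t₀ ∧
      C₂ * Real.exp (-t₀) ≤ δ / 4 := by
    have hδ := h.δ_pos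
    have e1 : Tendsto (fun t : ℝ => C₂ * Real.exp (-t)) atTop (𝓝 (C₂ * 0)) :=
      (Real.tendsto_exp_neg_atTop_nhds_zero).const_mul C₂
    rw [mul_zero] at e1
    obtain ⟨t, ht⟩ := ((eventually_ge_atTop (2 : ℝ)).and
      ((Real.tendsto_exp_atTop.eventually_ge_atTop C₁).and
        (e1.eventually_le_const (by positivity : 0 < δ / 4)))).exists
    exact ⟨t, ht⟩
  have htn : ∀ n, 0 ≤ time t₀ n := time_nonneg ht2
  refine ⟨t₀, min 1 (Real.exp (-(8 * a + 4) * t₀)), K, ht2, by positivity, min_le_left _ _, hK,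
    fun y hy => ?_⟩
  set x := iter S f ψ x₀ t₀ y with hx
  have hx0 : x 0 = x₀ := rfl
  have hxs : ∀ n, x (n + 1) = x n + S (time t₀ n) (ψ (x n) (y - f (x n))) := fun _ => rfl
  -- The growth bound is proved in a form that reproduces itself exactly. The factor `(1 + G j) ^ n`
  -- is converted into an exponential only when the bound is used.
  have hkey : ∀ n, p r (x n - x₀) ≤ δ / 2 * (1 - (1 / 2) ^ n) ∧
      q r (y - f (x n)) ≤ Real.exp (-(8 * a + 4) * time t₀ n) ∧
      ∀ j, 1 + q (j + 2 * r) (y - f x₀) + p (j + 2 * r) (x n - x₀) ≤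
        (1 + G j) ^ n * Real.exp (2 * a * (time t₀ n - t₀)) * (1 + q (j + 2 * r) (y - f x₀)) := by
    intro n
    induction n with
    | zero =>
      refine ⟨by simp [hx0], ?_, fun j => by simp [hx0, time]⟩
      rw [hx0, time, pow_zero, mul_one]
      exact (h.q_mono (by omega) _).trans (hy.le.trans (min_le_right _ _))
    | succ n ih =>
      obtain ⟨i1, i2, i3⟩ := ih
      have hδ := h.δ_pos
      have hball : ∀ m : ℕ, δ / 2 * (1 - (1 / 2) ^ m) < δ := fun m => by
        have : (0 : ℝ) < (1 / 2) ^ m := by positivity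
        nlinarith
      have hxn : p r (x n - x₀) < δ := i1.trans_lt (hball n)
      have hz1 : q r (y - f (x n)) ≤ 1 := i2.trans (Real.exp_le_one_iff.2 (by
        have := htn n
        nlinarith))
      have hu : p r (S (time t₀ n) (ψ (x n) (y - f (x n)))) ≤ δ / 4 * (1 / 2) ^ n := by
        have e1 : ((P + r : ℕ) : ℝ) ≤ a := by rw [ha]; exact_mod_cast (by omega)
        calc _ ≤ C₂ * Real.exp (((P + r : ℕ) : ℝ) * time t₀ n) *
              Real.exp (-(8 * a + 4) * time t₀ n) := (h₂ _ y _ hxn (htn n)).trans (by gcongr)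
          _ ≤ C₂ * Real.exp (-1 * time t₀ n) := by
            rw [mul_assoc, exp_mul_exp]
            exact mul_le_mul_of_nonneg_left (exp_mul_le (htn n) (by linarith)) hC₂
          _ ≤ C₂ * (Real.exp (-t₀) * (1 / 2) ^ n) := by
            rw [neg_one_mul]
            exact mul_le_mul_of_nonneg_left (exp_neg_time_le ht2 n) hC₂
          _ = C₂ * Real.exp (-t₀) * (1 / 2) ^ n := by ring
          _ ≤ _ := by gcongr
      have j1 : p r (x (n + 1) - x₀) ≤ δ / 2 * (1 - (1 / 2) ^ (n + 1)) := by
        rw [hxs, add_sub_right_comm]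
        refine (map_add_le_add _ _ _).trans ((add_le_add i1 hu).trans ?_)
        rw [pow_succ]
        linarith
      have hsum : 1 + q (r + r + P + B + 2 * r) (y - f x₀) +
          p (r + r + P + B + 2 * r) (x n - x₀) ≤
            2 * K (r + r + P + B) * Real.exp ((2 * a + 1) * time t₀ n) := by
        have e1 : 1 + q (r + r + P + B + 2 * r) (y - f x₀) ≤ 2 := by
          have := hy.trans_le (min_le_left _ _)
          linarith
        have e2 : Real.exp (2 * a * (time t₀ n - t₀)) ≤ Real.exp (2 * a * time t₀ n) :=
          Real.exp_le_exp.2 (by nlinarith)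
        have e3 := hpow (r + r + P + B) t₀ ht2 n
        have e4 : 0 ≤ 1 + q (r + r + P + B + 2 * r) (y - f x₀) := by
          have := apply_nonneg (q (r + r + P + B + 2 * r)) (y - f x₀)
          linarith
        have e5 := hK (r + r + P + B)
        calc _ ≤ K (r + r + P + B) * Real.exp (time t₀ n) * Real.exp (2 * a * time t₀ n) * 2 :=
              (i3 _).trans (by gcongr)
          _ = 2 * K (r + r + P + B) *
              (Real.exp (2 * a * time t₀ n) * Real.exp (1 * time t₀ n)) := by rw [one_mul]; ring
          _ = _ := by rw [exp_mul_exp]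
      have hxn' : p r (x (n + 1) - x₀) < δ := j1.trans_lt (hball _)
      refine ⟨j1, ?_, fun j => ?_⟩
      · calc q r (y - f (x (n + 1))) ≤ C₁ * Real.exp (-(12 * a + 7) * time t₀ n) :=
              h₁ (x n) y (time t₀ n) hxn hxn' (htn n) i2 hsum
          -- At the next parameter, `(8a+4) · 3/2 = 12a + 6`. The surplus rate `1` pays for the
          -- constant `C₁`.
          _ ≤ Real.exp (1 * time t₀ n) * Real.exp (-(12 * a + 7) * time t₀ n) := by
            gcongr
            rw [one_mul]
            refine ht1.trans (Real.exp_le_exp.2 ?_)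
            have := add_le_time ht2 n
            have : (0 : ℝ) ≤ n := n.cast_nonneg
            linarith
          _ = _ := by rw [exp_mul_exp, time_succ]; ring_nf
      · have e1 := hstep j (x n) y (time t₀ n) hxn hz1 (htn n)
        rw [← ha] at e1
        have e2 := map_add_le_add (p (j + 2 * r)) (x n - x₀)
          (S (time t₀ n) (ψ (x n) (y - f (x n))))
        have e3 : x (n + 1) - x₀ = x n - x₀ + S (time t₀ n) (ψ (x n) (y - f (x n))) := by
          rw [hxs, add_sub_right_comm]
        rw [e3]
        set N := 1 + q (j + 2 * r) (y - f x₀) + p (j + 2 * r) (x n - x₀) with hN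
        have hN0 : 0 ≤ N := by
          have n1 := apply_nonneg (q (j + 2 * r)) (y - f x₀)
          have n2 := apply_nonneg (p (j + 2 * r)) (x n - x₀)
          linarith
        have e4 : 1 ≤ Real.exp (a * time t₀ n) :=
          Real.one_le_exp (mul_nonneg ha0 (htn n))
        have e5 : N ≤ Real.exp (a * time t₀ n) * N := le_mul_of_one_le_left hN0 e4
        have e6 := hG j
        calc _ ≤ N + G j * Real.exp (a * time t₀ n) * N := by linarith
          _ ≤ (1 + G j) * Real.exp (a * time t₀ n) * N := by linarith
          _ ≤ (1 + G j) * Real.exp (a * time t₀ n) * ((1 + G j) ^ n *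
              Real.exp (2 * a * (time t₀ n - t₀)) * (1 + q (j + 2 * r) (y - f x₀))) := by
            have := i3 j
            gcongr
          _ = (1 + G j) ^ (n + 1) * (Real.exp (a * time t₀ n) *
              Real.exp (2 * a * (time t₀ n - t₀))) * (1 + q (j + 2 * r) (y - f x₀)) := by ring
          -- Since `t_{n+1} - t_n = t_n / 2`, one has `a t_n + 2a (t_n - t₀) = 2a (t_{n+1} - t₀)`.
          _ = _ := by rw [← Real.exp_add, time_succ]; ring_nf
  intro n
  obtain ⟨i1, i2, i3⟩ := hkey n
  refine ⟨i1, i2, fun j => (i3 j).trans ?_⟩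
  have e2 : Real.exp (2 * a * (time t₀ n - t₀)) ≤ Real.exp (2 * a * time t₀ n) :=
    Real.exp_le_exp.2 (by nlinarith)
  have e3 := hpow j t₀ ht2 n
  have e4 : 0 ≤ 1 + q (j + 2 * r) (y - f x₀) := by
    have := apply_nonneg (q (j + 2 * r)) (y - f x₀)
    linarith
  have e5 := hK j
  calc _ ≤ K j * Real.exp (time t₀ n) * Real.exp (2 * a * time t₀ n) *
        (1 + q (j + 2 * r) (y - f x₀)) := by gcongr
    _ = K j * (Real.exp (2 * a * time t₀ n) * Real.exp (1 * time t₀ n)) *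
        (1 + q (j + 2 * r) (y - f x₀)) := by rw [one_mul]; ring
    _ = _ := by rw [exp_mul_exp]

end NashMoser

/-! ### Convergence of the iteration and solvability. -/

namespace NashMoser

variable {𝕜 : Type*} [RCLike 𝕜] {E : Type*} [AddCommGroup E] [Module 𝕜 E] {F : Type*}
  [AddCommGroup F] [Module 𝕜 F] {p : ℕ → Seminorm 𝕜 E} {q : ℕ → Seminorm 𝕜 F} {S : ℝ → E → E}
  {P : ℕ} {f : E → F} {D : E → E → F} {ψ : E → F → E} {x₀ : E} {r : ℕ} {δ : ℝ}

/-- The steps of the iteration decay geometrically in all norms, with tame bounds. -/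
theorem iter_steps (h : NashMoser p q S P f D ψ x₀ r δ) : ∃ (b : ℕ) (t₀ ε : ℝ) (M : ℕ → ℝ),
    r ≤ b ∧ 0 < ε ∧ (∀ j, 0 ≤ M j) ∧ ∀ y, q b (y - f x₀) < ε → ∀ n,
      p r (iter S f ψ x₀ t₀ y n - x₀) ≤ δ / 2 ∧
      q r (y - f (iter S f ψ x₀ t₀ y n)) ≤ (1 / 2) ^ n ∧
      ∀ j, p j (iter S f ψ x₀ t₀ y (n + 1) - iter S f ψ x₀ t₀ y n) ≤
        M j * (1 + q (j + b) (y - f x₀)) * (1 / 2) ^ n := by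
  obtain ⟨a, ha⟩ : ∃ a : ℝ, a = (P + 2 * r : ℕ) := ⟨_, rfl⟩
  obtain ⟨B, hB'⟩ : ∃ B : ℕ, B = 16 * (P + 2 * r) + 9 := ⟨_, rfl⟩
  have hB : (B : ℝ) = 16 * a + 9 := by rw [hB', ha]; push_cast; ring
  have ha0 : 0 ≤ a := by rw [ha]; positivity
  have hPa : (P : ℝ) ≤ a := by rw [ha]; exact_mod_cast (by omega)
  obtain ⟨t₀, ε, K, ht2, hε, hε1, hK, hb⟩ := h.iter_bounds ha hB
  have htn : ∀ n, 0 ≤ time t₀ n := time_nonneg ht2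
  choose C₁ hC₁ h₁ using h.step_growth
  choose C₂ hC₂ h₂ using h.step_high
  choose C₃ hC₃ h₃ using fun j => h.high_step ha hB (κ := 2 * K (r + P + B))
    (κ' := K (j + r + r + P + B)) (by linarith [hK (r + P + B)])
    (by linarith [hK (j + r + r + P + B)]) (j + r)
  have hexp : ∀ n, Real.exp (-1 * time t₀ n) ≤ (1 / 2) ^ n := fun n => by
    rw [neg_one_mul]
    refine (exp_neg_time_le ht2 n).trans (mul_le_of_le_one_left (by positivity) ?_)
    exact Real.exp_le_one_iff.2 (by linarith)
  refine ⟨r + r + P + B + 2 * r, t₀, ε,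
    fun j => C₁ j * Real.exp (a * t₀) + 2 * (C₂ j * (C₃ j + K j)), by omega, hε, fun j => ?_,
    fun y hy n => ?_⟩
  · have := hC₁ j; have := hC₂ j; have := hC₃ j; have := hK j
    positivity
  have hδ := h.δ_pos
  have hb' := hb y hy
  set x := iter S f ψ x₀ t₀ y with hx
  have hx0 : x 0 = x₀ := rfl
  have hxs : ∀ n, x (n + 1) = x n + S (time t₀ n) (ψ (x n) (y - f (x n))) := fun _ => rfl
  have hball : ∀ n, p r (x n - x₀) ≤ δ / 2 := fun n => (hb' n).1.trans (by
    have : (0 : ℝ) < (1 / 2) ^ n := by positivity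
    nlinarith)
  have hball' : ∀ n, p r (x n - x₀) < δ := fun n => (hball n).trans_lt (by linarith)
  refine ⟨hball n, (hb' n).2.1.trans ((exp_mul_le (htn n) (by linarith)).trans (hexp n)),
    fun j => ?_⟩
  rw [hxs, add_sub_cancel_left]
  have hC₁j := hC₁ j
  have hC₂j := hC₂ j
  have hC₃j := hC₃ j
  have hKj := hK j
  set H := 1 + q (j + (r + r + P + B + 2 * r)) (y - f x₀) with hH
  have hH0 : 0 ≤ H := by
    have := apply_nonneg (q (j + (r + r + P + B + 2 * r))) (y - f x₀)
    linarith
  have hHj : 1 + q (j + 2 * r) (y - f x₀) ≤ H := by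
    have : q (j + 2 * r) (y - f x₀) ≤ q (j + (r + r + P + B + 2 * r)) (y - f x₀) :=
      h.q_mono (by omega) _
    linarith
  -- Step `n + 1` uses the decay of the residual produced by step `n`. The first step has no
  -- predecessor and is estimated directly at `t₀`.
  cases n with
  | zero =>
    have e1 := h₁ j x₀ y (time t₀ 0) h.mem_ball_self
      ((h.q_mono (by omega) _).trans (hy.le.trans hε1)) (htn 0)
    rw [sub_self, map_zero, add_zero, ← ha] at e1
    have e2 : time t₀ 0 = t₀ := by simp [time]
    rw [e2] at e1
    rw [pow_zero, mul_one, hx0, e2]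
    calc _ ≤ C₁ j * Real.exp (a * t₀) * (1 + q (j + 2 * r) (y - f x₀)) :=
          (h.p_mono (by omega) _).trans e1
      _ ≤ C₁ j * Real.exp (a * t₀) * H := by gcongr
      _ ≤ _ := by
        gcongr
        exact le_add_of_nonneg_right (by positivity)
  | succ n =>
    have d1 := h₂ j (x (n + 1)) y (time t₀ (n + 1)) (hball' _) (htn _)
    have d2 : q (j + r) (y - f (x (n + 1))) ≤
        C₃ j * Real.exp (-(4 * a + 3) * time t₀ n) * H := by
      have i1 := (hb' n).2.2 (r + P + B)
      have i2 := (hb' n).2.2 (j + r + r + P + B)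
      have i3 : q (r + P + B + 2 * r) (y - f x₀) ≤ 1 :=
        (h.q_mono (by omega) _).trans (hy.le.trans hε1)
      refine h₃ j (x n) y (time t₀ n) H (hball' n) (hball' (n + 1)) (htn n) hH0 (hb' n).2.1
        (i1.trans ?_) (i2.trans_eq ?_)
      · calc _ ≤ K (r + P + B) * Real.exp ((2 * a + 1) * time t₀ n) * 2 := by
              have := hK (r + P + B)
              gcongr
              linarith
          _ = _ := by ring
      · rw [hH, show j + r + r + P + B + 2 * r = j + (r + r + P + B + 2 * r) by omega]
    have d3 : 1 + p (j + r) (x (n + 1) - x₀) ≤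
        K j * Real.exp ((2 * a + 1) * time t₀ (n + 1)) * H := by
      have i1 := (hb' (n + 1)).2.2 j
      have i2 : p (j + r) (x (n + 1) - x₀) ≤ p (j + 2 * r) (x (n + 1) - x₀) :=
        h.p_mono (by omega) _
      have i3 : 0 ≤ q (j + 2 * r) (y - f x₀) := apply_nonneg _ _
      calc _ ≤ K j * Real.exp ((2 * a + 1) * time t₀ (n + 1)) * (1 + q (j + 2 * r) (y - f x₀)) := by
            linarith
        _ ≤ _ := by gcongr
    have d4 := (hb' (n + 1)).2.1
    set t := time t₀ n with ht
    have ht0 : 0 ≤ t := htn n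
    have ets : time t₀ (n + 1) = 3 / 2 * t := time_succ t₀ n
    rw [ets] at d1 d3 d4 ⊢
    -- The residual decays at parameter `t`, while the next smoothing costs `P` at parameter `3t/2`.
    -- Because `P ≤ a`, the rate `4a + 3` outweighs this cost.
    have c1 : Real.exp ((P : ℝ) * (3 / 2 * t)) * Real.exp (-(4 * a + 3) * t) ≤
        Real.exp (-1 * t) := by
      rw [← mul_assoc, exp_mul_exp]
      exact exp_mul_le ht0 (by linarith)
    have c2 : Real.exp ((P : ℝ) * (3 / 2 * t)) * (Real.exp ((2 * a + 1) * (3 / 2 * t)) *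
        Real.exp (-(8 * a + 4) * (3 / 2 * t))) ≤ Real.exp (-1 * t) := by
      rw [exp_mul_exp, exp_mul_exp, ← mul_assoc]
      exact exp_mul_le ht0 (by linarith)
    have n1 : 0 ≤ 1 + p (j + r) (x (n + 1) - x₀) := by
      have := apply_nonneg (p (j + r)) (x (n + 1) - x₀)
      linarith
    calc _ ≤ C₂ j * Real.exp ((P : ℝ) * (3 / 2 * t)) *
          (C₃ j * Real.exp (-(4 * a + 3) * t) * H + K j * Real.exp ((2 * a + 1) * (3 / 2 * t)) * H *
            Real.exp (-(8 * a + 4) * (3 / 2 * t))) := d1.trans (by gcongr)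
      _ = C₂ j * (C₃ j * (Real.exp ((P : ℝ) * (3 / 2 * t)) * Real.exp (-(4 * a + 3) * t)) +
          K j * (Real.exp ((P : ℝ) * (3 / 2 * t)) * (Real.exp ((2 * a + 1) * (3 / 2 * t)) *
            Real.exp (-(8 * a + 4) * (3 / 2 * t))))) * H := by ring
      _ ≤ C₂ j * (C₃ j * Real.exp (-1 * t) + K j * Real.exp (-1 * t)) * H := by gcongr
      _ ≤ C₂ j * (C₃ j * (1 / 2) ^ n + K j * (1 / 2) ^ n) * H := by
        have := hexp n
        gcongr
      _ = 2 * (C₂ j * (C₃ j + K j)) * H * (1 / 2) ^ (n + 1) := by rw [pow_succ]; ring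
      _ ≤ _ := by
        gcongr
        exact le_add_of_nonneg_left (by positivity)

/-- Solvability of `f x = y` near `x₀`, with tame estimates. -/
theorem exists_solution (h : NashMoser p q S P f D ψ x₀ r δ)
    (hcomp : ∀ a : ℕ → E, (∀ j, Summable fun n => p j (a (n + 1) - a n)) →
      ∃ x, ∀ j, Tendsto (fun n => p j (a n - x)) atTop (𝓝 0)) :
    ∃ (b : ℕ) (ε : ℝ) (K : ℕ → ℝ), r ≤ b ∧ 0 < ε ∧ (∀ j, 0 ≤ K j) ∧
      ∀ y, q b (y - f x₀) < ε → ∃ x, p r (x - x₀) < δ ∧ f x = y ∧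
        ∀ j, p j (x - x₀) ≤ K j * (1 + q (j + b) (y - f x₀)) := by
  obtain ⟨b, t₀, ε, M, hrb, hε, hM, H⟩ := h.iter_steps
  refine ⟨b, ε, fun j => 2 * M j, hrb, hε, fun j => by have := hM j; positivity, fun y hy => ?_⟩
  have H' := H y hy
  set a := iter S f ψ x₀ t₀ y with ha
  have ha0 : a 0 = x₀ := rfl
  have hδ := h.δ_pos
  have hN : ∀ j, 0 ≤ M j * (1 + q (j + b) (y - f x₀)) := fun j => by
    have := hM j
    have := apply_nonneg (q (j + b)) (y - f x₀)
    positivity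
  obtain ⟨x, hx⟩ := hcomp a fun j => Summable.of_nonneg_of_le (fun n => apply_nonneg _ _)
    (fun n => (H' n).2.2 j) ((summable_geometric_two).mul_left _)
  have hlim : ∀ j, ∀ c : ℝ, (∀ n, p j (a n - x₀) ≤ c) → p j (x - x₀) ≤ c := by
    intro j c hc
    have h1 : Tendsto (fun n => c + p j (a n - x)) atTop (𝓝 (c + 0)) := (hx j).const_add c
    rw [add_zero] at h1
    refine ge_of_tendsto' h1 fun n => ?_
    have h2 := map_sub_le_add (p j) (a n - x₀) (a n - x)
    rw [sub_sub_sub_cancel_left] at h2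
    have := hc n
    linarith
  have hxr : p r (x - x₀) ≤ δ / 2 := hlim r _ fun n => (H' n).1
  have hxr' : p r (x - x₀) < δ := hxr.trans_lt (by linarith)
  refine ⟨x, hxr', ?_, fun j => hlim j _ fun n => ?_⟩
  · obtain ⟨C₁, hC₁, h₁⟩ := h.Q_le 0
    obtain ⟨C₂, hC₂, h₂⟩ := h.D_le 0
    -- Continuity of `f` is not part of the data; convergence of `f (a n)` to `f x` is read off from
    -- the Taylor estimate at the limit `x`.
    have hbound : ∀ n, q 0 (y - f x) ≤ (1 / 2) ^ n + (C₁ * ((1 + p r (x - x₀)) * p r (a n - x) ^ 2 +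
        p r (a n - x) * p r (a n - x)) +
        C₂ * (p r (a n - x) + (1 + p r (x - x₀)) * p r (a n - x))) := by
      intro n
      have e1 : x + (a n - x) = a n := by abel
      have e2 := h₁ x (a n - x) hxr' (by rw [e1]; exact (H' n).1.trans_lt (by linarith))
      have e3 := h₂ x hxr' (a n - x)
      rw [e1, zero_add] at e2
      rw [zero_add] at e3
      have e4 : q 0 (y - f (a n)) ≤ (1 / 2) ^ n := (h.q_mono (Nat.zero_le r) _).trans (H' n).2.1
      have e5 : y - f x = y - f (a n) + ((f (a n) - f x - D x (a n - x)) + D x (a n - x)) := by abel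
      rw [e5]
      exact (map_add_le_add _ _ _).trans (add_le_add e4
        ((map_add_le_add _ _ _).trans (add_le_add e2 e3)))
    have hpr := hx r
    have h0 : Tendsto (fun n => (1 / 2 : ℝ) ^ n + (C₁ * ((1 + p r (x - x₀)) * p r (a n - x) ^ 2 +
        p r (a n - x) * p r (a n - x)) +
        C₂ * (p r (a n - x) + (1 + p r (x - x₀)) * p r (a n - x)))) atTop
        (𝓝 (0 + (C₁ * ((1 + p r (x - x₀)) * 0 ^ 2 + 0 * 0) +
          C₂ * (0 + (1 + p r (x - x₀)) * 0)))) :=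
      (tendsto_pow_atTop_nhds_zero_of_lt_one (by norm_num) (by norm_num)).add
        (((((hpr.pow 2).const_mul _).add (hpr.mul hpr)).const_mul _).add
          ((hpr.add (hpr.const_mul _)).const_mul _))
    have h3 := ge_of_tendsto' h0 hbound
    have h4 : q 0 (y - f x) = 0 := le_antisymm (h3.trans (by simp)) (apply_nonneg _ _)
    exact (sub_eq_zero.1 (h.q_sep _ h4)).symm
  -- Telescoping against the geometric series gives the factor `1 - 2^{-n}`, and so a bound affine
  -- in the norm of `y - f x₀`.
  · have hind : p j (a n - x₀) ≤ 2 * (M j * (1 + q (j + b) (y - f x₀))) * (1 - (1 / 2) ^ n) := by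
      induction n with
      | zero => simp [ha0]
      | succ n ih =>
        have h1 := map_add_le_add (p j) (a (n + 1) - a n) (a n - x₀)
        rw [sub_add_sub_cancel] at h1
        have h2 := (H' n).2.2 j
        rw [pow_succ]
        linarith
    have h3 : (0 : ℝ) < (1 / 2) ^ n := by positivity
    have := hN j
    rw [mul_assoc 2]
    nlinarith

end NashMoser

/-! ### Tame estimates for linear and quadratic expressions -/

section Scaling

variable {𝕜 : Type*} [RCLike 𝕜] {E : Type*} [AddCommGroup E] [Module 𝕜 E]

/-- Scale `u` to have `p₁`-norm `δ/2`, apply the affine bound there, and undo the scaling by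
homogeneity. The constant term acquires the factor `(p₁ u)^d` and the term in `p₂ u` the factor `(p₁
u)^(d-1)`, which turns local tame bounds into multilinear ones. -/
theorem le_of_homogeneous {p₁ p₂ : Seminorm 𝕜 E} (hsep : ∀ u, p₁ u = 0 → u = 0) {Φ : E → ℝ}
    {d : ℕ} (hd : d ≠ 0) (hΦ : ∀ (l : ℝ) u, 0 ≤ l → Φ ((l : 𝕜) • u) = l ^ d * Φ u) {δ α β : ℝ}
    (hδ : 0 < δ) (hle : ∀ u, p₁ u < δ → Φ u ≤ α + β * p₂ u) (u : E) :
    Φ u ≤ (2 / δ * p₁ u) ^ d * α + (2 / δ * p₁ u) ^ (d - 1) * (β * p₂ u) := by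
  rcases (apply_nonneg p₁ u).eq_or_lt with h0 | h0
  · have hu := hsep u h0.symm
    have h1 := hΦ 0 u le_rfl
    rw [zero_pow hd, zero_mul, RCLike.ofReal_zero, zero_smul] at h1
    rw [hu, h1, map_zero, map_zero, mul_zero, zero_pow hd]
    simp
  · set l := 2 / δ * p₁ u with hl
    have hl0 : 0 < l := by positivity
    have hl' : (l : 𝕜) ≠ 0 := by exact_mod_cast hl0.ne'
    set u' := ((l⁻¹ : ℝ) : 𝕜) • u with hu'
    have e : u = (l : 𝕜) • u' := by
      rw [hu', smul_smul, RCLike.ofReal_inv, mul_inv_cancel₀ hl', one_smul]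
    have hn : ∀ p : Seminorm 𝕜 E, p u' = l⁻¹ * p u := fun p => by
      rw [hu', map_smul_eq_mul, RCLike.norm_ofReal, abs_of_pos (inv_pos.2 hl0)]
    have h1 : p₁ u' < δ := by
      rw [hn, hl, show (2 / δ * p₁ u)⁻¹ * p₁ u = δ / 2 by field_simp]
      exact half_lt_self hδ
    have h2 := hle u' h1
    rw [hn] at h2
    obtain ⟨m, rfl⟩ : ∃ m, d = m + 1 := ⟨d - 1, by omega⟩
    calc Φ u = l ^ (m + 1) * Φ u' := by conv_lhs => rw [e, hΦ l u' hl0.le]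
      _ ≤ l ^ (m + 1) * (α + β * (l⁻¹ * p₂ u)) := by gcongr
      _ = _ := by
        rw [Nat.add_sub_cancel]
        field_simp
        ring

end Scaling

section Estimates

variable {𝕜 : Type w} [RCLike 𝕜] {E : Type u} [AddCommGroup E] [Module 𝕜 E] [TopologicalSpace E]
  {F : Type v} [AddCommGroup F] [Module 𝕜 F] [TopologicalSpace F]
  {W : Type u'} [AddCommGroup W] [Module 𝕜 W] [TopologicalSpace W]

theorem ScStructure.continuous_sn (s : ScStructure 𝕜 E) (j : ℕ) : Continuous (s.sn j) :=
  (s.level j).continuous.norm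

/-- Tame estimates for a map that is linear in its second variable. -/
theorem LocTame.linear_le {s : ScStructure 𝕜 E} {t : ScStructure 𝕜 W} {s' : ScStructure 𝕜 F}
    {φ : E × W → F} {Z : Set (E × W)} {x₀ : E} {r : ℕ} {δ : ℝ} (hδ : 0 < δ)
    (h : LocTame (s.prod t) s' φ Z (x₀, 0) r δ)
    (hlin : ∀ x, s.sn r (x - x₀) < δ → ∀ (c : 𝕜) v, φ (x, c • v) = c • φ (x, v)) (j : ℕ) :
    ∃ C : ℝ, 0 ≤ C ∧ ∀ x, s.sn r (x - x₀) < δ → ∀ v, s'.sn j (φ (x, v)) ≤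
      C * (t.sn (j + r) v + (1 + s.sn (j + r) (x - x₀)) * t.sn r v) := by
  obtain ⟨C, hC, H⟩ := h.2 j
  have hx0 : 0 ≤ s.sn (j + r) x₀ := apply_nonneg _ _
  refine ⟨C + 2 / δ * (C * (1 + s.sn (j + r) x₀)), by positivity, fun x hx v => ?_⟩
  have hb := le_of_homogeneous (p₁ := t.sn r) (p₂ := t.sn (j + r)) (d := 1)
    (Φ := fun v => s'.sn j (φ (x, v))) (α := C * (1 + s.sn (j + r) x)) (β := C)
    (fun v hv => t.eq_zero_of_sn hv) one_ne_zero
    (fun l v hl => by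
      rw [hlin x hx, map_smul_eq_mul, RCLike.norm_ofReal, abs_of_nonneg hl, pow_one]) hδ
    (fun v hv => by
      have h1 := H (x, v) (by
        rw [ScStructure.sn_prod]
        simpa using max_lt hx hv)
      refine h1.trans ?_
      rw [ScStructure.sn_prod]
      have h2 : max (s.sn (j + r) x) (t.sn (j + r) v) ≤ s.sn (j + r) x + t.sn (j + r) v :=
        max_le_add_of_nonneg (apply_nonneg _ _) (apply_nonneg _ _)
      have h3 := mul_le_mul_of_nonneg_left h2 hC
      change C * (1 + max (s.sn (j + r) x) (t.sn (j + r) v)) ≤ _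
      linarith) v
  refine hb.trans ?_
  rw [pow_one, Nat.sub_self, pow_zero, one_mul]
  have h4 : s.sn (j + r) x ≤ s.sn (j + r) (x - x₀) + s.sn (j + r) x₀ := by
    have := map_add_le_add (s.sn (j + r)) (x - x₀) x₀
    rwa [sub_add_cancel] at this
  have n1 : 0 ≤ t.sn r v := apply_nonneg _ _
  have n2 : 0 ≤ s.sn (j + r) (x - x₀) := apply_nonneg _ _
  have n3 : 0 ≤ t.sn (j + r) v := apply_nonneg _ _
  have h5 : 1 + s.sn (j + r) x ≤ (1 + s.sn (j + r) x₀) * (1 + s.sn (j + r) (x - x₀)) := by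
    nlinarith
  calc _ ≤ 2 / δ * t.sn r v * (C * ((1 + s.sn (j + r) x₀) * (1 + s.sn (j + r) (x - x₀)))) +
        C * t.sn (j + r) v := by gcongr
    _ = C * t.sn (j + r) v + 2 / δ * (C * (1 + s.sn (j + r) x₀)) *
        ((1 + s.sn (j + r) (x - x₀)) * t.sn r v) := by ring
    _ ≤ _ := by
      have a1 : 0 ≤ C * ((1 + s.sn (j + r) (x - x₀)) * t.sn r v) := by positivity
      have a2 : 0 ≤ 2 / δ * (C * (1 + s.sn (j + r) x₀)) * t.sn (j + r) v := by positivity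
      linarith

/-- Tame estimates for a quadratic expression. -/
theorem LocTame.quadratic_le {s : ScStructure 𝕜 E} {s' : ScStructure 𝕜 F}
    {φ : E × (E × E) → F} {Z : Set (E × (E × E))} {x₀ : E} {r : ℕ} {δ : ℝ} (hδ : 0 < δ)
    (h : LocTame (s.prod (s.prod s)) s' φ Z (x₀, 0) r δ)
    (hlin : ∀ x, s.sn r (x - x₀) < δ → ∀ (c : 𝕜) v, φ (x, (c • v, c • v)) = c ^ 2 • φ (x, (v, v)))
    (j : ℕ) :
    ∃ C : ℝ, 0 ≤ C ∧ ∀ x, s.sn r (x - x₀) < δ → ∀ v, s'.sn j (φ (x, (v, v))) ≤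
      C * ((1 + s.sn (j + r) (x - x₀)) * s.sn r v ^ 2 + s.sn (j + r) v * s.sn r v) := by
  obtain ⟨C, hC, H⟩ := h.2 j
  have hx0 : 0 ≤ s.sn (j + r) x₀ := apply_nonneg _ _
  refine ⟨2 / δ * C + (2 / δ) ^ 2 * (C * (1 + s.sn (j + r) x₀)), by positivity, fun x hx v => ?_⟩
  have hb := le_of_homogeneous (p₁ := s.sn r) (p₂ := s.sn (j + r)) (d := 2)
    (Φ := fun v => s'.sn j (φ (x, (v, v)))) (α := C * (1 + s.sn (j + r) x)) (β := C)
    (fun v hv => s.eq_zero_of_sn hv) two_ne_zero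
    (fun l v hl => by
      rw [hlin x hx, map_smul_eq_mul, norm_pow, RCLike.norm_ofReal, abs_of_nonneg hl]) hδ
    (fun v hv => by
      have h1 := H (x, (v, v)) (by
        rw [ScStructure.sn_prod, ScStructure.sn_prod]
        simpa using max_lt hx hv)
      refine h1.trans ?_
      rw [ScStructure.sn_prod, ScStructure.sn_prod]
      have h2 : max (s.sn (j + r) x) (s.sn (j + r) v) ≤ s.sn (j + r) x + s.sn (j + r) v :=
        max_le_add_of_nonneg (apply_nonneg _ _) (apply_nonneg _ _)
      have h3 := mul_le_mul_of_nonneg_left h2 hC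
      change C * (1 + max (s.sn (j + r) x) (max (s.sn (j + r) v) (s.sn (j + r) v))) ≤ _
      rw [max_self]
      linarith) v
  refine hb.trans ?_
  rw [show 2 - 1 = 1 from rfl, pow_one]
  have h4 : s.sn (j + r) x ≤ s.sn (j + r) (x - x₀) + s.sn (j + r) x₀ := by
    have := map_add_le_add (s.sn (j + r)) (x - x₀) x₀
    rwa [sub_add_cancel] at this
  have n1 : 0 ≤ s.sn r v := apply_nonneg _ _
  have n2 : 0 ≤ s.sn (j + r) (x - x₀) := apply_nonneg _ _
  have n3 : 0 ≤ s.sn (j + r) v := apply_nonneg _ _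
  have h5 : 1 + s.sn (j + r) x ≤ (1 + s.sn (j + r) x₀) * (1 + s.sn (j + r) (x - x₀)) := by
    nlinarith
  calc _ ≤ (2 / δ * s.sn r v) ^ 2 * (C * ((1 + s.sn (j + r) x₀) * (1 + s.sn (j + r) (x - x₀)))) +
        2 / δ * s.sn r v * (C * s.sn (j + r) v) := by gcongr
    _ = (2 / δ) ^ 2 * (C * (1 + s.sn (j + r) x₀)) *
        ((1 + s.sn (j + r) (x - x₀)) * s.sn r v ^ 2) +
        2 / δ * C * (s.sn (j + r) v * s.sn r v) := by ring
    _ ≤ _ := by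
      have a1 : 0 ≤ 2 / δ * C * ((1 + s.sn (j + r) (x - x₀)) * s.sn r v ^ 2) := by positivity
      have a2 : 0 ≤ (2 / δ) ^ 2 * (C * (1 + s.sn (j + r) x₀)) * (s.sn (j + r) v * s.sn r v) := by
        positivity
      linarith

/-- The second order Taylor estimate. -/
theorem taylor_le {s : ScStructure 𝕜 E} {s' : ScStructure 𝕜 F} {f : E → F} {D : E → E →L[𝕜] F}
    {DD : E × E → E × E →L[𝕜] F} {U : Set E} (hf : ContinuousOn f U)
    (hD : ∀ x ∈ U, HasGateaux f x (D x))
    (hDc : ContinuousOn (fun p : E × E => D p.1 p.2) (U ×ˢ univ))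
    (hDD : ∀ x ∈ U, ∀ u, HasGateaux (fun p : E × E => D p.1 p.2) (x, u) (DD (x, u))) {x₀ : E}
    {r : ℕ} {δ : ℝ} (hδ : δ ≤ 1) (hU : ∀ x, s.sn r (x - x₀) < δ → x ∈ U) {j : ℕ} {C : ℝ}
    (hC : 0 ≤ C) (H : ∀ x, s.sn r (x - x₀) < δ → ∀ v, s'.sn j (DD (x, v) (v, 0)) ≤
      C * ((1 + s.sn (j + r) (x - x₀)) * s.sn r v ^ 2 + s.sn (j + r) v * s.sn r v)) {x u : E}
    (hx : s.sn r (x - x₀) < δ) (hxu : s.sn r (x + u - x₀) < δ) :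
    s'.sn j (f (x + u) - f x - D x u) ≤
      3 * C * ((1 + s.sn (j + r) (x - x₀)) * s.sn r u ^ 2 + s.sn (j + r) u * s.sn r u) := by
  have := s.isTopologicalAddGroup
  have := s.continuousSMul
  have hball : ∀ t ∈ Icc (0 : ℝ) 1, s.sn r (x + (t : 𝕜) • u - x₀) < δ := by
    intro t ht
    have e : x + (t : 𝕜) • u - x₀ =
        ((1 - t : ℝ) : 𝕜) • (x - x₀) + (t : 𝕜) • (x + u - x₀) := by
      rw [RCLike.ofReal_sub, RCLike.ofReal_one]
      module
    rw [e]
    refine (map_add_le_add _ _ _).trans_lt ?_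
    rw [map_smul_eq_mul, map_smul_eq_mul, RCLike.norm_ofReal, RCLike.norm_ofReal,
      abs_of_nonneg ht.1, abs_of_nonneg (sub_nonneg.2 ht.2)]
    rcases eq_or_lt_of_le ht.1 with h0 | h0
    · rw [← h0]; simpa using hx
    · have := mul_lt_mul_of_pos_left hxu h0
      have := mul_le_mul_of_nonneg_left hx.le (sub_nonneg.2 ht.2)
      linarith
  set R := (1 + s.sn (j + r) (x - x₀)) * s.sn r u ^ 2 + s.sn (j + r) u * s.sn r u with hR
  have n1 : 0 ≤ s.sn r u := apply_nonneg _ _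
  have n2 : 0 ≤ s.sn (j + r) u := apply_nonneg _ _
  have n3 : 0 ≤ s.sn (j + r) (x - x₀) := apply_nonneg _ _
  have hR0 : 0 ≤ R := by positivity
  have hu2 : s.sn r u ≤ 2 := by
    have := map_sub_le_add (s.sn r) (x + u - x₀) (x - x₀)
    rw [sub_sub_sub_cancel_right, add_sub_cancel_left] at this
    linarith
  -- Moving the base point along the segment adds `‖u‖_{j+r} ‖u‖_r²`. As `‖u‖_r ≤ 2` this costs two
  -- more copies of the mixed term, hence the factor `3`.
  have hsecond : ∀ t ∈ Icc (0 : ℝ) 1, s'.sn j (DD (x + (t : 𝕜) • u, u) (u, 0)) ≤ 3 * C * R := by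
    intro t ht
    refine (H _ (hball t ht) u).trans ?_
    have h1 : s.sn (j + r) (x + (t : 𝕜) • u - x₀) ≤ s.sn (j + r) (x - x₀) + s.sn (j + r) u := by
      rw [add_sub_right_comm]
      refine (map_add_le_add _ _ _).trans ?_
      rw [map_smul_eq_mul, RCLike.norm_ofReal, abs_of_nonneg ht.1]
      gcongr
      exact mul_le_of_le_one_left n2 ht.2
    rw [mul_comm 3 C, mul_assoc]
    refine mul_le_mul_of_nonneg_left ?_ hC
    have h2 : s.sn (j + r) u * s.sn r u ^ 2 ≤ 2 * (s.sn (j + r) u * s.sn r u) := by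
      nlinarith [mul_nonneg n2 n1]
    have h3 : (1 + s.sn (j + r) (x + (t : 𝕜) • u - x₀)) * s.sn r u ^ 2 ≤
        (1 + (s.sn (j + r) (x - x₀) + s.sn (j + r) u)) * s.sn r u ^ 2 := by gcongr
    have h4 : 0 ≤ (1 + s.sn (j + r) (x - x₀)) * s.sn r u ^ 2 := by positivity
    rw [hR]
    linarith
  -- The mean value inequality is used twice: for `f` with comparison vector `D x u`, then for `y ↦
  -- D y u` on the segment from `x` to `x + t u`.
  refine HasGateaux.sn_sub_le s' hf hD (fun t ht => hU _ (hball t ht)) fun t ht => ?_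
  have hc' : ContinuousOn (fun y => D y u) U := by
    have h1 : ContinuousOn (fun y : E => (y, u)) U := by fun_prop
    exact hDc.comp h1 fun y hy => ⟨hy, mem_univ _⟩
  have hd' : ∀ y ∈ U, HasGateaux (fun y => D y u) y
      ((DD (y, u)).comp (ContinuousLinearMap.inl 𝕜 E E)) := fun y hy v => by
    refine (hDD y hy u (v, 0)).congr fun τ => ?_
    simp [diffQuot]
  have h1 := HasGateaux.sn_sub_le s' hc' hd' (x := x) (u := (t : 𝕜) • u) (j := j) (c := 0)
    (M := 3 * C * R) (fun τ hτ => ?_) (fun τ hτ => ?_)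
  · rwa [sub_zero] at h1
  · rw [smul_smul, ← RCLike.ofReal_mul]
    exact hU _ (hball _ ⟨mul_nonneg hτ.1 ht.1, mul_le_one₀ hτ.2 ht.1 ht.2⟩)
  · have h2 := hsecond (τ * t) ⟨mul_nonneg hτ.1 ht.1, mul_le_one₀ hτ.2 ht.1 ht.2⟩
    rw [smul_smul, ← RCLike.ofReal_mul, sub_zero, map_smul, map_smul_eq_mul, RCLike.norm_ofReal,
      abs_of_nonneg ht.1]
    exact (mul_le_of_le_one_left (apply_nonneg _ _) ht.2).trans h2

end Estimates

/-! ### The local inverse -/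

/-- Smoothing operators for the seminorms of a structure. -/
def IsSmoothing {𝕜 : Type w} [RCLike 𝕜] {E : Type u} [AddCommGroup E] [Module 𝕜 E]
    [TopologicalSpace E] (s : ScStructure 𝕜 E) (S : ℝ → E → E) (P : ℕ) : Prop :=
  (∀ k l : ℕ, ∃ C : ℝ, 0 ≤ C ∧ ∀ t x, 0 ≤ t →
    s.sn l (S t x) ≤ C * (1 + Real.exp (((P : ℝ) + ((l : ℝ) - k)) * t)) * s.sn k x) ∧
  ∀ k l : ℕ, l + P ≤ k → ∃ C : ℝ, 0 ≤ C ∧ ∀ t x, 0 ≤ t →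
    s.sn l (x - S t x) ≤ C * Real.exp (((P : ℝ) - ((k : ℝ) - l)) * t) * s.sn k x

section LocalInverse

variable {𝕜 : Type w} [RCLike 𝕜] {E : Type u} [AddCommGroup E] [Module 𝕜 E] [TopologicalSpace E]
  {F : Type v} [AddCommGroup F] [Module 𝕜 F] [TopologicalSpace F]

/-- Tame estimates near a point give the data of the Nash–Moser scheme on all smaller balls. -/
theorem exists_nashMoser [PreTame 𝕜 E] [PreTame 𝕜 F] {s : ScStructure 𝕜 E} {s' : ScStructure 𝕜 F}
    (hs : s ∈ Compat 𝕜 E) (hs' : s' ∈ Compat 𝕜 F) {S : ℝ → E → E} {P : ℕ}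
    (hS : IsSmoothing s S P) {U : Set E} (hU : IsOpen U) {f : E → F} (hf : ContinuousOn f U)
    {D : E → E →L[𝕜] F} (hD : ∀ x ∈ U, HasHadamard f x (D x))
    (hD1 : TSc 𝕜 True 1 (fun p : E × E => D p.1 p.2) (U ×ˢ univ)) {ψ : E × F → E}
    (hψ : TameOn 𝕜 ψ (U ×ˢ univ)) {Ψ : E → F →L[𝕜] E} (hΨ : ∀ x ∈ U, ∀ v, Ψ x v = ψ (x, v))
    (hl : ∀ x ∈ U, ∀ u, Ψ x (D x u) = u) (hr : ∀ x ∈ U, ∀ v, D x (Ψ x v) = v) {x₀ : E}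
    {V : Set E} (hV : V ∈ 𝓝 x₀) (hVU : V ⊆ U) :
    ∃ (r₀ : ℕ) (δ₀ : ℝ), 0 < δ₀ ∧ (∀ x, s.sn r₀ (x - x₀) < δ₀ → x ∈ V) ∧
      ∀ r δ, r₀ ≤ r → 0 < δ → δ ≤ δ₀ →
        NashMoser s.sn s'.sn S P f (fun x u => D x u) (fun x v => Ψ x v) x₀ r δ := by
  have hx₀ : x₀ ∈ U := hVU (mem_of_mem_nhds hV)
  have hU' : IsOpen (U ×ˢ (univ : Set E)) := hU.prod isOpen_univ
  have hpart : TameOn 𝕜 (partialDeriv 𝕜 U fun p : E × E => D p.1 p.2) (U ×ˢ univ) :=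
    (hD1.partialDeriv hU).sc0.2 trivial
  have hdiff : TameOn 𝕜 (fun p : E × E => D p.1 p.2) (U ×ˢ univ) := hD1.sc0.2 trivial
  have hDc := hD1.sc0.1.continuousOn
  obtain ⟨-, DD, hDD, -⟩ := hD1
  obtain ⟨r₁, δ₁, hδ₁, h₁⟩ := (tameOn_iff (compat_prod hs hs') hs).1 hψ (x₀, 0) ⟨hx₀, mem_univ _⟩
  obtain ⟨r₂, δ₂, hδ₂, h₂⟩ := (tameOn_iff (compat_prod hs hs) hs').1 hdiff (x₀, 0) ⟨hx₀, mem_univ _⟩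
  obtain ⟨r₃, δ₃, hδ₃, h₃⟩ := (tameOn_iff (compat_prod hs (compat_prod hs hs)) hs').1 hpart
    (x₀, 0) ⟨hx₀, mem_univ _⟩
  obtain ⟨r₄, δ₄, hδ₄, h₄⟩ := s.mem_nhds_iff.1 hV
  refine ⟨r₁ + r₂ + r₃ + r₄, min (min δ₁ δ₂) (min (min δ₃ δ₄) 1), by positivity, fun x hx => h₄ x
    ((s.sn_mono (by omega) _).trans_lt (hx.trans_le ((min_le_right _ _).trans
      ((min_le_left _ _).trans (min_le_right _ _))))), fun r δ hr₀ hδ hδ₀ => ?_⟩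
  obtain ⟨⟨hδ1, hδ2⟩, ⟨hδ3, hδ4⟩, hδ5⟩ : (δ ≤ δ₁ ∧ δ ≤ δ₂) ∧ (δ ≤ δ₃ ∧ δ ≤ δ₄) ∧ δ ≤ 1 := by
    simpa [le_min_iff] using hδ₀
  replace h₁ := h₁.mono (show r₁ ≤ r by omega) hδ1
  replace h₂ := h₂.mono (show r₂ ≤ r by omega) hδ2
  replace h₃ := h₃.mono (show r₃ ≤ r by omega) hδ3
  have hball : ∀ x, s.sn r (x - x₀) < δ → x ∈ U := fun x hx => hVU (h₄ x
    ((s.sn_mono (show r₄ ≤ r by omega) _).trans_lt (hx.trans_le hδ4)))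
  have hpd : ∀ x ∈ U, ∀ u v, partialDeriv 𝕜 U (fun p : E × E => D p.1 p.2) (x, (u, v)) =
      DD (x, u) (v, 0) := fun x hx u v => by
    rw [partialDeriv, (hDD (x, u) ⟨hx, mem_univ _⟩).scDeriv_eq hU' hDc ⟨hx, mem_univ _⟩]
  -- One factor `c` comes from linearity of the derivative in its direction. The other comes from
  -- differentiating `y ↦ D y (c • u) = c • D y u`.
  have hquad : ∀ x ∈ U, ∀ (c : 𝕜) (u : E), DD (x, c • u) (c • u, 0) = c ^ 2 • DD (x, u) (u, 0) := by
    intro x hx c u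
    have := s'.isTopologicalAddGroup
    have := s'.continuousSMul
    have := s'.t2Space
    have e1 : DD (x, c • u) (u, 0) = c • DD (x, u) (u, 0) := by
      refine tendsto_nhds_unique ((hDD (x, c • u) ⟨hx, mem_univ _⟩).hasGateaux (u, 0)) ?_
      refine (((hDD (x, u) ⟨hx, mem_univ _⟩).hasGateaux (u, 0)).const_smul c).congr fun t => ?_
      simp only [diffQuot, Prod.smul_mk, Prod.mk_add_mk, smul_zero, add_zero, map_smul]
      rw [← smul_sub, smul_comm]
    have e2 : ((c • u, 0) : E × E) = c • (u, 0) := by simp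
    rw [e2, map_smul, e1, smul_smul, sq]
  refine ⟨s.sn_mono, s'.sn_mono, fun x hx => s.eq_zero_of_sn hx, fun x hx => s'.eq_zero_of_sn hx,
    hS.1, hS.2, hδ, hδ5, fun j => ?_, fun j => ?_, fun j => ?_, fun x _ u u' => map_sub _ _ _,
    fun x hx => hr x (hball x hx), fun x hx => hl x (hball x hx)⟩
  · obtain ⟨C, hC, H⟩ := h₁.linear_le hδ (fun x hx c v => by
      rw [← hΨ x (hball x hx), ← hΨ x (hball x hx), map_smul]) j
    exact ⟨C, hC, fun x hx v => by rw [hΨ x (hball x hx)]; exact H x hx v⟩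
  · obtain ⟨C, hC, H⟩ := h₂.linear_le hδ (fun x hx c v => by simp) j
    exact ⟨C, hC, H⟩
  · obtain ⟨C, hC, H⟩ := h₃.quadratic_le hδ (fun x hx c v => by
      rw [hpd x (hball x hx), hpd x (hball x hx), hquad x (hball x hx)]) j
    refine ⟨3 * C, by positivity, fun x u hx hxu => ?_⟩
    refine taylor_le hf (fun x hx => (hD x hx).hasGateaux) hDc
      (fun x hx u => (hDD (x, u) ⟨hx, mem_univ _⟩).hasGateaux) hδ5 hball hC
      (fun x hx v => ?_) hx hxu
    rw [← hpd x (hball x hx)]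
    exact H x hx v

/-- The conclusion of the Nash–Moser scheme: solutions `g y` of `f (g y) = y`, with tame estimates,
that depend in a Lipschitz way on `y` in the weakest norm. -/
structure TameSolution (s : ScStructure 𝕜 E) (s' : ScStructure 𝕜 F) (f : E → F) (x₀ : E) (g : F → E)
    (b r : ℕ) (ε C : ℝ) (K : ℕ → ℝ) : Prop where
  r_le : r ≤ b
  ε_pos : 0 < ε
  C_nonneg : 0 ≤ C
  K_nonneg : ∀ j, 0 ≤ K j
  apply_center : g (f x₀) = x₀
  sn_le : ∀ y, s'.sn b (y - f x₀) < ε → ∀ j,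
    s.sn j (g y - x₀) ≤ K j * (1 + s'.sn (j + b) (y - f x₀))
  lipschitz : ∀ y y', s'.sn b (y - f x₀) < ε → s'.sn b (y' - f x₀) < ε →
    s.sn 0 (g y' - g y) ≤ C * s'.sn r (y' - y)

theorem TameSolution.tameNear {s : ScStructure 𝕜 E} {s' : ScStructure 𝕜 F} {f : E → F} {x₀ : E}
    {g : F → E} {b r : ℕ} {ε C : ℝ} {K : ℕ → ℝ} (h : TameSolution s s' f x₀ g b r ε C K) :
    TameNear s' s g {y | s'.sn b (y - f x₀) < ε} (f x₀) := by
  refine ⟨b, ε, h.ε_pos, fun y hy => hy, fun j => ?_⟩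
  have hK := h.K_nonneg j
  have n1 : 0 ≤ s.sn j x₀ := apply_nonneg _ _
  have n2 : 0 ≤ s'.sn (j + b) (f x₀) := apply_nonneg _ _
  refine ⟨s.sn j x₀ + K j * (1 + s'.sn (j + b) (f x₀)), by positivity, fun y hy => ?_⟩
  have h1 := map_add_le_add (s.sn j) (g y - x₀) x₀
  rw [sub_add_cancel] at h1
  have h2 := h.sn_le y hy j
  have h3 := mul_le_mul_of_nonneg_left (map_sub_le_add (s'.sn (j + b)) y (f x₀)) hK
  have n3 : 0 ≤ s'.sn (j + b) y := apply_nonneg _ _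
  have n4 := mul_nonneg n1 n3
  have n5 := mul_nonneg (mul_nonneg hK n2) n3
  nlinarith

/-- A nearby value changes `g` little in the weakest norm, by the Lipschitz bound, while the high
norms stay bounded by tameness. Interpolation with `t` chosen first, making the high-norm term
small, then gives continuity in norm `j`; the loss `b + P + 1` adds the levels used by interpolation
to the loss of the tame bound. -/
theorem TameSolution.contNear {s : ScStructure 𝕜 E} {s' : ScStructure 𝕜 F} {f : E → F} {x₀ : E}
    {g : F → E} {b r : ℕ} {ε C : ℝ} {K : ℕ → ℝ} (h : TameSolution s s' f x₀ g b r ε C K) {P : ℕ}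
    (hI : ∀ j, ∃ C : ℝ, 0 ≤ C ∧ ∀ t w, 0 ≤ t → s.sn j w ≤
      C * (Real.exp (((P + j : ℕ) : ℝ) * t) * s.sn 0 w + Real.exp (-t) * s.sn (j + P + 1) w)) :
    ContNear s' s g {y | s'.sn b (y - f x₀) < ε} (f x₀) := by
  have hb : ∀ y, s'.sn (b + P + 1) (y - f x₀) < ε → s'.sn b (y - f x₀) < ε := fun y hy =>
    (s'.sn_mono (by omega) _).trans_lt hy
  refine ⟨b + P + 1, ε, h.ε_pos, fun y hy => ⟨hb y hy, fun j ε' hε' => ?_⟩⟩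
  obtain ⟨C', hC', H⟩ := hI j
  set a := s'.sn (j + P + 1 + b) (y - f x₀) with ha
  have ha0 : 0 ≤ a := apply_nonneg _ _
  have hK := h.K_nonneg (j + P + 1)
  set R := K (j + P + 1) * (2 + a) + K (j + P + 1) * (1 + a) with hR
  obtain ⟨t, ht0, ht⟩ : ∃ t : ℝ, 0 ≤ t ∧ C' * (Real.exp (-t) * R) < ε' / 2 := by
    have e1 : Tendsto (fun t : ℝ => C' * (Real.exp (-t) * R)) atTop (𝓝 (C' * (0 * R))) :=
      ((Real.tendsto_exp_neg_atTop_nhds_zero).mul_const R).const_mul C'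
    rw [zero_mul, mul_zero] at e1
    exact ((eventually_ge_atTop (0 : ℝ)).and (e1.eventually_lt_const (half_pos hε'))).exists
  set c := C' * (Real.exp (((P + j : ℕ) : ℝ) * t) * C) with hc
  have hc0 : 0 ≤ c := by have := h.C_nonneg; positivity
  refine ⟨min 1 (ε' / (2 * (c + 1))), by positivity, fun y' hy' hyy => ?_⟩
  have hy1 : s'.sn (j + P + 1 + b) (y' - y) < 1 := by
    rw [show j + P + 1 + b = j + (b + P + 1) by omega]
    exact hyy.trans_le (min_le_left _ _)
  have hy2 : s'.sn r (y' - y) < ε' / (2 * (c + 1)) :=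
    (s'.sn_mono (show r ≤ j + (b + P + 1) by have := h.r_le; omega) _).trans_lt
      (hyy.trans_le (min_le_right _ _))
  set w := g y' - g y with hw
  have h0 : s.sn 0 w ≤ C * s'.sn r (y' - y) := h.lipschitz y y' (hb y hy) (hb y' hy')
  have h1 : s.sn (j + P + 1) w ≤ R := by
    have e1 := map_sub_le_add (s.sn (j + P + 1)) (g y' - x₀) (g y - x₀)
    rw [sub_sub_sub_cancel_right] at e1
    have e2 := h.sn_le y (hb y hy) (j + P + 1)
    have e3 := h.sn_le y' (hb y' hy') (j + P + 1)
    have e4 : s'.sn (j + P + 1 + b) (y' - f x₀) ≤ 1 + a := by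
      have := map_add_le_add (s'.sn (j + P + 1 + b)) (y' - y) (y - f x₀)
      rw [sub_add_sub_cancel] at this
      linarith
    have e5 : K (j + P + 1) * (1 + s'.sn (j + P + 1 + b) (y' - f x₀)) ≤
        K (j + P + 1) * (2 + a) := mul_le_mul_of_nonneg_left (by linarith) hK
    rw [hR]
    linarith
  calc s.sn j w ≤ C' * (Real.exp (((P + j : ℕ) : ℝ) * t) * (C * s'.sn r (y' - y)) +
        Real.exp (-t) * R) := (H t w ht0).trans (by gcongr)
    _ = c * s'.sn r (y' - y) + C' * (Real.exp (-t) * R) := by rw [hc]; ring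
    _ < ε' := by
      rw [lt_div_iff₀ (by positivity)] at hy2
      have n := apply_nonneg (s'.sn r) (y' - y)
      nlinarith

/-- By the Lipschitz bound and the power `3/2` in `hQ`, the Taylor remainder at `g(y₀ + t v)` is
`O(t^{3/2})`. Applying `Λ` to `t v = L (g(y₀ + t v) - x₀) + Q` and dividing by `t` gives the limit
`Λ v`. -/
theorem TameSolution.hasHadamard {s : ScStructure 𝕜 E} {s' : ScStructure 𝕜 F} {f : E → F} {x₀ : E}
    {g : F → E} {b r : ℕ} {ε C : ℝ} {K : ℕ → ℝ} (h : TameSolution s s' f x₀ g b r ε C K)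
    (hfg : ∀ y, s'.sn b (y - f x₀) < ε → f (g y) = y) {L : E →L[𝕜] F} {Λ : F →L[𝕜] E}
    (hΛ : ∀ u, Λ (L u) = u)
    (hQ : ∀ j, ∃ (M : ℕ) (C : ℝ), 0 ≤ C ∧ ∀ y, s'.sn b (y - f x₀) < ε →
      s'.sn j (f (g y) - f x₀ - L (g y - x₀)) ≤
        C * (1 + s.sn M (g y - x₀)) ^ 2 * (s.sn 0 (g y - x₀) * √(s.sn 0 (g y - x₀)))) :
    HasHadamard g (f x₀) Λ := by
  have := s'.isTopologicalAddGroup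
  have := s'.continuousSMul
  intro v
  set y₀ := f x₀ with hy₀
  let Q : ℝ × F → F := fun z =>
    f (g (y₀ + (z.1 : 𝕜) • z.2)) - y₀ - L (g (y₀ + (z.1 : 𝕜) • z.2) - x₀)
  have hnear : ∀ᶠ z : ℝ × F in 𝓝[>] 0 ×ˢ 𝓝 v, s'.sn b (y₀ + (z.1 : 𝕜) • z.2 - y₀) < ε :=
    (s'.tendsto_iff.1 (tendsto_add_smul (𝕜 := 𝕜) y₀ v) b).eventually_lt_const h.ε_pos
  have hQ0 : Tendsto (fun z : ℝ × F => (z.1 : 𝕜)⁻¹ • Q z) (𝓝[>] 0 ×ˢ 𝓝 v) (𝓝 0) := by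
    refine s'.tendsto_iff.2 fun j => ?_
    simp only [sub_zero]
    obtain ⟨M, C', hC', H⟩ := hQ j
    have hC := h.C_nonneg
    have hK := h.K_nonneg M
    have hcont : Continuous fun z : ℝ × F => C' * (1 + K M * (1 + z.1 * s'.sn (M + b) z.2)) ^ 2 *
        (C * s'.sn r z.2 * √(C * (z.1 * s'.sn r z.2))) := by
      have c1 := (s'.continuous_sn (M + b)).comp (continuous_snd (X := ℝ) (Y := F))
      have c2 := (s'.continuous_sn r).comp (continuous_snd (X := ℝ) (Y := F))
      have c3 : Continuous fun z : ℝ × F => z.1 := continuous_fst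
      have c4 : Continuous fun z : ℝ × F => √(C * (z.1 * s'.sn r z.2)) :=
        Real.continuous_sqrt.comp (continuous_const.mul (c3.mul c2))
      exact (continuous_const.mul ((continuous_const.add (continuous_const.mul
        (continuous_const.add (c3.mul c1)))).pow 2)).mul ((continuous_const.mul c2).mul c4)
    have hlim := (hcont.tendsto (0, v)).mono_left
      (show 𝓝[>] (0 : ℝ) ×ˢ 𝓝 v ≤ 𝓝 (0, v) by
        rw [nhds_prod_eq]; exact Filter.prod_mono nhdsWithin_le_nhds le_rfl)
    simp only [zero_mul, mul_zero, Real.sqrt_zero] at hlim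
    refine squeeze_zero' (Eventually.of_forall fun z => apply_nonneg _ _) ?_ hlim
    filter_upwards [hnear, eventually_pos_fst v] with z hz hz0
    have hsn : ∀ i, s'.sn i (y₀ + (z.1 : 𝕜) • z.2 - y₀) = z.1 * s'.sn i z.2 := fun i => by
      rw [add_sub_cancel_left, map_smul_eq_mul, RCLike.norm_ofReal, abs_of_pos hz0]
    have e1 := H _ hz
    have e2 := h.sn_le _ hz M
    rw [hsn] at e2
    have e3 : s.sn 0 (g (y₀ + (z.1 : 𝕜) • z.2) - x₀) ≤ C * (z.1 * s'.sn r z.2) := by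
      have := h.lipschitz y₀ _ (by rw [hy₀, sub_self, map_zero]; exact h.ε_pos) hz
      rwa [h.apply_center, hsn] at this
    rw [map_smul_eq_mul, norm_inv, RCLike.norm_ofReal, abs_of_pos hz0]
    have n1 : 0 ≤ s.sn M (g (y₀ + (z.1 : 𝕜) • z.2) - x₀) := apply_nonneg _ _
    have n2 : 0 ≤ s'.sn r z.2 := apply_nonneg _ _
    have n3 : 0 ≤ s.sn 0 (g (y₀ + (z.1 : 𝕜) • z.2) - x₀) := apply_nonneg _ _
    calc z.1⁻¹ * s'.sn j (Q z) ≤ z.1⁻¹ * (C' * (1 + K M * (1 + z.1 * s'.sn (M + b) z.2)) ^ 2 *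
          (C * (z.1 * s'.sn r z.2) * √(C * (z.1 * s'.sn r z.2)))) := by
          refine mul_le_mul_of_nonneg_left (e1.trans ?_) (by positivity)
          gcongr
      _ = _ := by field_simp
  have h1 : Tendsto (fun z : ℝ × F => z.2 - (z.1 : 𝕜)⁻¹ • Q z) (𝓝[>] 0 ×ˢ 𝓝 v) (𝓝 v) := by
    have h2 : Tendsto (fun z : ℝ × F => z.2) (𝓝[>] 0 ×ˢ 𝓝 v) (𝓝 v) := tendsto_snd
    simpa using h2.sub hQ0
  refine ((Λ.continuous.tendsto v).comp h1).congr' ?_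
  filter_upwards [hnear, eventually_pos_fst v] with z hz hz0
  have hz' : (z.1 : 𝕜) ≠ 0 := by exact_mod_cast hz0.ne'
  have e : z.2 - (z.1 : 𝕜)⁻¹ • Q z = (z.1 : 𝕜)⁻¹ • L (g (y₀ + (z.1 : 𝕜) • z.2) - x₀) := by
    simp only [Q]
    rw [hfg _ hz, add_sub_cancel_left, smul_sub, inv_smul_smul₀ hz', sub_sub_cancel]
  simp only [Function.comp]
  rw [e, map_smul, hΛ, diffQuot, h.apply_center]

/-- The local inverse function theorem, with continuity, tame estimates and the derivative of the
inverse at the centre. -/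
theorem exists_localInverse [PreTame 𝕜 E] [PreTame 𝕜 F] {s : ScStructure 𝕜 E}
    {s' : ScStructure 𝕜 F} (hs : s ∈ Compat 𝕜 E) (hs' : s' ∈ Compat 𝕜 F) {S : ℝ → E → E} {P : ℕ}
    (hS : IsSmoothing s S P) {U : Set E} (hU : IsOpen U) {f : E → F} (hf : ContinuousOn f U)
    {D : E → E →L[𝕜] F} (hD : ∀ x ∈ U, HasHadamard f x (D x))
    (hD1 : TSc 𝕜 True 1 (fun p : E × E => D p.1 p.2) (U ×ˢ univ)) {ψ : E × F → E}
    (hψ : TameOn 𝕜 ψ (U ×ˢ univ)) {Ψ : E → F →L[𝕜] E} (hΨ : ∀ x ∈ U, ∀ v, Ψ x v = ψ (x, v))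
    (hl : ∀ x ∈ U, ∀ u, Ψ x (D x u) = u) (hr : ∀ x ∈ U, ∀ v, D x (Ψ x v) = v) {x₀ : E}
    {V : Set E} (hV : V ∈ 𝓝 x₀) (hVU : V ⊆ U) :
    ∃ V' ⊆ V, x₀ ∈ V' ∧ ∃ g : F → E, IsLocalInverse f V' g ∧ ContNear s' s g (f '' V') (f x₀) ∧
      TameNear s' s g (f '' V') (f x₀) ∧ HasHadamard g (f x₀) (Ψ x₀) := by
  obtain ⟨r₀, δ₀, hδ₀, hball, hNM⟩ := exists_nashMoser hs hs' hS hU hf hD hD1 hψ hΨ hl hr hV hVU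
  have h₀ := hNM r₀ δ₀ le_rfl hδ₀ le_rfl
  obtain ⟨M, δ', C, hM, hδ', hδ'₀, hC, hstab⟩ := h₀.stability
  -- The scheme is run again with the norm index `M` and radius `δ'` of the stability estimate, so
  -- that the solutions lie where they are unique.
  obtain ⟨b, ε, K, hMb, hε, hK, hsol⟩ := (hNM M δ' hM hδ' hδ'₀).exists_solution fun a ha => by
    obtain ⟨x, hx⟩ := s.exists_tendsto a ha
    exact ⟨x, s.tendsto_iff.1 hx⟩
  choose! g hgM hfg hgK using hsol
  have hballV : ∀ x, s.sn M (x - x₀) < δ' → x ∈ V := fun x hx =>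
    hball x ((s.sn_mono hM _).trans_lt (hx.trans_le hδ'₀))
  have hinj : ∀ x₁ x₂, s.sn M (x₁ - x₀) < δ' → s.sn M (x₂ - x₀) < δ' → f x₁ = f x₂ → x₁ = x₂ := by
    intro x₁ x₂ h₁ h₂ he
    have := hstab x₁ x₂ h₁ h₂
    rw [he, sub_self, map_zero, mul_zero] at this
    exact (sub_eq_zero.1 (s.eq_zero_of_sn (le_antisymm this (apply_nonneg _ _)))).symm
  have hc0 : s'.sn b (f x₀ - f x₀) < ε := by simpa using hε
  have hx0M : s.sn M (x₀ - x₀) < δ' := by simpa using hδ'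
  have hg0 : g (f x₀) = x₀ := hinj _ _ (hgM _ hc0) hx0M (hfg _ hc0)
  have hsolution : TameSolution s s' f x₀ g b r₀ ε C K :=
    ⟨hM.trans hMb, hε, hC, hK, hg0, hgK, fun y y' hy hy' => by
      have := hstab (g y) (g y') (hgM y hy) (hgM y' hy')
      rwa [hfg y hy, hfg y' hy'] at this⟩
  -- Imposing the condition on `f x` as well makes the image exactly a ball around `f x₀`, hence
  -- open.
  set V' := {x | s.sn M (x - x₀) < δ' ∧ s'.sn b (f x - f x₀) < ε} with hV'
  have himage : f '' V' = {y | s'.sn b (y - f x₀) < ε} := by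
    ext y
    constructor
    · rintro ⟨x, hx, rfl⟩
      exact hx.2
    · intro hy
      refine ⟨g y, ⟨hgM y hy, ?_⟩, hfg y hy⟩
      rw [hfg y hy]
      exact hy
  have := s.isTopologicalAddGroup
  have := s'.isTopologicalAddGroup
  have hopen : IsOpen V' := by
    refine isOpen_iff_mem_nhds.2 fun x hx => ?_
    have h1 : ContinuousAt (fun x => s.sn M (x - x₀)) x :=
      ((s.continuous_sn M).comp (continuous_sub_right x₀)).continuousAt
    have h2 : ContinuousAt (fun x => s'.sn b (f x - f x₀)) x :=
      ((s'.continuous_sn b).comp (continuous_sub_right (f x₀))).continuousAt.comp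
        (hf.continuousAt (hU.mem_nhds (hVU (hballV x hx.1))))
    exact (h1.eventually_lt_const hx.1).and (h2.eventually_lt_const hx.2)
  have hopen' : IsOpen (f '' V') := by
    rw [himage]
    exact isOpen_lt ((s'.continuous_sn b).comp (continuous_sub_right (f x₀))) continuous_const
  refine ⟨V', fun x hx => hballV x hx.1, ⟨hx0M, hc0⟩, g, ⟨hopen, hopen', ?_, ?_, ?_⟩, ?_, ?_, ?_⟩
  · rw [himage]
    intro y hy
    refine ⟨hgM y hy, ?_⟩
    rw [hfg y hy]
    exact hy
  · intro x hx
    exact hinj _ _ (hgM _ hx.2) hx.1 (hfg _ hx.2)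
  · rw [himage]
    exact fun y hy => hfg y hy
  · rw [himage]
    exact hsolution.contNear h₀.interpolation
  · rw [himage]
    exact hsolution.tameNear
  · refine hsolution.hasHadamard hfg (hl x₀ (hVU (mem_of_mem_nhds hV))) fun j => ?_
    obtain ⟨M', C', hC', H⟩ := h₀.quadratic_le j
    refine ⟨M', C', hC', fun y hy => ?_⟩
    have := H (g y - x₀) ((s.sn_mono hM _).trans_lt ((hgM y hy).trans_le hδ'₀))
    rwa [add_sub_cancel] at this

end LocalInverse

/-! ### The inverse function theorem -/

section InverseFunction

variable {𝕜 : Type w} [RCLike 𝕜] {E : Type u} [AddCommGroup E] [Module 𝕜 E] [TopologicalSpace E]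
  [PreTame 𝕜 E] {F : Type v} [AddCommGroup F] [Module 𝕜 F] [TopologicalSpace F] [PreTame 𝕜 F]

theorem TSc.hasHadamard_and_differential {τ : Prop} {n : ℕ} {f : E → F} {U : Set E} (hU : IsOpen U)
    (h : TSc 𝕜 τ (n + 1) f U) : (∀ x ∈ U, HasHadamard f x (scDeriv 𝕜 f U x)) ∧
      TSc 𝕜 τ n (fun p : E × E => scDeriv 𝕜 f U p.1 p.2) (U ×ˢ univ) := by
  obtain ⟨h0, D, hD, h⟩ := h
  have he : ∀ x ∈ U, scDeriv 𝕜 f U x = D x := fun x hx =>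
    (hD x hx).scDeriv_eq hU h0.1.continuousOn hx
  refine ⟨fun x hx => he x hx ▸ hD x hx, h.congr (hU.prod isOpen_univ) fun p hp => ?_⟩
  rw [he p.1 hp.1]

theorem IsWeaklyTameSpace.exists_isSmoothing (hE : IsWeaklyTameSpace 𝕜 E) :
    ∃ s ∈ Compat 𝕜 E, ∃ S P, IsSmoothing s S P := by
  obtain ⟨s, hs, S, P, c, hc, h1, h2⟩ := hE.exists_smoothing
  exact ⟨s, hs, S, P, fun k l => ⟨c k l, hc k l, h1 k l⟩,
    fun k l hkl => ⟨c k l, hc k l, fun t x ht => h2 k l t x ht hkl⟩⟩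

/-- Any local inverse agrees near each point with the one found by the iteration, and hence is
continuous and tame with the expected derivative. -/
theorem IsLocalInverse.sc0_and_hasHadamard {s : ScStructure 𝕜 E} {s' : ScStructure 𝕜 F}
    (hs : s ∈ Compat 𝕜 E) (hs' : s' ∈ Compat 𝕜 F) {f : E → F} {V : Set E} {g : F → E}
    (h : IsLocalInverse f V g) {Ψ : E → F →L[𝕜] E}
    (H : ∀ x ∈ V, ∃ V' ⊆ V, x ∈ V' ∧ ∃ g' : F → E, IsLocalInverse f V' g' ∧
      ContNear s' s g' (f '' V') (f x) ∧ TameNear s' s g' (f '' V') (f x) ∧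
      HasHadamard g' (f x) (Ψ x)) :
    Sc0 𝕜 True g (f '' V) ∧ ∀ y ∈ f '' V, HasHadamard g y (Ψ (g y)) := by
  have := s'.isTopologicalAddGroup
  have := s'.continuousSMul
  obtain ⟨-, hfV, -, hgf, -⟩ := h
  have key : ∀ x ∈ V, ContNear s' s g (f '' V) (f x) ∧ TameNear s' s g (f '' V) (f x) ∧
      HasHadamard g (f x) (Ψ x) := by
    intro x hx
    obtain ⟨V', hV'V, hxV', g', ⟨-, hfV', -, hgf', -⟩, ⟨r, δ, hδ, hc⟩, ⟨r', δ', hδ', ht⟩,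
      hd⟩ := H x hx
    -- Both maps invert `f` on `f(V')`, and `V' ⊆ V`.
    have heq : EqOn g' g (f '' V') := by
      rintro _ ⟨z, hz, rfl⟩
      rw [hgf' z hz, hgf z (hV'V hz)]
    have hn := hfV.mem_nhds (mem_image_of_mem f hx)
    exact ⟨ContNear.restrict ⟨r, δ, hδ, hc.congr heq⟩ hn,
      TameNear.restrict ⟨r', δ', hδ', ht.congr heq⟩ hn,
      hd.congr (heq.eventuallyEq_of_mem (hfV'.mem_nhds (mem_image_of_mem f hxV')))⟩
  refine ⟨⟨(scContinuousOn_iff hs' hs).2 ?_, fun _ => (tameOn_iff hs' hs).2 ?_⟩, ?_⟩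
  · rintro _ ⟨x, hx, rfl⟩
    exact (key x hx).1
  · rintro _ ⟨x, hx, rfl⟩
    exact (key x hx).2.1
  · rintro _ ⟨x, hx, rfl⟩
    rw [hgf x hx]
    exact (key x hx).2.2

end InverseFunction

theorem theorem3p1 {𝕜 : Type w} [RCLike 𝕜]
    {E : Type u} [AddCommGroup E] [Module 𝕜 E] [TopologicalSpace E] [PreTame 𝕜 E]
    {E' : Type v} [AddCommGroup E'] [Module 𝕜 E'] [TopologicalSpace E'] [PreTame 𝕜 E']
    (hE : IsWeaklyTameSpace 𝕜 E) (κ : DiffKind) (k : ℕ∞) (hk : 2 ≤ k)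
    (U : Set E) (hU : IsOpen U) (f : E → E')
    (hf : ScDiffOn 𝕜 κ k f U) (hft : TameUpTo 𝕜 k f U)
    (ψ : E × E' → E) (hψ : IsInverseFamily 𝕜 f U ψ)
    (hψc : ScContinuousOn 𝕜 ψ (U ×ˢ Set.univ)) (hψt : TameOn 𝕜 ψ (U ×ˢ Set.univ)) :
    (∀ x ∈ U, ∃ V ⊆ U, x ∈ V ∧ ∃ g : E' → E, IsLocalInverse f V g) ∧
    ∀ V ⊆ U, ∀ g : E' → E, IsLocalInverse f V g →
      ScDiffOn 𝕜 κ k g (f '' V) ∧ TameUpTo 𝕜 k g (f '' V) ∧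
      ∀ y ∈ f '' V, ∀ v, scDifferential 𝕜 g (f '' V) (y, v) = ψ (g y, v) := by
  obtain ⟨s, hs, S, P, hS⟩ := hE.exists_isSmoothing
  obtain ⟨s', hs'⟩ := exists_compat 𝕜 E'
  have hfT : ∀ n : ℕ, (n : ℕ∞) ≤ k → TSc 𝕜 True n f U := fun n hn =>
    tsc_of_tameUpToNat hU (hf n hn) (hft n hn)
  have hf2 : TSc 𝕜 True 2 f U := hfT 2 (by exact_mod_cast hk)
  obtain ⟨hD, hD1⟩ := hf2.hasHadamard_and_differential hU
  obtain ⟨Ψ, hΨ⟩ := exists_clm_of_isLinearMap (fun x hx => (hψ x hx).1) hψc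
  have hl : ∀ x ∈ U, ∀ u, Ψ x (scDeriv 𝕜 f U x u) = u := fun x hx u =>
    (hΨ x hx _).trans ((hψ x hx).2.1 u)
  have hr : ∀ x ∈ U, ∀ v, scDeriv 𝕜 f U x (Ψ x v) = v := fun x hx v => by
    rw [hΨ x hx]
    exact (hψ x hx).2.2 v
  -- Every point of every open subset is admitted as centre. Part 2 needs this, because the
  -- construction yields the derivative of the inverse only at the image of the centre.
  have hloc := fun (V : Set E) (hV : IsOpen V) (hVU : V ⊆ U) (x : E) (hx : x ∈ V) =>
    exists_localInverse hs hs' hS hU hf2.sc0.1.continuousOn hD hD1 hψt hΨ hl hr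
      (hV.mem_nhds hx) hVU
  refine ⟨fun x hx => ?_, fun V hVU g hg => ?_⟩
  · obtain ⟨V, hVU, hxV, g, hg, -⟩ := hloc U hU subset_rfl x hx
    exact ⟨V, hVU, hxV, g, hg⟩
  obtain ⟨hg0, hgd⟩ := hg.sc0_and_hasHadamard hs hs' (hloc V hg.1 hVU)
  have hfV := hg.2.1
  have hgU : MapsTo g (f '' V) U := hg.2.2.1.mono_right hVU
  have hgT : ∀ n : ℕ, (n : ℕ∞) ≤ k → TSc 𝕜 True n g (f '' V) := by
    intro n hn
    cases n with
    | zero => exact hg0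
    | succ n =>
      -- Order `n + 1` of `f` gives order `n` of `Df`, hence of `ψ`, hence order `n + 1` of `g`.
      exact tsc_inverse hfV hg0 hgU hΨ hgd
        (tsc_inverseFamily hU ((hfT _ hn).hasHadamard_and_differential hU).2 hΨ
          ⟨hψc, fun _ => hψt⟩ hl hr)
  refine ⟨fun n hn => (hgT n hn).scDiffNat hfV, fun n hn => (hgT n hn).tameUpToNat hfV,
    fun y hy v => ?_⟩
  rw [scDifferential, (hgd y hy).scDeriv_eq hfV hg0.1.continuousOn hy, hΨ _ (hgU hy)]
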